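/- For $\varepsilon>0$ let $K_\varepsilon(u)=u^{-\varepsilon}+u^{1+\varepsilon}$, and for $g:(0,\infty)\to\mathbb C$ let $\widehat g(s)=\int_0^\infty g(u)u^s\,\frac{du}{u}$ and $g^\tau(x)=\frac1x g(\frac1x)$. Let $(E)$ be the class of continuous functions $g:(0,\infty)\to\mathbb C$ for which there is an $\varepsilon>0$ such that $gK_\varepsilon$ has bounded total variation on $(0,\infty)$ and $$\int_{\mathrm{Re}(s)=c}|\widehat g(s)|\,\log|\mathrm{Im}(s)|\,|ds|<\infty\quad\text{(absolutely convergent)}\qquad\text{for all } c \text{ with } -\varepsilon<c<1+\varepsilon .$$ **Theorem.** (1) $(E)$ is stable under multiplicative convolution: if $g,k\in(E)$, then $(g*k)(u)=\int_0^\infty g(t)\,k(u/t)\,\frac{dt}{t}$ converges absolutely for every $u>0$, and $g*k\in(E)$. (2) $(E)$ is stable under the transpose: if $g\in(E)$, then $g^\tau\in(E)$. (3) For each $g\in(E)$ the explicit formula holds: the limit below exists, and $$\widehat g(0)+\widehat g(1)-\lim_{T\to\infty}\sum_{|\mathrm{Im}(\rho)|<T}\widehat g(\rho)=\sum_p W_p(g)+W_r(g),$$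 where $\rho$ runs over the zeros of the Riemann zeta function with $0<\mathrm{Re}(\rho)<1$, counted with multiplicity, $p$ runs over the primes, and $$W_p(g)=\log(p)\sum_{k\ge1}g(p^k)+\log(p)\sum_{k\ge1}\frac1{p^k}\,g\!\left(\frac1{p^k}\right),$$ $$W_r(g)=(\log\pi+\gamma)\,g(1)+\int_1^\infty\bigl(g(u)+g^\tau(u)\bigr)\frac{du}{u}+\sum_{j\ge1}\int_1^\infty\bigl(g(u)-g(1)\bigr)u^{-2j}\,\frac{du}{u}+\sum_{j\ge1}\int_1^\infty\bigl(g^\tau(u)-g(1)\bigr)u^{-2j}\,\frac{du}{u},$$ with $\gamma$ Euler's constant. All the integrals in $W_r(g)$, the series over $k$ and over $j$, and the series $\sum_p W_p(g)$ converge absolutely. (4) The term $W_r(g)$ is the archimedean term of the explicit formula: with $L_r(s)=\pi^{-s/2}\Gamma(s/2)$, for every $\varepsilon$ as in the definition of $(E)$ for $g$ and every $c$ with $0<c<1+\varepsilon$, $$W_r(g)=\lim_{T\to\infty}\frac1{2\pi i}\int_{c-iT}^{c+iT}-\frac{L_r'(s)}{L_r(s)}\bigl(\widehat g(s)+\widehat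 g(1-s)\bigr)\,ds .$$ -/

import Mathlib

open Complex Set Filter Topology MeasureTheory

namespace ExplicitFormula

noncomputable section

/-! Functions on the half-line `(0, ∞)` are represented by functions `ℝ → ℂ` of which only the
values at positive reals matter. The Mellin transform is Mathlib's `mellin`. -/

/-- The weight `K_ε(u) = u^{-ε} + u^{1+ε}`. -/
def weight (ε u : ℝ) : ℝ := u ^ (-ε) + u ^ (1 + ε)

/-- The conditions defining the class `(E)`, for a given `ε`. -/
structure IsClassEWith (ε : ℝ) (g : ℝ → ℂ) : Prop where
  continuousOn : ContinuousOn g (Ioi 0)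
  boundedVariation : BoundedVariationOn (fun u : ℝ => g u * (weight ε u : ℂ)) (Ioi 0)
  integrable_log : ∀ c : ℝ, -ε < c → c < 1 + ε →
    Integrable (fun t : ℝ => ‖mellin g (c + t * I)‖ * Real.log |t|)

/-- The class `(E)`. -/
def IsClassE (g : ℝ → ℂ) : Prop := ∃ ε : ℝ, 0 < ε ∧ IsClassEWith ε g

/-- Multiplicative convolution `(g * k)(u) = ∫₀^∞ g(t) k(u/t) dt/t`. -/
def mulConv (g k : ℝ → ℂ) (u : ℝ) : ℂ := ∫ t in Ioi (0 : ℝ), g t * k (u / t) / (t : ℂ)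

/-- The transpose `g^τ(x) = (1/x) g(1/x)`. -/
def transpose (g : ℝ → ℂ) (x : ℝ) : ℂ := (1 / (x : ℂ)) * g (1 / x)

/-- The zeros of the Riemann zeta function in the critical strip. -/
def criticalZeros : Set ℂ := {ρ | riemannZeta ρ = 0 ∧ 0 < ρ.re ∧ ρ.re < 1}

theorem finite_criticalZeros_lt (T : ℝ) : {ρ ∈ criticalZeros | |ρ.im| < T}.Finite := by
  have hc : IsCompact (Icc (0 : ℝ) 1 ×ℂ Icc (-T) T) := isCompact_Icc.reProdIm isCompact_Icc
  refine hc.inter_riemannZetaZeros_finite.subset ?_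
  rintro ρ ⟨⟨h0, h1, h2⟩, h3⟩
  rw [abs_lt] at h3
  exact ⟨⟨⟨h1.le, h2.le⟩, ⟨h3.1.le, h3.2.le⟩⟩, h0⟩

/-- `∑_{|Im ρ| < T} ĝ(ρ)`, over the zeros in the critical strip, counted with multiplicity. -/
def zeroSum (g : ℝ → ℂ) (T : ℝ) : ℂ :=
  ∑ ρ ∈ (finite_criticalZeros_lt T).toFinset,
    (analyticOrderNatAt riemannZeta ρ : ℂ) * mellin g ρ

/-- The term `W_p(g)` at a prime `p`; the index `k : ℕ` stands for `k + 1 ≥ 1`. -/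
def weilPrime (g : ℝ → ℂ) (p : ℕ) : ℂ :=
  (Real.log p : ℂ) * ∑' k : ℕ, g ((p : ℝ) ^ (k + 1)) +
    (Real.log p : ℂ) * ∑' k : ℕ, (1 / (p : ℂ) ^ (k + 1)) * g (1 / (p : ℝ) ^ (k + 1))

/-- The integral `∫₁^∞ (h(u) - h(1)) u^{-2j} du/u`; note that `g^τ(1) = g(1)`. -/
def weilRealTerm (h : ℝ → ℂ) (j : ℕ) : ℂ :=
  ∫ u in Ioi (1 : ℝ), (h u - h 1) * ((u : ℂ) ^ (2 * j))⁻¹ / (u : ℂ)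

/-- The term `W_r(g)` at the real place; the index `j : ℕ` stands for `j + 1 ≥ 1`. -/
def weilReal (g : ℝ → ℂ) : ℂ :=
  ((Real.log Real.pi + Real.eulerMascheroniConstant : ℝ) : ℂ) * g 1 +
    (∫ u in Ioi (1 : ℝ), (g u + transpose g u) / (u : ℂ)) +
    ∑' j : ℕ, weilRealTerm g (j + 1) + ∑' j : ℕ, weilRealTerm (transpose g) (j + 1)

/-- `(1 / 2πi) ∫_{c - iT}^{c + iT} -(L_r'(s) / L_r(s)) (ĝ(s) + ĝ(1 - s)) ds`, where
`L_r(s) = π^{-s/2} Γ(s/2)` is Mathlib's `Gammaℝ`. -/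
def archimedeanIntegral (g : ℝ → ℂ) (c T : ℝ) : ℂ :=
  1 / (2 * (Real.pi : ℂ) * I) *
    ∫ t in (-T)..T, -logDeriv Gammaℝ (c + t * I) *
      (mellin g (c + t * I) + mellin g (1 - (c + t * I))) * I

/-- Absolute convergence of the series and integrals in `W_p(g)`, in `W_r(g)`, and of `∑_p W_p(g)`. -/
structure WeilTermsConverge (g : ℝ → ℂ) : Prop where
  prime : ∀ p : ℕ, p.Prime → Summable (fun k : ℕ => ‖g ((p : ℝ) ^ (k + 1))‖)
  prime_inv : ∀ p : ℕ, p.Prime →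
    Summable (fun k : ℕ => ‖(1 / (p : ℂ) ^ (k + 1)) * g (1 / (p : ℝ) ^ (k + 1))‖)
  primes : Summable (fun p : Nat.Primes => ‖weilPrime g p‖)
  real_integral : IntegrableOn (fun u : ℝ => (g u + transpose g u) / (u : ℂ)) (Ioi 1)
  real_term_integral : ∀ h ∈ ({g, transpose g} : Set (ℝ → ℂ)), ∀ j : ℕ,
    IntegrableOn (fun u : ℝ => (h u - h 1) * ((u : ℂ) ^ (2 * (j + 1)))⁻¹ / (u : ℂ)) (Ioi 1)
  real_sum : ∀ h ∈ ({g, transpose g} : Set (ℝ → ℂ)),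
    Summable (fun j : ℕ => ‖weilRealTerm h (j + 1)‖)

end

end ExplicitFormula

/-!
The explicit formula comes from integrating `ĝ(s) ξ'(s)/ξ(s)` around the critical strip, where `ξ(s)
= s (s - 1) Γℝ(s) ζ(s)` is entire, satisfies `ξ(1 - s) = ξ(s)`, and has exactly the critical zeros
of `ζ` as zeros (`xi_eq_zero_iff`, `analyticOrderNatAt_xi`). After subtracting `1/s + 1/(s - 1)`
from `ξ'/ξ`, the residues in the rectangle `[1 - c, c] × [-T, T]` add up to `∑ ĝ(ρ) - ĝ(0) - ĝ(1)`
(`IsClassEWith.rectIntegral_mellin_mul_logDerivXiSub`). The functional equation folds the two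
vertical sides onto the line `Re s = c > 1`, where `ξ'/ξ - 1/s - 1/(s - 1)` is `Γℝ'/Γℝ + ζ'/ζ` and
`ĝ(s)` is replaced by `ĝ(s) + ĝ(1 - s)`; note that `ĝ(1 - s)` is the transform of the transpose of
`g`.

* The part with `ζ'/ζ` is the sum over the primes, by the Dirichlet series with coefficients `Λ(n)`
  and Mellin inversion at each `n`.
* The part with `Γℝ'/Γℝ` is the term at the real place. The expansion `-Γℝ'/Γℝ(s) = (log π + γ)/2 +
  1/s + ∑ (1/(s + 2j) - 1/(2j))` (`neg_logDeriv_Gammaℝ_eq`) has absolute sum `O(log |s|)`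
  (`sum_norm_gammaTerm_le`), so the hypothesis on `ĝ(s) log |Im s|` permits termwise integration,
  and `1/(s + 2j) = ∫₁^∞ u^{-s-2j} du/u` turns each term into an integral of `g`. This holds on
  every line `0 < Re s = c < 1 + ε`.
* The horizontal sides vanish in the limit. Bounded variation gives `ĝ(s) = O(1 / |Im s|)` uniformly
  in the strip (`IsClassEWith.exists_norm_mellin_mul_abs_im_le`): translation by half a period shows
  that a Fourier integral is bounded by the `L¹` modulus of continuity. Every interval `[τ, τ +
  1/4]` contains a height at which `ξ'/ξ = O(log² τ)` (`exists_height_logDerivXiSub`), because there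
  are only `O(log τ)` zeros nearby. The same count shows that the sum over the zeros hardly changes
  between `τ` and such a height, so that the limit over all `T` exists.

The count of zeros and the bound for `ζ'/ζ` follow from `exists_zeros_logDeriv_bound`, applied to
discs about `2 + iτ`, and the bound `ζ(s) = O(|Im s|)` for `Re s ≥ 0.2`.

Stability of the class `(E)` under convolution rests on two facts: the Mellin transform of `g * k`
is `ĝ k̂`, with `k̂` bounded on vertical lines, and `u^σ (g * k)(u)` is an average of dilates of
`u^σ k(u)`, so its variation is at most `∫ |g(t)| t^σ dt/t` times that of `u^σ k(u)`. That the
latter is finite for all `σ ∈ [-ε, 1 + ε]` follows from the bounded variation of `k K_ε`, as `u^σ /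
K_ε(u)` is bounded and of bounded variation (`eVariationOn_rpow_div_weight_le`).
-/

namespace ExplicitFormula

/-! ### Cauchy integrals over rectangles symmetric about the real axis -/

/-- The integral of `f` around the boundary of `[a, b] × [-T, T]`, counterclockwise. -/
noncomputable def rectIntegral (f : ℂ → ℂ) (a b T : ℝ) : ℂ :=
  (∫ x in a..b, f (x + (-T : ℝ) * I)) - (∫ x in a..b, f (x + T * I)) +
    I * (∫ y in (-T)..T, f (b + y * I)) - I * ∫ y in (-T)..T, f (a + y * I)

theorem rectIntegral_eq_zero {f : ℂ → ℂ} {a b T : ℝ} (hab : a ≤ b) (hT : 0 ≤ T)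
    (hf : DifferentiableOn ℂ f (Icc a b ×ℂ Icc (-T) T)) : rectIntegral f a b T = 0 := by
  have := integral_boundary_rect_eq_zero_of_differentiableOn f (a + (-T : ℝ) * I) (b + T * I)
    (by simpa [uIcc_of_le hab, uIcc_of_le (show -T ≤ T by linarith)] using hf)
  simpa [rectIntegral] using this

theorem continuous_inv_sub_of_im_ne {ρ : ℂ} {y : ℝ} (h : y ≠ ρ.im) :
    Continuous fun x : ℝ => ((x : ℂ) + y * I - ρ)⁻¹ := by
  refine Continuous.inv₀ (by fun_prop) fun x hx => h ?_
  have := congrArg im hx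
  simp at this
  linarith

theorem continuous_inv_sub_of_re_ne {ρ : ℂ} {x : ℝ} (h : x ≠ ρ.re) :
    Continuous fun y : ℝ => ((x : ℂ) + y * I - ρ)⁻¹ := by
  refine Continuous.inv₀ (by fun_prop) fun y hx => h ?_
  have := congrArg re hx
  simp at this
  linarith

/-- The left side of a rectangle crosses the branch cut of `log`, so a primitive there is `log
(-w)`; the two formulas for `log (-w)` produce the `2πi` of Cauchy's formula. -/
theorem log_neg_of_im_pos {w : ℂ} (h : 0 < w.im) : log (-w) = log w - Real.pi * I := by
  rw [log, log, norm_neg, arg_neg_eq_arg_sub_pi_of_im_pos h]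
  push_cast; ring

theorem log_neg_of_im_neg {w : ℂ} (h : w.im < 0) : log (-w) = log w + Real.pi * I := by
  rw [log, log, norm_neg, arg_neg_eq_arg_add_pi_of_im_neg h]
  push_cast; ring

theorem integral_inv_sub_horizontal {ρ : ℂ} {a b y : ℝ} (h : y ≠ ρ.im) :
    ∫ x in a..b, ((x : ℂ) + y * I - ρ)⁻¹ = log (b + y * I - ρ) - log (a + y * I - ρ) := by
  refine intervalIntegral.integral_eq_sub_of_hasDerivAt
    (f := fun x : ℝ => log ((x : ℂ) + y * I - ρ)) (fun x _ => ?_)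
    ((continuous_inv_sub_of_im_ne h).intervalIntegrable _ _)
  have h1 : HasDerivAt (fun x : ℝ => (x : ℂ) + y * I - ρ) 1 x :=
    ((ofRealCLM.hasDerivAt (x := x)).add_const _).sub_const _
  have h2 : (x : ℂ) + y * I - ρ ∈ slitPlane := by
    rw [mem_slitPlane_iff]; right; simpa [sub_eq_zero] using h
  simpa using h1.clog_real h2

theorem integral_inv_sub_vertical {ρ : ℂ} {a b x : ℝ} (h : ρ.re < x) :
    I * ∫ y in a..b, ((x : ℂ) + y * I - ρ)⁻¹ = log (x + b * I - ρ) - log (x + a * I - ρ) := by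
  rw [← intervalIntegral.integral_const_mul]
  refine intervalIntegral.integral_eq_sub_of_hasDerivAt
    (f := fun y : ℝ => log ((x : ℂ) + y * I - ρ)) (fun y _ => ?_)
    (((continuous_inv_sub_of_re_ne h.ne').const_mul _).intervalIntegrable _ _)
  have h1 : HasDerivAt (fun y : ℝ => (x : ℂ) + y * I - ρ) I y := by
    simpa using (((ofRealCLM.hasDerivAt (x := y)).mul_const I).const_add (x : ℂ)).sub_const ρ
  have h2 : (x : ℂ) + y * I - ρ ∈ slitPlane := by
    rw [mem_slitPlane_iff]; left; simpa using h
  simpa [div_eq_mul_inv] using h1.clog_real h2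

theorem integral_inv_sub_vertical_left {ρ : ℂ} {a b x : ℝ} (h : x < ρ.re) :
    I * ∫ y in a..b, ((x : ℂ) + y * I - ρ)⁻¹ =
      log (-(x + b * I - ρ)) - log (-(x + a * I - ρ)) := by
  rw [← intervalIntegral.integral_const_mul]
  refine intervalIntegral.integral_eq_sub_of_hasDerivAt
    (f := fun y : ℝ => log (-((x : ℂ) + y * I - ρ))) (fun y _ => ?_)
    (((continuous_inv_sub_of_re_ne h.ne).const_mul _).intervalIntegrable _ _)
  have h1 : HasDerivAt (fun y : ℝ => -((x : ℂ) + y * I - ρ)) (-I) y := by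
    have := ((((ofRealCLM.hasDerivAt (x := y)).mul_const I).const_add (x : ℂ)).sub_const ρ).fun_neg
    rwa [ofRealCLM_apply, ofReal_one, one_mul] at this
  have h2 : -((x : ℂ) + y * I - ρ) ∈ slitPlane := by
    rw [mem_slitPlane_iff]; left; simpa using h
  have := h1.clog_real h2
  rwa [neg_div_neg_eq, div_eq_mul_inv] at this

theorem rectIntegral_inv_sub {ρ : ℂ} {a b T : ℝ} (ha : a < ρ.re) (hb : ρ.re < b)
    (hT : |ρ.im| < T) : rectIntegral (fun s => (s - ρ)⁻¹) a b T = 2 * Real.pi * I := by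
  rw [abs_lt] at hT
  have h1 : -T ≠ ρ.im := by linarith
  have h2 : T ≠ ρ.im := by linarith
  rw [rectIntegral, integral_inv_sub_horizontal h1, integral_inv_sub_horizontal h2,
    integral_inv_sub_vertical hb, integral_inv_sub_vertical_left ha,
    log_neg_of_im_pos (by simp; linarith), log_neg_of_im_neg (by simp; linarith)]
  ring

/-- Integrability on the four sides, which is what additivity of `rectIntegral` needs. -/
structure RectIntegrable (f : ℂ → ℂ) (a b T : ℝ) : Prop where
  bottom : IntervalIntegrable (fun x : ℝ => f (x + (-T : ℝ) * I)) volume a b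
  top : IntervalIntegrable (fun x : ℝ => f (x + T * I)) volume a b
  right : IntervalIntegrable (fun y : ℝ => f (b + y * I)) volume (-T) T
  left : IntervalIntegrable (fun y : ℝ => f (a + y * I)) volume (-T) T

/-- The four sides of the rectangle `[a, b] × [-T, T]`. -/
def rectBoundary (a b T : ℝ) : Set ℂ :=
  {s | (s.re ∈ Icc a b ∧ (s.im = -T ∨ s.im = T)) ∨ (s.im ∈ Icc (-T) T ∧ (s.re = a ∨ s.re = b))}

theorem RectIntegrable.of_continuousOn {f : ℂ → ℂ} {a b T : ℝ} (hab : a ≤ b) (hT : 0 ≤ T)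
    (hf : ContinuousOn f (rectBoundary a b T)) : RectIntegrable f a b T := by
  have hT' : -T ≤ T := by linarith
  constructor
  all_goals
    refine ContinuousOn.intervalIntegrable (hf.comp (by fun_prop) fun x hx => ?_)
    first
    | rw [uIcc_of_le hab] at hx; left; simp [hx.1, hx.2]
    | rw [uIcc_of_le hT'] at hx; right; simp [hx.1, hx.2]

theorem rectIntegral_add {f g : ℂ → ℂ} {a b T : ℝ} (hf : RectIntegrable f a b T)
    (hg : RectIntegrable g a b T) :
    rectIntegral (fun s => f s + g s) a b T = rectIntegral f a b T + rectIntegral g a b T := by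
  simp only [rectIntegral]
  rw [intervalIntegral.integral_add hf.bottom hg.bottom, intervalIntegral.integral_add hf.top hg.top,
    intervalIntegral.integral_add hf.right hg.right, intervalIntegral.integral_add hf.left hg.left]
  ring

theorem rectIntegral_const_mul (f : ℂ → ℂ) (k : ℂ) (a b T : ℝ) :
    rectIntegral (fun s => k * f s) a b T = k * rectIntegral f a b T := by
  simp only [rectIntegral, intervalIntegral.integral_const_mul]
  ring

theorem rectIntegral_congr {f g : ℂ → ℂ} {a b T : ℝ} (hab : a ≤ b) (hT : 0 ≤ T)
    (h : EqOn f g (rectBoundary a b T)) : rectIntegral f a b T = rectIntegral g a b T := by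
  have hT' : -T ≤ T := by linarith
  simp only [rectIntegral]
  congr 1
  congr 1
  congr 1
  · refine intervalIntegral.integral_congr fun x hx => h ?_
    rw [uIcc_of_le hab] at hx; left; simp [hx.1, hx.2]
  · refine intervalIntegral.integral_congr fun x hx => h ?_
    rw [uIcc_of_le hab] at hx; left; simp [hx.1, hx.2]
  · congr 1
    refine intervalIntegral.integral_congr fun x hx => h ?_
    rw [uIcc_of_le hT'] at hx; right; simp [hx.1, hx.2]
  · congr 1
    refine intervalIntegral.integral_congr fun x hx => h ?_
    rw [uIcc_of_le hT'] at hx; right; simp [hx.1, hx.2]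

theorem rectBoundary_subset {a b T : ℝ} (hab : a ≤ b) (hT : 0 ≤ T) :
    rectBoundary a b T ⊆ Icc a b ×ℂ Icc (-T) T := by
  have hT' : -T ≤ T := by linarith
  rintro s (⟨h1, h2 | h2⟩ | ⟨h1, h2 | h2⟩)
  · exact ⟨h1, by simp [h2, hT']⟩
  · exact ⟨h1, by simp [h2, hT']⟩
  · exact ⟨by simp [h2, hab], h1⟩
  · exact ⟨by simp [h2, hab], h1⟩

theorem sub_ne_zero_of_mem_rectBoundary {ρ s : ℂ} {a b T : ℝ} (ha : a < ρ.re) (hb : ρ.re < b)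
    (hT : |ρ.im| < T) (hs : s ∈ rectBoundary a b T) : s - ρ ≠ 0 := by
  intro h
  rw [sub_eq_zero] at h
  subst h
  rw [abs_lt] at hT
  rcases hs with ⟨_, h | h⟩ | ⟨_, h | h⟩ <;> linarith

/-- The Cauchy integral formula on a rectangle. -/
theorem rectIntegral_mul_inv_sub {f : ℂ → ℂ} {U : Set ℂ} (hU : IsOpen U)
    (hf : DifferentiableOn ℂ f U) {ρ : ℂ} {a b T : ℝ} (hsub : Icc a b ×ℂ Icc (-T) T ⊆ U)
    (ha : a < ρ.re) (hb : ρ.re < b) (hT : |ρ.im| < T) :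
    rectIntegral (fun s => f s * (s - ρ)⁻¹) a b T = 2 * Real.pi * I * f ρ := by
  have hab : a ≤ b := by linarith
  have hT0 : 0 ≤ T := (abs_nonneg _).trans hT.le
  have hmem : ρ ∈ U := hsub ⟨⟨ha.le, hb.le⟩, (abs_lt.1 hT).1.le, (abs_lt.1 hT).2.le⟩
  have hd : DifferentiableOn ℂ (dslope f ρ) U :=
    (differentiableOn_dslope (hU.mem_nhds hmem)).2 hf
  have hne := fun s => sub_ne_zero_of_mem_rectBoundary (s := s) ha hb hT
  have h1 : rectIntegral (fun s => f s * (s - ρ)⁻¹) a b T =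
      rectIntegral (fun s => dslope f ρ s + f ρ * (s - ρ)⁻¹) a b T := by
    refine rectIntegral_congr hab hT0 fun s hs => ?_
    have := hne s hs
    change f s * (s - ρ)⁻¹ = dslope f ρ s + f ρ * (s - ρ)⁻¹
    rw [dslope_of_ne _ (sub_ne_zero.1 this), slope_def_field]
    field_simp
    ring
  rw [h1, rectIntegral_add (.of_continuousOn hab hT0 ?_) (.of_continuousOn hab hT0 ?_),
    rectIntegral_eq_zero hab hT0 (hd.mono hsub), rectIntegral_const_mul,
    rectIntegral_inv_sub ha hb hT]
  · ring
  · exact hd.continuousOn.mono ((rectBoundary_subset hab hT0).trans hsub)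
  · exact continuousOn_const.mul ((continuousOn_id.sub continuousOn_const).inv₀ hne)

/-! ### Factoring out zeros and bounding logarithmic derivatives -/

/-- Dividing a holomorphic function by `(z - ρ) ^ m`, where `m` is the order of vanishing at `ρ`. -/
theorem exists_eq_pow_mul {f : ℂ → ℂ} {U : Set ℂ} (hU : IsOpen U) (hf : DifferentiableOn ℂ f U)
    {ρ : ℂ} (hρ : ρ ∈ U) (hord : analyticOrderAt f ρ ≠ ⊤) :
    ∃ e : ℂ → ℂ, DifferentiableOn ℂ e U ∧
      (∀ z ∈ U, f z = (z - ρ) ^ analyticOrderNatAt f ρ * e z) ∧ e ρ ≠ 0 := by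
  have hfa : AnalyticAt ℂ f ρ := hf.analyticAt (hU.mem_nhds hρ)
  obtain ⟨g, hg, hg0, hfg⟩ := hfa.analyticOrderAt_ne_top.1 hord
  set n := analyticOrderNatAt f ρ
  have key : Function.update (fun z => f z / (z - ρ) ^ n) ρ (g ρ) =ᶠ[𝓝 ρ] g := by
    filter_upwards [hfg] with z hz
    rcases eq_or_ne z ρ with rfl | h
    · simp
    · rw [Function.update_of_ne h, hz, smul_eq_mul,
        mul_div_cancel_left₀ _ (pow_ne_zero _ (sub_ne_zero.2 h))]
  refine ⟨Function.update (fun z => f z / (z - ρ) ^ n) ρ (g ρ), fun z hz => ?_, fun z hz => ?_,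
    by simpa using hg0⟩
  · rcases eq_or_ne z ρ with rfl | h
    · exact (key.differentiableAt_iff.2 hg.differentiableAt).differentiableWithinAt
    · have h1 : Function.update (fun z => f z / (z - ρ) ^ n) ρ (g ρ) =ᶠ[𝓝 z]
          fun z => f z / (z - ρ) ^ n := by
        filter_upwards [isOpen_ne.mem_nhds h] with w hw using Function.update_of_ne hw _ _
      refine (h1.differentiableAt_iff.2 ?_).differentiableWithinAt
      exact (hf.differentiableAt (hU.mem_nhds hz)).div (by fun_prop)
        (pow_ne_zero _ (sub_ne_zero.2 h))
  · rcases eq_or_ne z ρ with rfl | h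
    · simpa using hfg.self_of_nhds
    · rw [Function.update_of_ne h, mul_div_cancel₀ _ (pow_ne_zero _ (sub_ne_zero.2 h))]

/-- Dividing out finitely many zeros of a holomorphic function. -/
theorem exists_eq_prod_mul {f : ℂ → ℂ} {U : Set ℂ} (hU : IsOpen U) (hf : DifferentiableOn ℂ f U)
    (Z : Finset ℂ) (hZ : ∀ ρ ∈ Z, ρ ∈ U) (hord : ∀ ρ ∈ Z, analyticOrderAt f ρ ≠ ⊤) :
    ∃ e : ℂ → ℂ, DifferentiableOn ℂ e U ∧
      (∀ z ∈ U, f z = (∏ ρ ∈ Z, (z - ρ) ^ analyticOrderNatAt f ρ) * e z) ∧ ∀ ρ ∈ Z, e ρ ≠ 0 := by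
  induction Z using Finset.induction_on with
  | empty => exact ⟨f, hf, by simp, by simp⟩
  | insert ρ Z hρ ih =>
    obtain ⟨e, he, hfe, he0⟩ := ih (fun w hw => hZ w (Finset.mem_insert_of_mem hw))
      fun w hw => hord w (Finset.mem_insert_of_mem hw)
    have hρU := hZ ρ (Finset.mem_insert_self _ _)
    have hea : AnalyticAt ℂ e ρ := he.analyticAt (hU.mem_nhds hρU)
    have hPa : AnalyticAt ℂ (fun z => ∏ w ∈ Z, (z - w) ^ analyticOrderNatAt f w) ρ :=
      Finset.analyticAt_fun_prod _ fun w _ => by fun_prop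
    have hP0 : ∏ w ∈ Z, (ρ - w) ^ analyticOrderNatAt f w ≠ 0 :=
      Finset.prod_ne_zero_iff.2 fun w hw => pow_ne_zero _
        (sub_ne_zero.2 fun h => hρ (h ▸ hw))
    have hoe : analyticOrderAt e ρ = analyticOrderAt f ρ := by
      have h1 : f =ᶠ[𝓝 ρ] (fun z => ∏ w ∈ Z, (z - w) ^ analyticOrderNatAt f w) * e := by
        filter_upwards [hU.mem_nhds hρU] with z hz using hfe z hz
      rw [analyticOrderAt_congr h1, analyticOrderAt_mul hPa hea,
        hPa.analyticOrderAt_eq_zero.2 hP0, zero_add]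
    obtain ⟨e', he', hee', he'0⟩ := exists_eq_pow_mul hU he hρU
      (hoe ▸ hord ρ (Finset.mem_insert_self _ _))
    have hon : analyticOrderNatAt e ρ = analyticOrderNatAt f ρ := by
      simp [analyticOrderNatAt, hoe]
    refine ⟨e', he', fun z hz => ?_, fun w hw => ?_⟩
    · rw [Finset.prod_insert hρ, hfe z hz, hee' z hz, hon]
      ring
    · rcases Finset.mem_insert.1 hw with rfl | hw
      · exact he'0
      · have := he0 w hw
        rw [hee' w (hZ w (Finset.mem_insert_of_mem hw))] at this
        exact right_ne_zero_of_mul this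

/-- The logarithmic derivative of a function factored over its zeros is the sum of its principal
parts and the logarithmic derivative of the zero-free cofactor. -/
theorem logDeriv_eq_sum_add_logDeriv {f e : ℂ → ℂ} {U : Set ℂ} (hU : IsOpen U) {Z : Finset ℂ}
    {m : ℂ → ℕ} (he : DifferentiableOn ℂ e U)
    (hfe : ∀ z ∈ U, f z = (∏ ρ ∈ Z, (z - ρ) ^ m ρ) * e z) {z : ℂ} (hz : z ∈ U) (hfz : f z ≠ 0)
    (hzZ : z ∉ Z) : logDeriv f z = ∑ ρ ∈ Z, m ρ * (z - ρ)⁻¹ + logDeriv e z := by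
  have h1 : f =ᶠ[𝓝 z] fun z => (∏ ρ ∈ Z, (z - ρ) ^ m ρ) * e z := by
    filter_upwards [hU.mem_nhds hz] with w hw using hfe w hw
  rw [hfe z hz] at hfz
  have h2 : ∀ ρ ∈ Z, (z - ρ) ^ m ρ ≠ 0 := fun ρ hρ =>
    pow_ne_zero _ (sub_ne_zero.2 fun h => hzZ (h ▸ hρ))
  rw [(logDeriv_congr_nhds h1).self_of_nhds, logDeriv_mul (f := fun z => ∏ ρ ∈ Z, (z - ρ) ^ m ρ) z
    (left_ne_zero_of_mul hfz) (right_ne_zero_of_mul hfz)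
    (DifferentiableAt.fun_finsetProd fun ρ _ => by fun_prop)
    (he.differentiableAt (hU.mem_nhds hz)), logDeriv_prod (f := fun ρ z => (z - ρ) ^ m ρ) h2
      (fun ρ _ => by fun_prop)]
  congr 1
  refine Finset.sum_congr rfl fun ρ _ => ?_
  rw [logDeriv_fun_pow (by fun_prop)]
  congr 1
  simp [logDeriv_apply]

/-- A zero-free holomorphic function on a disc which is not much larger than its value at the
centre has a small logarithmic derivative: Borel–Carathéodory for its logarithm. -/
theorem norm_logDeriv_le_of_ne_zero_zero_centre {G : ℂ → ℂ} {r₁ r₂ M : ℝ} (h₂ : 0 < r₂)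
    (h₁ : r₂ < r₁) (hM : 0 < M) (hG : DifferentiableOn ℂ G (Metric.ball 0 r₁))
    (hG0 : ∀ z ∈ Metric.ball (0 : ℂ) r₁, G z ≠ 0)
    (hb : ∀ z ∈ Metric.ball (0 : ℂ) r₁, ‖G z‖ ≤ Real.exp M * ‖G 0‖) {z : ℂ} (hz : ‖z‖ ≤ r₂) :
    ‖logDeriv G z‖ ≤ 8 * r₁ / (r₁ - r₂) ^ 2 * M := by
  have hr1 : 0 < r₁ := h₂.trans h₁
  have h0 : (0 : ℂ) ∈ Metric.ball (0 : ℂ) r₁ := by simpa using hr1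
  have hlog : DifferentiableOn ℂ (logDeriv G) (Metric.ball 0 r₁) :=
    (hG.deriv Metric.isOpen_ball).div hG hG0
  obtain ⟨l, hl0, hl⟩ := hlog.isExactOn_ball.with_val_at 0 0
  have hld : DifferentiableOn ℂ l (Metric.ball 0 r₁) := fun w hw =>
    (hl w hw).differentiableAt.differentiableWithinAt
  have hGd := fun w (hw : w ∈ Metric.ball (0 : ℂ) r₁) =>
    (hG.differentiableAt (Metric.isOpen_ball.mem_nhds hw)).hasDerivAt
  have hexp : ∀ w ∈ Metric.ball (0 : ℂ) r₁, G w = G 0 * exp (l w) := by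
    intro w hw
    have h3 : ∀ w ∈ Metric.ball (0 : ℂ) r₁, HasDerivAt (fun w => G w * exp (-l w)) 0 w := by
      intro w hw
      have := (hGd w hw).mul (hl w hw).neg.cexp
      refine this.congr_deriv ?_
      have := hG0 w hw
      rw [logDeriv_apply]
      field_simp
      ring
    have h4 := Metric.isOpen_ball.is_const_of_deriv_eq_zero
      (convex_ball (0 : ℂ) r₁).isPreconnected
      (fun w hw => (h3 w hw).differentiableAt.differentiableWithinAt)
      (fun w hw => (h3 w hw).deriv) hw h0
    rw [hl0, neg_zero, exp_zero, mul_one] at h4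
    rw [← h4, mul_assoc, ← exp_add]
    simp
  have hre : MapsTo l (Metric.ball 0 r₁) {z | z.re ≤ M} := by
    intro w hw
    have h5 := hb w hw
    rw [hexp w hw, norm_mul, mul_comm, norm_exp] at h5
    exact Real.exp_le_exp.1 (le_of_mul_le_mul_right h5 (norm_pos_iff.2 (hG0 0 h0)))
  set δ := (r₁ - r₂) / 2 with hδ
  have hδ0 : 0 < δ := by simp only [hδ]; linarith
  have hsub : ∀ w ∈ Metric.closedBall z δ, ‖w‖ ≤ r₁ - δ := by
    intro w hw
    rw [Metric.mem_closedBall, dist_eq_norm] at hw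
    calc ‖w‖ = ‖w - z + z‖ := by simp
      _ ≤ δ + r₂ := (norm_add_le _ _).trans (add_le_add hw hz)
      _ = r₁ - δ := by rw [hδ]; ring
  have hsub' : Metric.closedBall z δ ⊆ Metric.ball 0 r₁ := fun w hw => by
    rw [mem_ball_zero_iff]; linarith [hsub w hw]
  have hbound : ∀ w ∈ Metric.sphere z δ, ‖l w‖ ≤ 2 * M * r₁ / δ := by
    intro w hw
    have hw' := Metric.sphere_subset_closedBall hw
    have h6 := hsub w hw'
    refine (borelCaratheodory_zero hM hld hre hr1 (hsub' hw') hl0).trans ?_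
    gcongr <;> linarith
  have h7 := norm_deriv_le_of_forall_mem_sphere_norm_le hδ0
    ((hld.mono hsub').diffContOnCl_ball subset_rfl) hbound
  have hzm : z ∈ Metric.ball (0 : ℂ) r₁ := by rw [mem_ball_zero_iff]; linarith
  rw [(hl z hzm).deriv] at h7
  refine h7.trans (le_of_eq ?_)
  have : r₁ - r₂ ≠ 0 := by linarith
  rw [hδ]
  field_simp
  ring

section

open scoped ComplexConjugate

theorem norm_logDeriv_le_of_ne_zero {G : ℂ → ℂ} {c : ℂ} {r₁ r₂ M : ℝ} (h₂ : 0 < r₂)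
    (h₁ : r₂ < r₁) (hM : 0 < M) (hG : DifferentiableOn ℂ G (Metric.ball c r₁))
    (hG0 : ∀ z ∈ Metric.ball c r₁, G z ≠ 0)
    (hb : ∀ z ∈ Metric.ball c r₁, ‖G z‖ ≤ Real.exp M * ‖G c‖) {z : ℂ}
    (hz : z ∈ Metric.closedBall c r₂) :
    ‖logDeriv G z‖ ≤ 8 * r₁ / (r₁ - r₂) ^ 2 * M := by
  have hmem : ∀ w ∈ Metric.ball (0 : ℂ) r₁, c + w ∈ Metric.ball c r₁ := by
    intro w hw
    simpa [mem_ball_iff_norm] using hw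
  have := norm_logDeriv_le_of_ne_zero_zero_centre (G := fun w => G (c + w)) (z := z - c) h₂ h₁ hM
    (hG.comp (by fun_prop) hmem) (fun w hw => hG0 _ (hmem w hw))
    (fun w hw => by simpa using hb _ (hmem w hw)) (by simpa only [mem_closedBall_iff_norm] using hz)
  simpa [logDeriv_apply, deriv_comp_const_add] using this

/-- On the circle of radius `R` around `c`, the factor `(R² - conj (ρ - c) (z - c)) / R` of a
Blaschke product has the same absolute value as `z - ρ`. -/
theorem norm_blaschke_sphere {c ρ z : ℂ} {R : ℝ} (hρ : ρ ∈ Metric.ball c R)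
    (hz : z ∈ Metric.sphere c R) :
    ‖((R : ℂ) ^ 2 - conj (ρ - c) * (z - c)) / R‖ = ‖z - ρ‖ := by
  have hzρ : z - ρ ≠ 0 := by
    intro h
    rw [sub_eq_zero] at h
    subst h
    rw [mem_sphere_iff_norm] at hz
    rw [mem_ball_iff_norm] at hρ
    linarith
  have h := norm_canonicalFactor_eval_circle_eq_one (R := R) (w := ρ - c) (z := z - c)
    (by rwa [mem_ball_iff_norm, sub_zero, ← mem_ball_iff_norm])
    (by simpa [mem_sphere_iff_norm] using hz)
  rw [canonicalFactor_apply, sub_sub_sub_cancel_right, ← div_div, norm_div,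
    div_eq_one_iff_eq (norm_ne_zero_iff.2 hzρ)] at h
  exact h

theorem sub_le_norm_blaschke {c ρ z : ℂ} {R r s : ℝ}
    (hρ : ‖ρ - c‖ ≤ r) (hz : ‖z - c‖ ≤ s) :
    R ^ 2 - r * s ≤ ‖(R : ℂ) ^ 2 - conj (ρ - c) * (z - c)‖ := by
  have h1 : ‖conj (ρ - c) * (z - c)‖ ≤ r * s := by
    rw [norm_mul, RCLike.norm_conj]
    gcongr
    exact (norm_nonneg _).trans hρ
  have h2 : ‖(R : ℂ) ^ 2‖ = R ^ 2 := by simp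
  linarith [norm_sub_norm_le ((R : ℂ) ^ 2) (conj (ρ - c) * (z - c))]

/-- If `|f| ≤ e^M |f(c)|` on a circle about `c`, then the number of zeros of `f` in a smaller disc,
and the distance between `f'/f` and the sum of its principal parts in a still smaller disc, are
`O(M)`. The function `G` obtained from `f` by replacing each factor `z - ρ` by the Blaschke factor
`(R² - conj (ρ - c) (z - c)) / R` is no larger than `f` on the outer circle and zero-free in the
disc of radius `r₁`; comparing `G c` with `f c` counts the zeros, and Borel–Carathéodory bounds
`G'/G`. -/
theorem exists_zeros_logDeriv_bound {r₂ r₁ R : ℝ} (h₂ : 0 < r₂) (h₁ : r₂ < r₁) (hR : r₁ < R) :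
    ∃ C : ℝ, 0 < C ∧ ∀ (c : ℂ) (f : ℂ → ℂ) (U : Set ℂ) (M : ℝ) (Z : Finset ℂ), IsOpen U →
      DifferentiableOn ℂ f U → Metric.closedBall c R ⊆ U → 0 < M → f c ≠ 0 →
      (∀ z ∈ Metric.sphere c R, ‖f z‖ ≤ Real.exp M * ‖f c‖) →
      (∀ ρ, ρ ∈ Z ↔ ρ ∈ Metric.closedBall c r₁ ∧ f ρ = 0) →
      (∀ ρ ∈ Z, analyticOrderAt f ρ ≠ ⊤) →
      (∑ ρ ∈ Z, (analyticOrderNatAt f ρ : ℝ) ≤ C * M) ∧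
        ∀ z ∈ Metric.closedBall c r₂, f z ≠ 0 →
          ‖logDeriv f z - ∑ ρ ∈ Z, analyticOrderNatAt f ρ * (z - ρ)⁻¹‖ ≤ C * M := by
  have hr1 : 0 < r₁ := h₂.trans h₁
  have hR0 : 0 < R := hr1.trans hR
  have hlog : 0 < Real.log (R / r₁) := Real.log_pos ((one_lt_div hr1).2 hR)
  have hden : 0 < R ^ 2 - r₁ * r₂ := by nlinarith
  set K₁ := (Real.log (R / r₁))⁻¹ with hK₁
  set K₂ := 8 * r₁ / (r₁ - r₂) ^ 2 with hK₂
  set K₃ := r₁ / (R ^ 2 - r₁ * r₂) with hK₃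
  have hK₁0 : 0 < K₁ := inv_pos.2 hlog
  have hK₂0 : 0 ≤ K₂ := by positivity
  have hK₃0 : 0 ≤ K₃ := by positivity
  refine ⟨K₁ + (K₂ + K₁ * K₃), by positivity, ?_⟩
  intro c f U M Z hU hf hcU hM hfc hfM hZ hord
  have hZr : ∀ ρ ∈ Z, ‖ρ - c‖ ≤ r₁ := fun ρ hρ => by
    simpa only [mem_closedBall_iff_norm] using ((hZ ρ).1 hρ).1
  have hZU : ∀ ρ ∈ Z, ρ ∈ U := fun ρ hρ =>
    hcU (Metric.closedBall_subset_closedBall hR.le ((hZ ρ).1 hρ).1)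
  obtain ⟨e, he, hfe, he0⟩ := exists_eq_prod_mul hU hf Z hZU hord
  set m := fun ρ => analyticOrderNatAt f ρ with hm
  set B : ℂ → ℂ → ℂ := fun ρ z => ((R : ℂ) ^ 2 - conj (ρ - c) * (z - c)) / R with hB
  have hBd : ∀ ρ, Differentiable ℂ (B ρ) := fun ρ => by simp only [hB]; fun_prop
  have hB0 : ∀ ρ ∈ Z, ∀ z ∈ Metric.closedBall c R, B ρ z ≠ 0 := by
    intro ρ hρ z hz
    have := sub_le_norm_blaschke (R := R) (hZr ρ hρ) (mem_closedBall_iff_norm.1 hz)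
    refine div_ne_zero (norm_pos_iff.1 (lt_of_lt_of_le ?_ this)) (by exact_mod_cast hR0.ne')
    nlinarith
  set G : ℂ → ℂ := fun z => (∏ ρ ∈ Z, B ρ z ^ m ρ) * e z with hG
  have hGd : DifferentiableOn ℂ G U := DifferentiableOn.mul
    (Differentiable.differentiableOn (Differentiable.fun_finsetProd fun ρ _ => (hBd ρ).pow _)) he
  have hcR : c ∈ Metric.closedBall c R := by simpa using hR0.le
  -- On the boundary circle `G` and `f` have the same absolute value
  have hGs : ∀ z ∈ Metric.sphere c R, ‖G z‖ ≤ Real.exp M * ‖f c‖ := by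
    intro z hz
    refine le_of_eq_of_le ?_ (hfM z hz)
    rw [hG, hfe z (hcU (Metric.sphere_subset_closedBall hz))]
    simp only [norm_mul, norm_prod, norm_pow]
    congr 1
    refine Finset.prod_congr rfl fun ρ hρ => ?_
    rw [hB, norm_blaschke_sphere _ hz]
    rw [mem_ball_iff_norm]
    exact (hZr ρ hρ).trans_lt hR
  have hGle : ∀ z ∈ Metric.closedBall c R, ‖G z‖ ≤ Real.exp M * ‖f c‖ := by
    intro z hz
    refine norm_le_of_forall_mem_frontier_norm_le (U := Metric.ball c R) Metric.isBounded_ball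
      ((hGd.mono hcU).diffContOnCl_ball subset_rfl) ?_ (by rwa [closure_ball _ hR0.ne'])
    rwa [frontier_ball _ hR0.ne']
  set N := ∑ ρ ∈ Z, m ρ with hN
  have hGc : ‖G c‖ = R ^ N * ‖e c‖ := by
    simp only [hG, hB, norm_mul, norm_prod, norm_pow, sub_self, mul_zero, sub_zero, hN,
      ← Finset.prod_pow_eq_pow_sum]
    congr 1
    refine Finset.prod_congr rfl fun ρ hρ => ?_
    rw [sq, mul_div_cancel_right₀ _ (by exact_mod_cast hR0.ne')]
    simp [abs_of_pos hR0]
  have hfcle : ‖f c‖ ≤ r₁ ^ N * ‖e c‖ := by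
    rw [hfe c (hcU hcR)]
    simp only [norm_mul, norm_prod, norm_pow, hN, ← Finset.prod_pow_eq_pow_sum]
    gcongr with ρ hρ
    rw [norm_sub_rev]
    exact hZr ρ hρ
  have hfcG : ‖f c‖ ≤ ‖G c‖ := by
    rw [hGc]
    refine hfcle.trans ?_
    gcongr
  have hNM : N * Real.log (R / r₁) ≤ M := by
    have h1 := hGle c hcR
    have h2 : (R / r₁) ^ N ≤ Real.exp M := by
      have h3 : (R / r₁) ^ N * ‖f c‖ ≤ ‖G c‖ := by
        rw [hGc, div_pow]
        calc R ^ N / r₁ ^ N * ‖f c‖ ≤ R ^ N / r₁ ^ N * (r₁ ^ N * ‖e c‖) := by gcongr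
          _ = R ^ N * ‖e c‖ := by field_simp
      exact le_of_mul_le_mul_right (h3.trans h1) (norm_pos_iff.2 hfc)
    have := Real.log_le_log (by positivity) h2
    rwa [Real.log_pow, Real.log_exp] at this
  have hNM' : (N : ℝ) ≤ K₁ * M := by
    rw [hK₁, inv_mul_eq_div, le_div_iff₀ hlog]
    exact hNM
  have hNsum : ∑ ρ ∈ Z, (analyticOrderNatAt f ρ : ℝ) = N := by
    rw [hN]; push_cast; rfl
  refine ⟨?_, fun z hz hfz => ?_⟩
  · rw [hNsum]
    refine hNM'.trans ?_
    gcongr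
    linarith [show 0 ≤ K₂ + K₁ * K₃ by positivity]
  have hball : ∀ z ∈ Metric.ball c r₁, z ∈ Metric.closedBall c R := fun z hz =>
    Metric.ball_subset_closedBall (Metric.ball_subset_ball hR.le hz)
  have heb : ∀ z ∈ Metric.ball c r₁, e z ≠ 0 := by
    intro z hz h
    have : z ∈ Z := (hZ z).2 ⟨Metric.ball_subset_closedBall hz, by
      rw [hfe z (hcU (hball z hz)), h, mul_zero]⟩
    exact he0 z this h
  have hP0 : ∀ z ∈ Metric.ball c r₁, ∏ ρ ∈ Z, B ρ z ^ m ρ ≠ 0 := fun z hz =>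
    Finset.prod_ne_zero_iff.2 fun ρ hρ => pow_ne_zero _ (hB0 ρ hρ z (hball z hz))
  have hGlog := norm_logDeriv_le_of_ne_zero h₂ h₁ hM
    (hGd.mono fun z hz => hcU (hball z hz))
    (fun z hz => mul_ne_zero (hP0 z hz) (heb z hz))
    (fun z hz => (hGle z (hball z hz)).trans (by gcongr)) hz
  have hz1 : z ∈ Metric.ball c r₁ := Metric.closedBall_subset_ball h₁ hz
  have hzU := hcU (hball z hz1)
  have hzZ : z ∉ Z := fun h => hfz ((hZ z).1 h).2
  have hlf := logDeriv_eq_sum_add_logDeriv hU he hfe hzU hfz hzZ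
  have hlG : logDeriv G z = ∑ ρ ∈ Z, m ρ * logDeriv (B ρ) z + logDeriv e z := by
    rw [hG, logDeriv_mul (f := fun z => ∏ ρ ∈ Z, B ρ z ^ m ρ) z (hP0 z hz1) (heb z hz1)
      (DifferentiableAt.fun_finsetProd fun ρ _ => ((hBd ρ) z).pow _)
      (he.differentiableAt (hU.mem_nhds hzU)), logDeriv_prod (f := fun ρ z => B ρ z ^ m ρ)
      (fun ρ hρ => pow_ne_zero _ (hB0 ρ hρ z (hball z hz1))) (fun ρ _ => ((hBd ρ) z).pow _)]
    congr 1
    refine Finset.sum_congr rfl fun ρ _ => ?_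
    rw [logDeriv_fun_pow ((hBd ρ) z)]
  have hBlog : ∀ ρ ∈ Z, ‖logDeriv (B ρ) z‖ ≤ K₃ := by
    intro ρ hρ
    have h1 : HasDerivAt (B ρ) (-conj (ρ - c) / R) z := by
      have := ((((hasDerivAt_id z).sub_const c).const_mul (conj (ρ - c))).const_sub
        ((R : ℂ) ^ 2)).div_const (R : ℂ)
      exact this.congr_deriv (by simp)
    have h2 := sub_le_norm_blaschke (R := R) (hZr ρ hρ) (mem_closedBall_iff_norm.1 hz)
    have hRc : (R : ℂ) ≠ 0 := by exact_mod_cast hR0.ne'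
    rw [logDeriv_apply, h1.deriv, hB, div_div_div_cancel_right₀ hRc, norm_div, norm_neg,
      RCLike.norm_conj, hK₃]
    exact div_le_div₀ hr1.le (hZr ρ hρ) hden h2
  have hsum : ‖∑ ρ ∈ Z, (m ρ : ℂ) * logDeriv (B ρ) z‖ ≤ K₁ * K₃ * M := by
    refine (norm_sum_le _ _).trans ?_
    calc ∑ ρ ∈ Z, ‖(m ρ : ℂ) * logDeriv (B ρ) z‖ ≤ ∑ ρ ∈ Z, (m ρ : ℝ) * K₃ := by
          refine Finset.sum_le_sum fun ρ hρ => ?_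
          rw [norm_mul, Complex.norm_natCast]
          gcongr
          exact hBlog ρ hρ
      _ = N * K₃ := by rw [← Finset.sum_mul, hN]; push_cast; rfl
      _ ≤ K₁ * M * K₃ := by gcongr
      _ = _ := by ring
  rw [hlf, add_sub_cancel_left, eq_sub_of_add_eq' hlG.symm]
  calc ‖logDeriv G z - ∑ ρ ∈ Z, (m ρ : ℂ) * logDeriv (B ρ) z‖ ≤ K₂ * M + K₁ * K₃ * M :=
        (norm_sub_le _ _).trans (add_le_add hGlog hsum)
    _ ≤ _ := by nlinarith [mul_pos hK₁0 hM]

end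

/-! ### Growth of the zeta function to the right of the imaginary axis -/

/-- The fractional part on `(1, ∞)`, extended by zero. -/
noncomputable def fractTail : ℝ → ℂ := indicator (Ioi 1) fun x => ((Int.fract x : ℝ) : ℂ)

theorem norm_fractTail_le (x : ℝ) : ‖fractTail x‖ ≤ 1 := by
  rw [fractTail, indicator_apply]
  split_ifs
  · rw [norm_real, Real.norm_of_nonneg (Int.fract_nonneg x)]
    exact (Int.fract_lt_one x).le
  · simp

theorem measurable_fractTail : Measurable fractTail :=
  (measurable_ofReal.comp measurable_fract).indicator measurableSet_Ioi

theorem mellin_fractTail_eq (s : ℂ) :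
    mellin fractTail (-s) = ∫ x in Ioi (1 : ℝ), (x : ℂ) ^ (-(s + 1)) * ((Int.fract x : ℝ) : ℂ) := by
  have h : ∀ x : ℝ, (x : ℂ) ^ (-s - 1) • fractTail x =
      indicator (Ioi 1) (fun x : ℝ => (x : ℂ) ^ (-(s + 1)) * ((Int.fract x : ℝ) : ℂ)) x := by
    intro x
    rw [← neg_add']
    by_cases hx : x ∈ Ioi (1 : ℝ) <;> simp [fractTail, hx]
  rw [mellin]
  simp_rw [h]
  rw [setIntegral_indicator measurableSet_Ioi, inter_eq_self_of_subset_right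
    (Ioi_subset_Ioi zero_le_one)]

theorem differentiableAt_mellin_fractTail {s : ℂ} (hs : 0 < s.re) :
    DifferentiableAt ℂ (fun s => mellin fractTail (-s)) s := by
  have : DifferentiableAt ℂ (mellin fractTail) (-s) := by
    refine mellin_differentiableAt_of_isBigO_rpow (a := 0) (b := -s.re - 1) ?_ ?_ (by simpa) ?_
      (by simp)
    · refine MeasureTheory.LocallyIntegrable.locallyIntegrableOn ?_ _
      refine (locallyIntegrable_const (1 : ℝ)).mono measurable_fractTail.aestronglyMeasurable
        (ae_of_all _ fun x => ?_)
      simpa using norm_fractTail_le x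
    · refine Asymptotics.IsBigO.of_bound 1 (Eventually.of_forall fun x => ?_)
      simpa using norm_fractTail_le x
    · refine Asymptotics.IsBigO.of_bound 0 ?_
      filter_upwards [Ioo_mem_nhdsGT (zero_lt_one' ℝ)] with x hx
      simp [fractTail, hx.2.le]
  exact this.comp s differentiableAt_id.neg

theorem norm_mellin_fractTail_le {s : ℂ} (hs : 0 < s.re) :
    ‖mellin fractTail (-s)‖ ≤ 1 / s.re := by
  rw [mellin_fractTail_eq]
  have hlt : -(s.re + 1) < -1 := by linarith
  calc ‖∫ x in Ioi (1 : ℝ), (x : ℂ) ^ (-(s + 1)) * ((Int.fract x : ℝ) : ℂ)‖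
      ≤ ∫ x in Ioi (1 : ℝ), x ^ (-(s.re + 1)) := by
        refine norm_integral_le_of_norm_le (integrableOn_Ioi_rpow_of_lt hlt one_pos) ?_
        filter_upwards [ae_restrict_mem measurableSet_Ioi] with x hx
        have hx0 : 0 < x := zero_lt_one.trans hx
        rw [norm_mul, norm_cpow_eq_rpow_re_of_pos hx0, norm_real,
          Real.norm_of_nonneg (Int.fract_nonneg x)]
        simpa using mul_le_of_le_one_right (Real.rpow_nonneg hx0.le _) (Int.fract_lt_one x).le
    _ = 1 / s.re := by
        rw [integral_Ioi_rpow_of_lt hlt one_pos]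
        simp [neg_div_neg_eq]

theorem riemannZeta_eq_of_one_lt_re {s : ℂ} (hs : 1 < s.re) :
    riemannZeta s = s / (s - 1) - s * mellin fractTail (-s) := by
  have hs1 : s - 1 ≠ 0 := by
    intro h
    rw [sub_eq_zero] at h
    simp [h] at hs
  have h1 : riemannZeta s = s * ∫ t in Ioi (1 : ℝ), ((⌊t⌋₊ : ℕ) : ℂ) * (t : ℂ) ^ (-(s + 1)) := by
    rw [← LSeries_one_eq_riemannZeta hs, LSeries_eq_mul_integral' 1 zero_le_one hs]
    · simp
    · simp [Asymptotics.isBigO_refl]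
  have hint1 : IntegrableOn (fun t : ℝ => (t : ℂ) ^ (-s)) (Ioi 1) :=
    integrableOn_Ioi_cpow_of_lt (by simpa using hs) one_pos
  have hint2 : IntegrableOn (fun x : ℝ => (x : ℂ) ^ (-(s + 1)) * ((Int.fract x : ℝ) : ℂ))
      (Ioi 1) := by
    have h0 : IntegrableOn (fun x : ℝ => (x : ℂ) ^ (-(s + 1))) (Ioi 1) :=
      integrableOn_Ioi_cpow_of_lt (by simp; linarith) one_pos
    refine Integrable.mul_bdd h0 (c := 1)
      (measurable_ofReal.comp measurable_fract).aestronglyMeasurable (ae_of_all _ fun x => ?_)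
    rw [norm_real, Real.norm_of_nonneg (Int.fract_nonneg x)]
    exact (Int.fract_lt_one x).le
  have h2 : ∫ t in Ioi (1 : ℝ), ((⌊t⌋₊ : ℕ) : ℂ) * (t : ℂ) ^ (-(s + 1)) =
      (∫ t in Ioi (1 : ℝ), (t : ℂ) ^ (-s)) -
        ∫ x in Ioi (1 : ℝ), (x : ℂ) ^ (-(s + 1)) * ((Int.fract x : ℝ) : ℂ) := by
    rw [← integral_sub hint1 hint2]
    refine setIntegral_congr_fun measurableSet_Ioi fun t ht => ?_
    have ht0 : 0 < t := zero_lt_one.trans ht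
    have htc : (t : ℂ) ≠ 0 := by exact_mod_cast ht0.ne'
    have h3 : ((⌊t⌋₊ : ℕ) : ℂ) = t - ((Int.fract t : ℝ) : ℂ) := by
      rw [Int.fract, ← natCast_floor_eq_intCast_floor ht0.le]
      push_cast
      ring
    have h4 : (t : ℂ) ^ (-s) = t * (t : ℂ) ^ (-(s + 1)) := by
      rw [show -s = 1 + -(s + 1) by ring, cpow_add _ _ htc, cpow_one]
    simp only [h3, h4]
    ring
  rw [h1, h2, integral_Ioi_cpow_of_lt (by simpa using hs) one_pos, mellin_fractTail_eq]
  have h5 : -s + 1 ≠ 0 := by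
    intro h
    exact hs1 (by linear_combination -h)
  simp only [ofReal_one, one_cpow]
  field_simp
  ring

/-- Continuation of `ζ(s) = s/(s-1) - s ∫₁^∞ {x} x^{-s-1} dx` from `Re s > 1` to `Re s > 0`: both
sides, multiplied by `s - 1`, are holomorphic there. -/
theorem riemannZeta_eq_of_re_pos {s : ℂ} (hs : 0 < s.re) (hs1 : s ≠ 1) :
    riemannZeta s = s / (s - 1) - s * mellin fractTail (-s) := by
  have hU : IsOpen {s : ℂ | 0 < s.re} := isOpen_lt continuous_const continuous_re
  have hF : AnalyticOnNhd ℂ (fun s => s - (s - 1) * s * mellin fractTail (-s))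
      {s : ℂ | 0 < s.re} := by
    refine DifferentiableOn.analyticOnNhd (fun s hs => ?_) hU
    refine DifferentiableAt.differentiableWithinAt ?_
    exact differentiableAt_id.sub (((differentiableAt_id.sub_const _).mul differentiableAt_id).mul
      (differentiableAt_mellin_fractTail hs))
  have hZ : AnalyticOnNhd ℂ riemannZeta₁ {s : ℂ | 0 < s.re} :=
    differentiable_riemannZeta₁.differentiableOn.analyticOnNhd hU
  have heq : EqOn riemannZeta₁ (fun s => s - (s - 1) * s * mellin fractTail (-s))
      {s : ℂ | 0 < s.re} := by
    refine hZ.eqOn_of_preconnected_of_eventuallyEq hF (z₀ := 2)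
      (convex_halfSpace_re_gt 0).isPreconnected (by simp) ?_
    filter_upwards [(isOpen_lt continuous_const continuous_re).mem_nhds
      (show (1 : ℝ) < (2 : ℂ).re by simp)] with z hz
    have hz1 : z - 1 ≠ 0 := by
      intro h
      rw [sub_eq_zero] at h
      simp [h] at hz
    have h2 := riemannZeta_eq_of_one_lt_re hz
    rw [riemannZeta_eq_inv_sub_mul (sub_ne_zero.1 hz1)] at h2
    field_simp at h2
    linear_combination h2
  have hs1' : s - 1 ≠ 0 := sub_ne_zero.2 hs1
  have := heq hs
  rw [riemannZeta_eq_inv_sub_mul hs1, this]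
  field_simp

theorem norm_riemannZeta_le {s : ℂ} {δ : ℝ} (hδ : 0 < δ) (hs : δ ≤ s.re) (hs4 : s.re ≤ 4)
    (him : 1 ≤ |s.im|) : ‖riemannZeta s‖ ≤ (2 + 5 / δ) * |s.im| := by
  have hs0 : 0 < s.re := hδ.trans_le hs
  have him1 : |s.im| ≤ ‖s - 1‖ := by simpa using abs_im_le_norm (s - 1)
  have hs1 : s ≠ 1 := by
    rintro rfl
    simp at him
    linarith
  have hn : ‖s‖ ≤ 5 * |s.im| := by
    refine (norm_le_abs_re_add_abs_im s).trans ?_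
    rw [abs_of_pos hs0]
    linarith
  have h1 : ‖s / (s - 1)‖ ≤ 2 := by
    rw [norm_div, div_le_iff₀ (by linarith)]
    calc ‖s‖ = ‖s - 1 + 1‖ := by simp
      _ ≤ ‖s - 1‖ + 1 := by simpa using norm_add_le (s - 1) 1
      _ ≤ _ := by linarith
  have h2 : ‖s * mellin fractTail (-s)‖ ≤ 5 * |s.im| * (1 / δ) := by
    rw [norm_mul]
    have := norm_mellin_fractTail_le hs0
    have h3 : 1 / s.re ≤ 1 / δ := one_div_le_one_div_of_le hδ hs
    gcongr
    exact this.trans h3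
  rw [riemannZeta_eq_of_re_pos hs0 hs1]
  calc _ ≤ 2 + 5 * |s.im| * (1 / δ) := (norm_sub_le _ _).trans (add_le_add h1 h2)
    _ ≤ 2 * |s.im| + 5 * |s.im| * (1 / δ) := by gcongr; linarith
    _ = _ := by ring

/-- On the line `Re s = 2` the Riemann zeta function stays away from zero. -/
theorem quarter_le_norm_riemannZeta {s : ℂ} (hs : s.re = 2) : 1 / 4 ≤ ‖riemannZeta s‖ := by
  have hs1 : 1 < s.re := by rw [hs]; norm_num
  have hz := zeta_eq_tsum_one_div_nat_add_one_cpow hs1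
  have hterm : ∀ n : ℕ, ‖1 / ((n : ℂ) + 1) ^ s‖ = 1 / ((n : ℝ) + 1) ^ 2 := by
    intro n
    have h := norm_natCast_cpow_of_pos (Nat.succ_pos n) s
    push_cast at h
    rw [norm_div, h, hs]
    norm_num
  have hz2 : HasSum (fun n : ℕ => 1 / ((n : ℝ) + 1) ^ 2) (Real.pi ^ 2 / 6) := by
    have := (hasSum_nat_add_iff' (f := fun n : ℕ => 1 / (n : ℝ) ^ 2) 1).2 hasSum_zeta_two
    simpa using this
  have hsum : Summable fun n : ℕ => 1 / ((n : ℂ) + 1) ^ s :=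
    Summable.of_norm (by simp_rw [hterm]; exact hz2.summable)
  have hz2' : HasSum (fun n : ℕ => 1 / (((n + 1 : ℕ) : ℝ) + 1) ^ 2) (Real.pi ^ 2 / 6 - 1) := by
    have := (hasSum_nat_add_iff' (f := fun n : ℕ => 1 / ((n : ℝ) + 1) ^ 2) 1).2 hz2
    simpa using this
  rw [hsum.tsum_eq_zero_add] at hz
  have hle : ‖∑' n : ℕ, 1 / (((n + 1 : ℕ) : ℂ) + 1) ^ s‖ ≤ Real.pi ^ 2 / 6 - 1 := by
    refine tsum_of_norm_bounded hz2' fun n => ?_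
    rw [hterm]
  have hpi : Real.pi ^ 2 / 6 - 1 ≤ 3 / 4 := by
    nlinarith [Real.pi_lt_d2, Real.pi_pos]
  rw [hz]
  have := norm_sub_norm_le (1 : ℂ) (-∑' n : ℕ, 1 / (((n + 1 : ℕ) : ℂ) + 1) ^ s)
  simp only [norm_neg, norm_one, sub_neg_eq_add] at this
  simp only [Nat.cast_zero, zero_add, one_cpow, div_one]
  linarith

/-! ### Zeros of the zeta function at a given height -/

theorem analyticOnNhd_riemannZeta : AnalyticOnNhd ℂ riemannZeta {1}ᶜ :=
  differentiableOn_riemannZeta.analyticOnNhd isOpen_compl_singleton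

theorem analyticOrderAt_riemannZeta_ne_top {s : ℂ} (hs : s ≠ 1) :
    analyticOrderAt riemannZeta s ≠ ⊤ := by
  refine analyticOnNhd_riemannZeta.analyticOrderAt_ne_top_of_isPreconnected (x := 2)
    (isConnected_compl_singleton_of_one_lt_rank (by simp) 1).isPreconnected (by simp) hs ?_
  rw [(analyticOnNhd_riemannZeta 2 (by simp)).analyticOrderAt_eq_zero.2
    (riemannZeta_ne_zero_of_one_le_re (by simp))]
  simp

theorem one_le_analyticOrderNatAt_riemannZeta {s : ℂ} (hs : s ≠ 1) (h : riemannZeta s = 0) :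
    1 ≤ analyticOrderNatAt riemannZeta s := by
  rw [Nat.one_le_iff_ne_zero, analyticOrderNatAt, Ne, ENat.toNat_eq_zero, not_or]
  exact ⟨(analyticOnNhd_riemannZeta s hs).analyticOrderAt_ne_zero.2 h,
    analyticOrderAt_riemannZeta_ne_top hs⟩

/-- In a disc around `2 + iτ` reaching to the left of the critical line, `ζ` has `O(log |τ|)` zeros,
and `ζ'/ζ` differs by `O(log |τ|)` from the sum of its principal parts at these zeros. -/
theorem exists_riemannZeta_window : ∃ A : ℝ, 0 < A ∧ ∀ τ : ℝ, 3 ≤ |τ| → ∃ Z : Finset ℂ,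
    (∀ ρ, ρ ∈ Z ↔ ρ ∈ Metric.closedBall (2 + τ * I) (17 / 10) ∧ riemannZeta ρ = 0) ∧
    ∑ ρ ∈ Z, (analyticOrderNatAt riemannZeta ρ : ℝ) ≤ A * Real.log |τ| ∧
    ∀ z ∈ Metric.closedBall (2 + τ * I) (16 / 10), riemannZeta z ≠ 0 →
      ‖logDeriv riemannZeta z - ∑ ρ ∈ Z, analyticOrderNatAt riemannZeta ρ * (z - ρ)⁻¹‖ ≤
        A * Real.log |τ| := by
  -- The disc of radius `1.6` contains the points with `1/2 ≤ Re s ≤ 2` and `|Im s - τ| ≤ 1/4`, and the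
  -- one of radius `1.8` stays in `Re s ≥ 0.2`, where `ζ` has at most linear growth.
  obtain ⟨C, hC, h⟩ := exists_zeros_logDeriv_bound (r₂ := 16 / 10) (r₁ := 17 / 10) (R := 18 / 10)
    (by norm_num) (by norm_num) (by norm_num)
  refine ⟨C * 6, by positivity, fun τ hτ => ?_⟩
  set c : ℂ := 2 + τ * I with hc
  have hre : c.re = 2 := by simp [hc]
  have him : c.im = τ := by simp [hc]
  have hfin : (Metric.closedBall c (17 / 10) ∩ riemannZetaZeros).Finite :=
    (isCompact_closedBall _ _).inter_riemannZetaZeros_finite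
  have hlog : 0 < Real.log |τ| := Real.log_pos (by linarith)
  have hbox : ∀ z ∈ Metric.closedBall c (18 / 10),
      2 / 10 ≤ z.re ∧ z.re ≤ 38 / 10 ∧ |τ| - 18 / 10 ≤ |z.im| ∧ |z.im| ≤ |τ| + 18 / 10 := by
    intro z hz
    rw [mem_closedBall_iff_norm] at hz
    have h1 := (abs_re_le_norm (z - c)).trans hz
    have h2 := (abs_im_le_norm (z - c)).trans hz
    rw [sub_re, hre, abs_le] at h1
    rw [sub_im, him] at h2
    have h3 := abs_sub_abs_le_abs_sub z.im τ
    have h4 := abs_sub_abs_le_abs_sub τ z.im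
    rw [abs_sub_comm] at h4
    refine ⟨?_, ?_, ?_, ?_⟩ <;> linarith [h1.1, h1.2]
  have hne1 : ∀ z ∈ Metric.closedBall c (18 / 10), z ≠ 1 := by
    rintro z hz rfl
    have := (hbox 1 hz).2.2.1
    norm_num at this
    linarith
  have hsub : Metric.closedBall c (17 / 10) ⊆ Metric.closedBall c (18 / 10) :=
    Metric.closedBall_subset_closedBall (by norm_num)
  refine ⟨hfin.toFinset, fun ρ => by simp [riemannZetaZeros], ?_⟩
  have hq := quarter_le_norm_riemannZeta hre
  have := h c riemannZeta {1}ᶜ (6 * Real.log |τ|) hfin.toFinset isOpen_compl_singleton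
    differentiableOn_riemannZeta (fun z hz => hne1 z hz) (by positivity)
    (norm_pos_iff.1 (by linarith)) ?_ (fun ρ => by simp [riemannZetaZeros]) ?_
  · simpa only [mul_assoc] using this
  · intro z hz
    have hz' := Metric.sphere_subset_closedBall hz
    obtain ⟨h1, h2, h3, h4⟩ := hbox z hz'
    have h5 := norm_riemannZeta_le (δ := 2 / 10) (by norm_num) h1 (by linarith) (by linarith)
    have h6 : Real.exp (6 * Real.log |τ|) = |τ| ^ 6 := by
      rw [mul_comm, Real.exp_mul, Real.exp_log (by linarith)]
      norm_cast
    rw [h6]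
    have h7 : (243 : ℝ) ≤ |τ| ^ 5 := by
      calc (243 : ℝ) = 3 ^ 5 := by norm_num
        _ ≤ |τ| ^ 5 := by gcongr
    have h8 : 243 * |τ| ≤ |τ| ^ 6 := by
      calc 243 * |τ| ≤ |τ| ^ 5 * |τ| := by gcongr
        _ = |τ| ^ 6 := by ring
    calc ‖riemannZeta z‖ ≤ 27 * |z.im| := by norm_num at h5; exact h5
      _ ≤ 243 * |τ| * (1 / 4) := by linarith
      _ ≤ |τ| ^ 6 * ‖riemannZeta c‖ := by gcongr
  · intro ρ hρ
    refine analyticOrderAt_riemannZeta_ne_top (hne1 ρ (hsub ?_))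
    simp at hρ
    simpa using hρ.1

/-- An interval contains a point which is not too close to any of finitely many given points. -/
theorem exists_mem_Icc_far (S : Finset ℝ) (a : ℝ) {L : ℝ} (hL : 0 < L) :
    ∃ T ∈ Icc a (a + L), ∀ x ∈ S, L / (4 * (S.card + 1)) ≤ |T - x| := by
  by_contra! hcon
  set δ := L / (4 * ((S.card : ℝ) + 1)) with hδ
  have hδ0 : 0 < δ := by positivity
  have hcov : Icc a (a + L) ⊆ ⋃ x ∈ S, Metric.ball x δ := by
    intro T hT
    obtain ⟨x, hx, hxT⟩ := hcon T hT
    simp only [mem_iUnion, exists_prop]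
    exact ⟨x, hx, by rwa [Metric.mem_ball, Real.dist_eq]⟩
  have h1 : volume (Icc a (a + L)) ≤ ∑ x ∈ S, volume (Metric.ball x δ) :=
    (measure_mono hcov).trans (measure_biUnion_finset_le _ _)
  simp only [Real.volume_Icc, add_sub_cancel_left, Real.volume_ball, Finset.sum_const,
    nsmul_eq_mul] at h1
  rw [← ENNReal.ofReal_natCast, ← ENNReal.ofReal_mul (by positivity),
    ENNReal.ofReal_le_ofReal_iff (by positivity)] at h1
  have h2 : (S.card : ℝ) * (2 * δ) < L := by
    have : (S.card : ℝ) * (2 * δ) = L * (S.card / (2 * (S.card + 1))) := by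
      rw [hδ]; field_simp; ring
    rw [this]
    refine mul_lt_of_lt_one_right hL ?_
    rw [div_lt_one (by positivity)]
    linarith [show (0 : ℝ) ≤ S.card by positivity]
  linarith

theorem mem_closedBall_two_add {s : ℂ} {τ : ℝ} (h1 : 1 / 2 ≤ s.re) (h2 : s.re ≤ 2)
    (h3 : |s.im - τ| ≤ 1 / 4) : s ∈ Metric.closedBall (2 + τ * I) (16 / 10) := by
  rw [mem_closedBall_iff_norm, Complex.norm_eq_sqrt_sq_add_sq, Real.sqrt_le_left (by norm_num)]
  rw [abs_le] at h3
  simp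
  nlinarith

/-- There are heights `T` in every interval `[τ, τ + 1/4]` at which `ζ'/ζ` is `O(log² τ)` in the
right half of the critical strip. -/
theorem exists_height_logDeriv_riemannZeta : ∃ A : ℝ, 0 < A ∧ ∀ τ : ℝ, 3 ≤ τ →
    ∃ T ∈ Icc τ (τ + 1 / 4), ∀ s : ℂ, 1 / 2 ≤ s.re → s.re ≤ 2 → |s.im| = T →
      riemannZeta s ≠ 0 ∧ ‖logDeriv riemannZeta s‖ ≤ A * Real.log τ ^ 2 := by
  obtain ⟨A, hA, h⟩ := exists_riemannZeta_window
  refine ⟨A + A * (16 * (2 * A + 1)), by positivity, fun τ hτ => ?_⟩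
  have hτ0 : 0 < τ := by linarith
  have habs : |τ| = τ := abs_of_pos hτ0
  obtain ⟨Z₁, hZ₁, hs₁, hl₁⟩ := h τ (by rwa [habs])
  obtain ⟨Z₂, hZ₂, hs₂, hl₂⟩ := h (-τ) (by rwa [abs_neg, habs])
  rw [abs_neg] at hs₂ hl₂
  rw [habs] at hs₁ hl₁ hs₂ hl₂
  set l := Real.log τ with hl
  have hl1 : 1 ≤ l := by
    rw [hl, Real.le_log_iff_exp_le hτ0]
    linarith [Real.exp_one_lt_d9]
  classical
  set S : Finset ℝ := Z₁.image (fun ρ => |ρ.im|) ∪ Z₂.image (fun ρ => |ρ.im|) with hS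
  have hne : ∀ t : ℝ, |t| = τ → ∀ ρ ∈ Metric.closedBall (2 + t * I) (17 / 10), ρ ≠ 1 := by
    rintro t ht ρ hρ rfl
    rw [mem_closedBall_iff_norm] at hρ
    have := (abs_im_le_norm _).trans hρ
    simp [ht] at this
    linarith
  have hcard : ∀ t : ℝ, |t| = τ → ∀ Z : Finset ℂ,
      (∀ ρ, ρ ∈ Z ↔ ρ ∈ Metric.closedBall (2 + t * I) (17 / 10) ∧ riemannZeta ρ = 0) →
      ∑ ρ ∈ Z, (analyticOrderNatAt riemannZeta ρ : ℝ) ≤ A * l → (Z.card : ℝ) ≤ A * l := by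
    intro t ht Z hZ hle
    refine le_trans ?_ hle
    rw [Finset.card_eq_sum_ones, Nat.cast_sum]
    refine Finset.sum_le_sum fun ρ hρ => ?_
    have h1 := (hZ ρ).1 hρ
    exact_mod_cast one_le_analyticOrderNatAt_riemannZeta (hne t ht ρ h1.1) h1.2
  have hc₁ := hcard τ habs Z₁ hZ₁ hs₁
  have hc₂ := hcard (-τ) (by rw [abs_neg, habs]) Z₂ hZ₂ hs₂
  have hSc : (S.card : ℝ) ≤ 2 * A * l := by
    have h1 : S.card ≤ Z₁.card + Z₂.card :=
      (Finset.card_union_le _ _).trans (add_le_add Finset.card_image_le Finset.card_image_le)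
    have h2 : (S.card : ℝ) ≤ Z₁.card + Z₂.card := by exact_mod_cast h1
    linarith
  obtain ⟨T, hT, hfar⟩ := exists_mem_Icc_far S τ (L := 1 / 4) (by norm_num)
  refine ⟨T, hT, fun s h1 h2 h3 => ?_⟩
  set δ : ℝ := 1 / 4 / (4 * (S.card + 1)) with hδ
  have hδ0 : 0 < δ := by positivity
  have hδi : δ⁻¹ ≤ 16 * (2 * A + 1) * l := by
    rw [hδ]
    have : (1 / 4 / (4 * ((S.card : ℝ) + 1)))⁻¹ = 16 * (S.card + 1) := by field_simp; norm_num
    rw [this]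
    nlinarith
  -- The windows at heights `τ` and `-τ` are treated in the same way.
  have key : ∀ t : ℝ, |t| = τ → |s.im - t| ≤ 1 / 4 → ∀ Z : Finset ℂ,
      (∀ ρ, ρ ∈ Z ↔ ρ ∈ Metric.closedBall (2 + t * I) (17 / 10) ∧ riemannZeta ρ = 0) →
      ∑ ρ ∈ Z, (analyticOrderNatAt riemannZeta ρ : ℝ) ≤ A * l →
      (∀ ρ ∈ Z, |ρ.im| ∈ S) →
      (∀ z ∈ Metric.closedBall (2 + t * I) (16 / 10), riemannZeta z ≠ 0 →
      ‖logDeriv riemannZeta z - ∑ ρ ∈ Z, analyticOrderNatAt riemannZeta ρ * (z - ρ)⁻¹‖ ≤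
        A * l) → riemannZeta s ≠ 0 ∧ ‖logDeriv riemannZeta s‖ ≤
          (A + A * (16 * (2 * A + 1))) * l ^ 2 := by
    intro t ht hst Z hZ hs hZS hlog
    have hsb := mem_closedBall_two_add h1 h2 hst
    have hdist : ∀ ρ ∈ Z, δ ≤ ‖s - ρ‖ := by
      intro ρ hρ
      have h4 := hfar _ (hZS ρ hρ)
      rw [← h3] at h4
      have h5 := abs_im_le_norm (s - ρ)
      rw [sub_im] at h5
      exact (h4.trans (abs_abs_sub_abs_le_abs_sub _ _)).trans h5
    have hs0 : riemannZeta s ≠ 0 := by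
      intro h0
      have h4 : s ∈ Z := (hZ s).2 ⟨Metric.closedBall_subset_closedBall (by norm_num) hsb, h0⟩
      have := hdist s h4
      simp at this
      linarith
    refine ⟨hs0, ?_⟩
    have hsum : ‖∑ ρ ∈ Z, (analyticOrderNatAt riemannZeta ρ : ℂ) * (s - ρ)⁻¹‖ ≤
        A * l * (16 * (2 * A + 1) * l) := by
      refine (norm_sum_le _ _).trans ?_
      calc ∑ ρ ∈ Z, ‖(analyticOrderNatAt riemannZeta ρ : ℂ) * (s - ρ)⁻¹‖
          ≤ ∑ ρ ∈ Z, (analyticOrderNatAt riemannZeta ρ : ℝ) * (16 * (2 * A + 1) * l) := by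
            refine Finset.sum_le_sum fun ρ hρ => ?_
            rw [norm_mul, Complex.norm_natCast, norm_inv]
            gcongr
            exact (inv_anti₀ hδ0 (hdist ρ hρ)).trans hδi
        _ ≤ _ := by
            rw [← Finset.sum_mul]
            gcongr
    have h6 := norm_sub_norm_le (logDeriv riemannZeta s)
      (∑ ρ ∈ Z, (analyticOrderNatAt riemannZeta ρ : ℂ) * (s - ρ)⁻¹)
    have h7 := hlog s hsb hs0
    have h8 : A * l ≤ A * l ^ 2 := by nlinarith [mul_nonneg hA.le (sub_nonneg.2 hl1)]
    calc ‖logDeriv riemannZeta s‖ ≤ A * l ^ 2 + A * l * (16 * (2 * A + 1) * l) := by linarith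
      _ = _ := by ring
  rcases abs_eq (by linarith [hT.1] : (0 : ℝ) ≤ T) |>.1 h3 with h4 | h4
  · refine key τ habs ?_ Z₁ hZ₁ hs₁ (fun ρ hρ => ?_) hl₁
    · rw [h4, abs_le]; constructor <;> linarith [hT.1, hT.2]
    · exact Finset.mem_union_left _ (Finset.mem_image_of_mem _ hρ)
  · refine key (-τ) (by rw [abs_neg, habs]) ?_ Z₂ hZ₂ hs₂ (fun ρ hρ => ?_) hl₂
    · rw [h4, abs_le]; constructor <;> linarith [hT.1, hT.2]
    · exact Finset.mem_union_right _ (Finset.mem_image_of_mem _ hρ)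

/-- The number of zeros in the right half of the critical strip, with ordinates in
`[τ, τ + 1/4]` or `[-τ - 1/4, -τ]`, is `O(log τ)`. -/
theorem exists_card_zeros_le : ∃ A : ℝ, 0 < A ∧ ∀ τ : ℝ, 3 ≤ τ → ∀ F : Finset ℂ,
    (∀ ρ ∈ F, riemannZeta ρ = 0 ∧ 1 / 2 ≤ ρ.re ∧ ρ.re ≤ 2 ∧ |ρ.im| ∈ Icc τ (τ + 1 / 4)) →
    ∑ ρ ∈ F, (analyticOrderNatAt riemannZeta ρ : ℝ) ≤ A * Real.log τ := by
  obtain ⟨A, hA, h⟩ := exists_riemannZeta_window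
  refine ⟨2 * A, by positivity, fun τ hτ F hF => ?_⟩
  have habs : |τ| = τ := abs_of_pos (by linarith)
  obtain ⟨Z₁, hZ₁, hs₁, -⟩ := h τ (by rwa [habs])
  obtain ⟨Z₂, hZ₂, hs₂, -⟩ := h (-τ) (by rwa [abs_neg, habs])
  rw [abs_neg] at hs₂
  rw [habs] at hs₁ hs₂
  classical
  have hsub : F ⊆ Z₁ ∪ Z₂ := by
    intro ρ hρ
    obtain ⟨h0, h1, h2, h3⟩ := hF ρ hρ
    have hb : Metric.closedBall (2 + (τ : ℂ) * I) (16 / 10) ⊆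
      Metric.closedBall (2 + (τ : ℂ) * I) (17 / 10) :=
        Metric.closedBall_subset_closedBall (by norm_num)
    have hb' : Metric.closedBall (2 + ((-τ : ℝ) : ℂ) * I) (16 / 10) ⊆
      Metric.closedBall (2 + ((-τ : ℝ) : ℂ) * I) (17 / 10) :=
        Metric.closedBall_subset_closedBall (by norm_num)
    rcases le_total 0 ρ.im with h4 | h4
    · rw [abs_of_nonneg h4] at h3
      refine Finset.mem_union_left _ ((hZ₁ ρ).2 ⟨hb (mem_closedBall_two_add h1 h2 ?_), h0⟩)
      rw [abs_le]; constructor <;> linarith [h3.1, h3.2]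
    · rw [abs_of_nonpos h4] at h3
      refine Finset.mem_union_right _ ((hZ₂ ρ).2 ⟨hb' (mem_closedBall_two_add h1 h2 ?_), h0⟩)
      rw [abs_le]; constructor <;> linarith [h3.1, h3.2]
  calc ∑ ρ ∈ F, (analyticOrderNatAt riemannZeta ρ : ℝ)
      ≤ ∑ ρ ∈ Z₁ ∪ Z₂, (analyticOrderNatAt riemannZeta ρ : ℝ) :=
        Finset.sum_le_sum_of_subset_of_nonneg hsub fun _ _ _ => by positivity
    _ ≤ ∑ ρ ∈ Z₁, (analyticOrderNatAt riemannZeta ρ : ℝ) +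
        ∑ ρ ∈ Z₂, (analyticOrderNatAt riemannZeta ρ : ℝ) := by
        rw [← Finset.sum_union_inter]
        exact le_add_of_nonneg_right (Finset.sum_nonneg fun _ _ => by positivity)
    _ ≤ 2 * A * Real.log τ := by linarith

/-! ### The logarithmic derivative of the archimedean factor -/

/-- The integral `∫₀ⁿ (1 - x/n)ⁿ x^{s-1} dx` representing `GammaSeq s n` is dominated by that of
`Γ`. -/
theorem norm_GammaSeq_le {s : ℂ} (hs : 0 < s.re) {n : ℕ} (hn : n ≠ 0) :
    ‖GammaSeq s n‖ ≤ Real.Gamma s.re := by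
  rw [GammaSeq_eq_approx_Gamma_integral hs hn,
    intervalIntegral.integral_of_le (by positivity : (0 : ℝ) ≤ n), Real.Gamma_eq_integral hs]
  have hint := Real.GammaIntegral_convergent hs
  refine (norm_integral_le_of_norm_le (hint.mono_set Ioc_subset_Ioi_self) ?_).trans
    (setIntegral_mono_set hint ?_ Ioc_subset_Ioi_self.eventuallyLE)
  · filter_upwards [ae_restrict_mem measurableSet_Ioc] with x hx
    rw [norm_mul, norm_real, Real.norm_of_nonneg
      (pow_nonneg (sub_nonneg.mpr <| div_le_one_of_le₀ hx.2 <| by positivity) _),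
      norm_cpow_eq_rpow_re_of_pos hx.1, sub_re, one_re]
    have := Real.rpow_nonneg hx.1.le (s.re - 1)
    gcongr
    exact Real.one_sub_div_pow_le_exp_neg hx.2
  · filter_upwards [ae_restrict_mem measurableSet_Ioi] with x hx
    have := Real.rpow_nonneg (mem_Ioi.1 hx).le (s.re - 1)
    simp only [Pi.zero_apply]
    positivity

theorem differentiableAt_GammaSeq {s : ℂ} (hs : 0 < s.re) {n : ℕ} (hn : n ≠ 0) :
    DifferentiableAt ℂ (fun s => GammaSeq s n) s := by
  have hn' : (n : ℂ) ≠ 0 := Nat.cast_ne_zero.2 hn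
  refine ((differentiableAt_id.const_cpow (Or.inl hn')).mul_const _).div
    (DifferentiableAt.fun_finsetProd fun j _ => by fun_prop) ?_
  refine Finset.prod_ne_zero_iff.2 fun j _ h => ?_
  have := congrArg re h
  simp at this
  linarith [show (0 : ℝ) ≤ j by positivity]

/-- The functions `GammaSeq · n` are locally uniformly bounded, so by Cauchy's formula their
derivatives converge to that of `Gamma`. -/
theorem tendsto_deriv_GammaSeq {z : ℂ} (hz : 0 < z.re) :
    Tendsto (fun n => deriv (fun s => GammaSeq s n) z) atTop (𝓝 (deriv Gamma z)) := by
  set r := z.re / 2 with hr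
  have hr0 : 0 < r := by positivity
  have hU : IsOpen {s : ℂ | 0 < s.re} := isOpen_lt continuous_const continuous_re
  have hsub : Metric.closedBall z r ⊆ {s : ℂ | 0 < s.re} := by
    intro w hw
    rw [mem_closedBall_iff_norm] at hw
    have := (abs_re_le_norm (w - z)).trans hw
    rw [sub_re, abs_le] at this
    simp only [mem_ofPred_eq]
    linarith [this.1]
  have hzb : z ∈ Metric.ball z r := Metric.mem_ball_self hr0
  have hcirc : ∀ θ, circleMap z r θ ∈ Metric.closedBall z r := fun θ =>
    circleMap_mem_closedBall z hr0.le θ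
  have hcΓ : ContinuousOn (fun w : ℂ => Real.Gamma w.re) {s : ℂ | 0 < s.re} := by
    refine Real.differentiableOn_Gamma_Ioi.continuousOn.comp continuous_re.continuousOn ?_
    intro w hw
    exact hw
  obtain ⟨C, hC⟩ := (isCompact_closedBall z r).exists_bound_of_continuousOn (hcΓ.mono hsub)
  have hseq : ∀ n : ℕ, n ≠ 0 → DifferentiableOn ℂ (fun s => GammaSeq s n) {s : ℂ | 0 < s.re} :=
    fun n hn s hs => (differentiableAt_GammaSeq hs hn).differentiableWithinAt
  have hGd : DifferentiableOn ℂ Gamma {s : ℂ | 0 < s.re} := fun s hs =>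
    (differentiableAt_Gamma s fun m h => by
      have h1 := congrArg re h
      simp at h1
      have h2 : 0 < s.re := hs
      linarith [show (0 : ℝ) ≤ m by positivity]).differentiableWithinAt
  rw [← two_pi_I_inv_smul_circleIntegral_sub_sq_inv_smul_of_differentiable hU hsub hGd hzb]
  have hlim : Tendsto (fun n => (2 * (Real.pi : ℂ) * I)⁻¹ •
      ∮ w in C(z, r), ((w - z) ^ 2)⁻¹ • GammaSeq w n) atTop
      (𝓝 ((2 * (Real.pi : ℂ) * I)⁻¹ • ∮ w in C(z, r), ((w - z) ^ 2)⁻¹ • Gamma w)) := by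
    refine Tendsto.const_smul ?_ _
    simp only [circleIntegral]
    refine intervalIntegral.tendsto_integral_filter_of_dominated_convergence
      (fun _ => r * ((r ^ 2)⁻¹ * C)) ?_ ?_ intervalIntegrable_const ?_
    · filter_upwards [eventually_ne_atTop 0] with n hn
      refine Continuous.aestronglyMeasurable ?_
      have h1 : Continuous fun θ => GammaSeq (circleMap z r θ) n :=
        (hseq n hn).continuousOn.comp_continuous (continuous_circleMap z r)
          fun θ => hsub (hcirc θ)
      have h2 : Continuous fun θ => ((circleMap z r θ - z) ^ 2)⁻¹ := by
        refine Continuous.inv₀ ((continuous_circleMap z r).sub continuous_const |>.pow 2) ?_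
        intro θ
        simpa using hr0.ne'
      simp only [deriv_circleMap]
      exact ((continuous_circleMap 0 r).mul continuous_const).smul (h2.smul h1)
    · filter_upwards [eventually_ne_atTop 0] with n hn
      refine ae_of_all _ fun θ _ => ?_
      simp only [deriv_circleMap, smul_eq_mul, norm_mul, norm_inv, norm_pow, norm_I, mul_one,
        circleMap_sub_center, norm_circleMap_zero, abs_of_pos hr0]
      gcongr
      refine (norm_GammaSeq_le (hsub (hcirc θ)) hn).trans ((le_abs_self _).trans (hC _ (hcirc θ)))
    · refine ae_of_all _ fun θ _ => ?_
      exact ((GammaSeq_tendsto_Gamma _).const_smul _).const_smul _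
  refine hlim.congr' ?_
  filter_upwards [eventually_ne_atTop 0] with n hn
  exact two_pi_I_inv_smul_circleIntegral_sub_sq_inv_smul_of_differentiable hU hsub (hseq n hn) hzb

theorem logDeriv_GammaSeq {z : ℂ} (hz : 0 < z.re) {n : ℕ} (hn : n ≠ 0) :
    logDeriv (fun s => GammaSeq s n) z = log n - ∑ j ∈ Finset.range (n + 1), (z + j)⁻¹ := by
  have hn' : (n : ℂ) ≠ 0 := Nat.cast_ne_zero.2 hn
  have hne : ∀ j : ℕ, z + j ≠ 0 := fun j h => by
    have := congrArg re h
    simp at this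
    linarith [show (0 : ℝ) ≤ j by positivity]
  have hP : ∏ j ∈ Finset.range (n + 1), (z + j) ≠ 0 := Finset.prod_ne_zero_iff.2 fun j _ => hne j
  have hpow : HasDerivAt (fun s : ℂ => (n : ℂ) ^ s) ((n : ℂ) ^ z * log n) z := by
    simpa using (hasDerivAt_id z).const_cpow (Or.inl hn')
  have hf : ((n.factorial : ℕ) : ℂ) ≠ 0 := Nat.cast_ne_zero.2 n.factorial_ne_zero
  have hnz : (n : ℂ) ^ z ≠ 0 := by simp [cpow_eq_zero_iff, hn']
  simp only [GammaSeq]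
  rw [logDeriv_div (f := fun s : ℂ => (n : ℂ) ^ s * (n.factorial : ℂ)) z (mul_ne_zero hnz hf) hP
    (hpow.differentiableAt.mul_const _) (DifferentiableAt.fun_finsetProd fun j _ => by fun_prop),
    logDeriv_mul_const _ _ hf, logDeriv_prod (f := fun (j : ℕ) (s : ℂ) => s + j) (fun j _ => hne j)
      (fun j _ => by fun_prop), logDeriv_apply, hpow.deriv, mul_div_cancel_left₀ _ hnz]
  congr 1
  refine Finset.sum_congr rfl fun j _ => ?_
  simp [logDeriv_apply]

theorem tendsto_digamma {z : ℂ} (hz : 0 < z.re) :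
    Tendsto (fun n : ℕ => log n - ∑ j ∈ Finset.range (n + 1), (z + j)⁻¹) atTop (𝓝 (digamma z)) := by
  rw [digamma_def, logDeriv_apply]
  refine ((tendsto_deriv_GammaSeq hz).div (GammaSeq_tendsto_Gamma z)
    (Gamma_ne_zero_of_re_pos hz)).congr' ?_
  filter_upwards [eventually_ne_atTop 0] with n hn
  rw [← logDeriv_GammaSeq hz hn, logDeriv_apply, Pi.div_apply]

/-- The series of the digamma function. Subtracting the limit formula at `1` from that at `z`
removes the logarithm. -/
theorem tendsto_digamma_add_gamma {z : ℂ} (hz : 0 < z.re) :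
    Tendsto (fun n : ℕ => ∑ j ∈ Finset.range n, (((j : ℂ) + 1)⁻¹ - (z + j)⁻¹)) atTop
      (𝓝 (digamma z + Real.eulerMascheroniConstant)) := by
  rw [← tendsto_add_atTop_iff_nat 1]
  have h := (tendsto_digamma hz).sub (tendsto_digamma (z := 1) (by simp))
  rw [digamma_one, sub_neg_eq_add] at h
  refine h.congr fun n => ?_
  rw [Finset.sum_sub_distrib, sub_sub_sub_cancel_left]
  simp only [add_comm (1 : ℂ)]

theorem logDeriv_Gammaℝ {s : ℂ} (hs : 0 < s.re) :
    logDeriv Gammaℝ s = -(Real.log Real.pi : ℂ) / 2 + digamma (s / 2) / 2 := by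
  have hs2 : 0 < (s / 2).re := by simpa using hs
  have hpi : (Real.pi : ℂ) ≠ 0 := by exact_mod_cast Real.pi_ne_zero
  have h1 : HasDerivAt (fun s : ℂ => (Real.pi : ℂ) ^ (-s / 2))
      ((Real.pi : ℂ) ^ (-s / 2) * log Real.pi * (-1 / 2)) s :=
    ((hasDerivAt_id s).neg.div_const 2).const_cpow (Or.inl hpi)
  have hG : DifferentiableAt ℂ Gamma (s / 2) := differentiableAt_Gamma _ fun m h => by
    have := congrArg re h
    rw [neg_re, natCast_re] at this
    linarith [show (0 : ℝ) ≤ m by positivity]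
  have h2 : HasDerivAt (fun s : ℂ => Gamma (s / 2)) (deriv Gamma (s / 2) * (1 / 2)) s :=
    hG.hasDerivAt.comp s ((hasDerivAt_id s).div_const 2)
  have hpz : (Real.pi : ℂ) ^ (-s / 2) ≠ 0 := by simp [cpow_eq_zero_iff, hpi]
  have hGz := Gamma_ne_zero_of_re_pos hs2
  have h3 : Gammaℝ = fun s => (Real.pi : ℂ) ^ (-s / 2) * Gamma (s / 2) := rfl
  rw [h3, logDeriv_mul (f := fun s : ℂ => (Real.pi : ℂ) ^ (-s / 2)) s hpz hGz
    h1.differentiableAt h2.differentiableAt, logDeriv_apply, logDeriv_apply, h1.deriv, h2.deriv,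
    digamma_def, logDeriv_apply, ofReal_log Real.pi_pos.le]
  field_simp

/-- The `j`-th term of the partial fraction expansion of `-Γℝ'/Γℝ`; the index `j` stands for the
pole at `-2 (j + 1)`. -/
noncomputable def gammaTerm (j : ℕ) (s : ℂ) : ℂ :=
  (s + 2 * (j + 1 : ℕ))⁻¹ - (2 * (j + 1 : ℕ) : ℂ)⁻¹

theorem norm_le_two_mul_norm_add {s : ℂ} (hs : 0 < s.re) {x : ℝ} (hx : 0 ≤ x) :
    ‖s‖ + x ≤ 2 * ‖s + x‖ := by
  have h1 : ‖s‖ ≤ ‖s + x‖ := by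
    rw [Complex.norm_eq_sqrt_sq_add_sq, Complex.norm_eq_sqrt_sq_add_sq]
    refine Real.sqrt_le_sqrt ?_
    simp
    nlinarith
  have h2 : x ≤ ‖s + x‖ := by
    refine le_trans ?_ (re_le_norm _)
    simp
    exact hs.le
  linarith

theorem norm_gammaTerm_le {s : ℂ} (hs : 0 < s.re) (j : ℕ) :
    ‖gammaTerm j s‖ ≤ (j + 1 : ℝ)⁻¹ - (j + 1 + ‖s‖ : ℝ)⁻¹ := by
  have hx : (0 : ℝ) < 2 * (j + 1) := by positivity
  have h1 := norm_le_two_mul_norm_add hs hx.le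
  have hn := norm_nonneg s
  push_cast at h1
  have hpos : 0 < ‖s + 2 * ((j : ℂ) + 1)‖ := by linarith
  have hne := norm_pos_iff.1 hpos
  have hj : (2 * ((j : ℂ) + 1)) ≠ 0 := by
    have : ((2 * (j + 1) : ℝ) : ℂ) ≠ 0 := by exact_mod_cast hx.ne'
    push_cast at this
    exact this
  have h2 : gammaTerm j s = -s / ((s + 2 * ((j : ℂ) + 1)) * (2 * ((j : ℂ) + 1))) := by
    rw [gammaTerm]
    push_cast
    field_simp
    ring
  have h3 : ‖2 * ((j : ℂ) + 1)‖ = 2 * (j + 1) := by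
    have : ‖((2 * (j + 1) : ℝ) : ℂ)‖ = 2 * (j + 1) := by
      rw [norm_real, Real.norm_of_nonneg hx.le]
    push_cast at this
    exact this
  rw [h2, norm_div, norm_neg, norm_mul, h3]
  have h4 : ((j : ℝ) + 1)⁻¹ - ((j : ℝ) + 1 + ‖s‖)⁻¹ = ‖s‖ / ((j + 1 + ‖s‖) * (j + 1)) := by
    field_simp
    ring
  rw [h4]
  refine div_le_div_of_nonneg_left hn (by positivity) ?_
  have h5 := mul_le_mul_of_nonneg_right (show (j : ℝ) + 1 + ‖s‖ ≤ 2 * ‖s + 2 * ((j : ℂ) + 1)‖ by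
    linarith [show (0 : ℝ) ≤ j by positivity]) (show (0 : ℝ) ≤ j + 1 by positivity)
  linarith

/-- The sum is logarithmic in `x`, uniformly in `n`: comparing `1/k` with `log (k + 1) - log k`
makes the sum telescope. -/
theorem sum_inv_sub_inv_le {x : ℝ} (hx : 0 ≤ x) (n : ℕ) :
    ∑ j ∈ Finset.range n, ((j + 1 : ℝ)⁻¹ - (j + 1 + x : ℝ)⁻¹) ≤ 1 + Real.log (2 + x) := by
  have key : ∀ n : ℕ, ∑ j ∈ Finset.range (n + 1), ((j + 1 : ℝ)⁻¹ - (j + 1 + x : ℝ)⁻¹) ≤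
      1 + Real.log (2 + x) - (Real.log (n + 2 + x) - Real.log (n + 1)) := by
    intro n
    induction n with
    | zero => simp; positivity
    | succ n ih =>
      rw [Finset.sum_range_succ]
      push_cast
      have h1 : ((n : ℝ) + 1 + 1)⁻¹ ≤ Real.log (n + 1 + 1) - Real.log (n + 1) := by
        rw [← Real.log_div (by positivity) (by positivity)]
        have := Real.one_sub_inv_le_log_of_pos
          (show (0 : ℝ) < ((n : ℝ) + 1 + 1) / (n + 1) by positivity)
        refine le_trans (le_of_eq ?_) this
        field_simp
        ring
      have h2 : Real.log (n + 1 + 2 + x) - Real.log (n + 2 + x) ≤ ((n : ℝ) + 1 + 1 + x)⁻¹ := by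
        rw [← Real.log_div (by positivity) (by positivity)]
        have := Real.log_le_sub_one_of_pos
          (show (0 : ℝ) < ((n : ℝ) + 1 + 2 + x) / (n + 2 + x) by positivity)
        refine this.trans (le_of_eq ?_)
        field_simp
        ring
      linarith
  rcases n with _ | n
  · simp
    have := Real.log_nonneg (show (1 : ℝ) ≤ 2 + x by linarith)
    positivity
  · refine (key n).trans ?_
    have := Real.log_le_log (show (0 : ℝ) < n + 1 by positivity)
      (show (n : ℝ) + 1 ≤ n + 2 + x by linarith)
    linarith

/-- The partial fraction series has absolute sum `O(log |s|)`. This is where the factor `log |Im s|`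
in the definition of the class `(E)` is needed. -/
theorem sum_norm_gammaTerm_le {s : ℂ} (hs : 0 < s.re) (n : ℕ) :
    ∑ j ∈ Finset.range n, ‖gammaTerm j s‖ ≤ 1 + Real.log (2 + ‖s‖) :=
  (Finset.sum_le_sum fun j _ => norm_gammaTerm_le hs j).trans (sum_inv_sub_inv_le (norm_nonneg s) n)

theorem summable_norm_gammaTerm {s : ℂ} (hs : 0 < s.re) : Summable fun j => ‖gammaTerm j s‖ :=
  summable_of_sum_range_le (fun _ => norm_nonneg _) (sum_norm_gammaTerm_le hs)

/-- The partial fraction expansion of the logarithmic derivative of `Γℝ`. -/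
theorem neg_logDeriv_Gammaℝ_eq {s : ℂ} (hs : 0 < s.re) :
    -logDeriv Gammaℝ s = ((Real.log Real.pi + Real.eulerMascheroniConstant : ℝ) : ℂ) / 2 + s⁻¹ +
      ∑' j, gammaTerm j s := by
  have hs2 : 0 < (s / 2).re := by simpa using hs
  have h1 : Tendsto (fun n : ℕ => ∑ j ∈ Finset.range (n + 1),
      (((j : ℂ) + 1)⁻¹ - (s / 2 + j)⁻¹)) atTop
      (𝓝 (digamma (s / 2) + Real.eulerMascheroniConstant)) :=
    (tendsto_add_atTop_iff_nat 1).2 (tendsto_digamma_add_gamma hs2)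
  have h2 := (summable_norm_gammaTerm hs).of_norm.hasSum.tendsto_sum_nat
  have h3 : Tendsto (fun n : ℕ => ((n : ℂ) + 1)⁻¹) atTop (𝓝 0) := by
    have := tendsto_one_div_add_atTop_nhds_zero_nat (𝕜 := ℂ)
    simpa only [one_div] using this
  have h4 : ∀ n : ℕ, ∑ j ∈ Finset.range (n + 1), (((j : ℂ) + 1)⁻¹ - (s / 2 + j)⁻¹) =
      -2 * (∑ j ∈ Finset.range n, gammaTerm j s) - 2 * s⁻¹ + ((n : ℂ) + 1)⁻¹ := by
    intro n
    have h5 : ∀ j : ℕ, gammaTerm j s =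
        ((s / 2 + (j + 1 : ℕ))⁻¹ - ((j : ℂ) + 1)⁻¹) / 2 := by
      intro j
      have : s + 2 * ((j : ℂ) + 1) = 2 * (s / 2 + (j + 1)) := by ring
      rw [gammaTerm]
      push_cast
      rw [this, mul_inv, mul_inv]
      ring
    have h6 : (s / 2)⁻¹ = 2 * s⁻¹ := by rw [inv_div, div_eq_mul_inv]
    rw [Finset.sum_sub_distrib, Finset.sum_range_succ (fun j : ℕ => ((j : ℂ) + 1)⁻¹),
      Finset.sum_range_succ' (fun j : ℕ => (s / 2 + (j : ℂ))⁻¹)]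
    simp only [h5, ← Finset.sum_div, Finset.sum_sub_distrib, Nat.cast_zero, add_zero, h6]
    ring
  have h5 : Tendsto (fun n : ℕ => ∑ j ∈ Finset.range (n + 1),
      (((j : ℂ) + 1)⁻¹ - (s / 2 + j)⁻¹)) atTop
      (𝓝 (-2 * (∑' j, gammaTerm j s) - 2 * s⁻¹ + 0)) := by
    simp_rw [h4]
    exact ((h2.const_mul _).sub_const _).add h3
  have h6 := tendsto_nhds_unique h1 h5
  rw [logDeriv_Gammaℝ hs]
  push_cast
  linear_combination (-1 / 2) * h6

theorem norm_logDeriv_Gammaℝ_le {s : ℂ} {δ : ℝ} (hδ : 0 < δ) (hs : δ ≤ s.re) :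
    ‖logDeriv Gammaℝ s‖ ≤
      |Real.log Real.pi + Real.eulerMascheroniConstant| + δ⁻¹ + 1 + Real.log (2 + ‖s‖) := by
  have hs0 : 0 < s.re := hδ.trans_le hs
  rw [← norm_neg, neg_logDeriv_Gammaℝ_eq hs0]
  have h1 : ‖∑' j, gammaTerm j s‖ ≤ 1 + Real.log (2 + ‖s‖) :=
    (norm_tsum_le_tsum_norm (summable_norm_gammaTerm hs0)).trans
      ((summable_norm_gammaTerm hs0).tsum_le_of_sum_range_le (sum_norm_gammaTerm_le hs0))
  have h2 : ‖s⁻¹‖ ≤ δ⁻¹ := by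
    rw [norm_inv]
    exact inv_anti₀ hδ (hs.trans (re_le_norm s))
  have h3 : ‖((Real.log Real.pi + Real.eulerMascheroniConstant : ℝ) : ℂ) / 2‖ ≤
      |Real.log Real.pi + Real.eulerMascheroniConstant| := by
    rw [norm_div, norm_real, Real.norm_eq_abs]
    refine div_le_self (abs_nonneg _) (by simp)
  calc _ ≤ _ := norm_add₃_le
    _ ≤ _ := by linarith

/-! ### Variation, size and Mellin transform of functions in the class -/

theorem eVariationOn_le_one_of_monotoneOn {f : ℝ → ℝ} {s : Set ℝ} (hf : MonotoneOn f s)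
    (h0 : ∀ x ∈ s, 0 ≤ f x) (h1 : ∀ x ∈ s, f x ≤ 1) : eVariationOn f s ≤ 1 := by
  rw [eVariationOn.eq_biSup_inter_Icc]
  simp only [mem_ofPred_eq, iSup_le_iff, and_imp, Prod.forall]
  intro a b ha hb _
  rw [hf.eVariationOn_eq ha hb, ENNReal.ofReal_le_one]
  linarith [h0 a ha, h1 b hb]

theorem eVariationOn_le_one_of_antitoneOn {f : ℝ → ℝ} {s : Set ℝ} (hf : AntitoneOn f s)
    (h0 : ∀ x ∈ s, 0 ≤ f x) (h1 : ∀ x ∈ s, f x ≤ 1) : eVariationOn f s ≤ 1 := by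
  have h := eVariationOn_le_one_of_monotoneOn (f := fun x => 1 - f x) (s := s)
    (fun x hx y hy hxy => sub_le_sub_left (hf hx hy hxy) 1)
    (fun x hx => sub_nonneg.2 (h1 x hx)) fun x hx => by linarith [h0 x hx]
  simpa only [eVariationOn, edist_sub_left] using h

theorem eVariationOn_mul_le_two {f g : ℝ → ℝ} {s : Set ℝ}
    (hf0 : ∀ x ∈ s, 0 ≤ f x) (hf1 : ∀ x ∈ s, f x ≤ 1) (hg0 : ∀ x ∈ s, 0 ≤ g x)
    (hg1 : ∀ x ∈ s, g x ≤ 1) (hf : eVariationOn f s ≤ 1) (hg : eVariationOn g s ≤ 1) :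
    eVariationOn (fun x => f x * g x) s ≤ 2 := by
  have hb : ∀ h : ℝ → ℝ, (∀ x ∈ s, 0 ≤ h x) → (∀ x ∈ s, h x ≤ 1) → ∀ x ∈ s, ‖h x‖ₑ ≤ 1 := by
    intro h h0 h1 x hx
    rw [Real.enorm_of_nonneg (h0 x hx), ENNReal.ofReal_le_one]
    exact h1 x hx
  refine (eVariationOn_fun_smul_le (f := f) (g := g) (hb f hf0 hf1) (hb g hg0 hg1)).trans ?_
  rw [one_mul, one_mul, ← one_add_one_eq_two]
  exact add_le_add hg hf

theorem weight_pos {ε u : ℝ} (hu : 0 < u) : 0 < weight ε u :=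
  add_pos (Real.rpow_pos_of_pos hu _) (Real.rpow_pos_of_pos hu _)

/-- The weight dominates every power with exponent in `[-ε, 1 + ε]`, hence controls the Mellin
transform on the whole strip. -/
theorem rpow_le_weight {ε σ u : ℝ} (h1 : -ε ≤ σ) (h2 : σ ≤ 1 + ε) (hu : 0 < u) :
    u ^ σ ≤ weight ε u := by
  rw [weight]
  have h3 := Real.rpow_pos_of_pos hu (-ε)
  have h4 := Real.rpow_pos_of_pos hu (1 + ε)
  rcases le_total u 1 with hu1 | hu1
  · linarith [Real.rpow_le_rpow_of_exponent_ge hu hu1 h1]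
  · linarith [Real.rpow_le_rpow_of_exponent_le hu1 h2]

/-- The variation of `u ^ σ / K_ε(u)` is bounded independently of `σ ∈ [-ε, 1 + ε]`: on `(0, 1]` and
on `[1, ∞)` the quotient is a product of two monotone functions with values in `[0, 1]`. -/
theorem eVariationOn_rpow_div_weight_le {ε σ : ℝ} (hε : 0 < ε) (h1 : -ε ≤ σ) (h2 : σ ≤ 1 + ε) :
    eVariationOn (fun u : ℝ => u ^ σ / weight ε u) (Ioi 0) ≤ 4 := by
  have hunion : Ioi (0 : ℝ) = Ioc 0 1 ∪ Ici 1 := (Ioc_union_Ici_eq_Ioi zero_lt_one).symm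
  have hg : IsGreatest (Ioc (0 : ℝ) 1) 1 := isGreatest_Ioc zero_lt_one
  rw [hunion, eVariationOn.union _ hg isLeast_Ici]
  have hA : eVariationOn (fun u : ℝ => u ^ σ / weight ε u) (Ioc 0 1) ≤ 2 := by
    have hq : ∀ u ∈ Ioc (0 : ℝ) 1, 0 < 1 + u ^ (1 + 2 * ε) := fun u hu => by
      have := Real.rpow_pos_of_pos hu.1 (1 + 2 * ε); positivity
    rw [eVariationOn.eq_of_eqOn (f' := fun u : ℝ => u ^ (σ + ε) * (1 + u ^ (1 + 2 * ε))⁻¹)]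
    · refine eVariationOn_mul_le_two (fun u hu => Real.rpow_nonneg hu.1.le _)
        (fun u hu => Real.rpow_le_one hu.1.le hu.2 (by linarith))
        (fun u hu => (inv_pos.2 (hq u hu)).le) (fun u hu => inv_le_one_of_one_le₀ ?_) ?_ ?_
      · linarith [Real.rpow_pos_of_pos hu.1 (1 + 2 * ε)]
      · exact eVariationOn_le_one_of_monotoneOn
          (fun u hu v hv huv => Real.rpow_le_rpow hu.1.le huv (by linarith))
          (fun u hu => Real.rpow_nonneg hu.1.le _)
          (fun u hu => Real.rpow_le_one hu.1.le hu.2 (by linarith))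
      · refine eVariationOn_le_one_of_antitoneOn (fun u hu v hv huv => inv_anti₀ (hq u hu) ?_)
          (fun u hu => (inv_pos.2 (hq u hu)).le) (fun u hu => inv_le_one_of_one_le₀ ?_)
        · have := Real.rpow_le_rpow hu.1.le huv (show 0 ≤ 1 + 2 * ε by linarith)
          linarith
        · linarith [Real.rpow_pos_of_pos hu.1 (1 + 2 * ε)]
    · intro u hu
      have hw : weight ε u = u ^ (-ε) * (1 + u ^ (1 + 2 * ε)) := by
        rw [mul_add, ← Real.rpow_add hu.1, mul_one, weight]
        ring_nf
      simp only
      rw [hw, ← div_div, ← Real.rpow_sub hu.1, sub_neg_eq_add, div_eq_mul_inv]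
  have hB : eVariationOn (fun u : ℝ => u ^ σ / weight ε u) (Ici 1) ≤ 2 := by
    have hp : ∀ u ∈ Ici (1 : ℝ), 0 < u := fun u hu => zero_lt_one.trans_le hu
    have hq : ∀ u ∈ Ici (1 : ℝ), 0 < 1 + u ^ (-1 - 2 * ε) := fun u hu => by
      have := Real.rpow_pos_of_pos (hp u hu) (-1 - 2 * ε); positivity
    rw [eVariationOn.eq_of_eqOn
      (f' := fun u : ℝ => u ^ (σ - (1 + ε)) * (1 + u ^ (-1 - 2 * ε))⁻¹)]
    · refine eVariationOn_mul_le_two (fun u hu => Real.rpow_nonneg (hp u hu).le _)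
        (fun u hu => Real.rpow_le_one_of_one_le_of_nonpos hu (by linarith))
        (fun u hu => (inv_pos.2 (hq u hu)).le) (fun u hu => inv_le_one_of_one_le₀ ?_) ?_ ?_
      · linarith [Real.rpow_pos_of_pos (hp u hu) (-1 - 2 * ε)]
      · exact eVariationOn_le_one_of_antitoneOn
          (fun u hu v hv huv => Real.rpow_le_rpow_of_nonpos (hp u hu) huv (by linarith))
          (fun u hu => Real.rpow_nonneg (hp u hu).le _)
          (fun u hu => Real.rpow_le_one_of_one_le_of_nonpos hu (by linarith))
      · refine eVariationOn_le_one_of_monotoneOn (fun u hu v hv huv => inv_anti₀ (hq v hv) ?_)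
          (fun u hu => (inv_pos.2 (hq u hu)).le) (fun u hu => inv_le_one_of_one_le₀ ?_)
        · have := Real.rpow_le_rpow_of_nonpos (hp u hu) huv (show -1 - 2 * ε ≤ 0 by linarith)
          linarith
        · linarith [Real.rpow_pos_of_pos (hp u hu) (-1 - 2 * ε)]
    · intro u hu
      have hw : weight ε u = u ^ (1 + ε) * (1 + u ^ (-1 - 2 * ε)) := by
        rw [mul_add, ← Real.rpow_add (hp u hu), mul_one, weight]
        ring_nf
      simp only
      rw [hw, ← div_div, ← Real.rpow_sub (hp u hu), div_eq_mul_inv]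
  calc _ ≤ (2 : ENNReal) + 2 := add_le_add hA hB
    _ = 4 := by norm_num

namespace IsClassEWith

variable {ε : ℝ} {g : ℝ → ℂ}

theorem exists_norm_mul_weight_le (h : IsClassEWith ε g) :
    ∃ C : ℝ, 0 ≤ C ∧ ∀ u, 0 < u → ‖g u‖ * weight ε u ≤ C := by
  refine ⟨‖g 1 * (weight ε 1 : ℂ)‖ +
    (eVariationOn (fun u : ℝ => g u * (weight ε u : ℂ)) (Ioi 0)).toReal, by positivity, ?_⟩
  intro u hu
  have h1 := h.boundedVariation.dist_le (x := u) (y := 1) hu (by simp)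
  rw [dist_eq_norm] at h1
  have h2 := norm_sub_norm_le (g u * (weight ε u : ℂ)) (g 1 * (weight ε 1 : ℂ))
  have h3 : ‖g u * (weight ε u : ℂ)‖ = ‖g u‖ * weight ε u := by
    rw [norm_mul, norm_real, Real.norm_of_nonneg (weight_pos hu).le]
  linarith

/-- All the functions `u^σ g(u)` with `σ ∈ [-ε, 1 + ε]` have variation and size bounded by one
constant. -/
theorem exists_variation_bound (hε : 0 < ε) (h : IsClassEWith ε g) :
    ∃ V : ℝ, 0 ≤ V ∧ ∀ σ, -ε ≤ σ → σ ≤ 1 + ε →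
      eVariationOn (fun u : ℝ => ((u ^ σ : ℝ) : ℂ) * g u) (Ioi 0) ≤ ENNReal.ofReal V ∧
      ∀ u, 0 < u → ‖g u‖ * u ^ σ ≤ V := by
  obtain ⟨C, hC0, hC⟩ := h.exists_norm_mul_weight_le
  set W := eVariationOn (fun u : ℝ => g u * (weight ε u : ℂ)) (Ioi 0) with hW
  have hWtop : W ≠ ⊤ := h.boundedVariation
  refine ⟨W.toReal + C * 4, by positivity, fun σ h1 h2 => ⟨?_, fun u hu => ?_⟩⟩
  · have hφ := eVariationOn_rpow_div_weight_le hε h1 h2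
    have h3 := eVariationOn_fun_smul_le (f := fun u : ℝ => u ^ σ / weight ε u)
      (g := fun u : ℝ => g u * (weight ε u : ℂ)) (C := 1) (D := ENNReal.ofReal C) (s := Ioi 0)
      (fun u hu => by
        have h4 := weight_pos (ε := ε) hu
        rw [Real.enorm_of_nonneg (div_nonneg (Real.rpow_nonneg (mem_Ioi.1 hu).le _) h4.le),
          ENNReal.ofReal_le_one, div_le_one h4]
        exact rpow_le_weight h1 h2 hu)
      (fun u hu => by
        rw [← ofReal_norm, norm_mul, norm_real, Real.norm_of_nonneg (weight_pos hu).le]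
        exact ENNReal.ofReal_le_ofReal (hC u hu))
    have h5 : eVariationOn (fun u : ℝ => ((u ^ σ : ℝ) : ℂ) * g u) (Ioi 0) = eVariationOn
        (fun u : ℝ => (u ^ σ / weight ε u) • (g u * (weight ε u : ℂ))) (Ioi 0) := by
      refine eVariationOn.eq_of_eqOn fun u hu => ?_
      have : (weight ε u : ℂ) ≠ 0 := by exact_mod_cast (weight_pos hu).ne'
      simp only [real_smul]
      push_cast
      field_simp
    rw [h5]
    refine h3.trans ?_
    rw [one_mul, ENNReal.ofReal_add (by positivity) (by positivity), ENNReal.ofReal_toReal hWtop,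
      ENNReal.ofReal_mul hC0]
    gcongr
    simpa using hφ
  · have h3 := rpow_le_weight h1 h2 hu
    calc ‖g u‖ * u ^ σ ≤ ‖g u‖ * weight ε u := by gcongr
      _ ≤ C := hC u hu
      _ ≤ _ := by linarith [ENNReal.toReal_nonneg (a := W)]

theorem exists_norm_le (hε : 0 < ε) (h : IsClassEWith ε g) :
    ∃ C : ℝ, 0 ≤ C ∧ ∀ σ, -ε ≤ σ → σ ≤ 1 + ε → ∀ u, 0 < u → ‖g u‖ ≤ C * u ^ (-σ) := by
  obtain ⟨V, hV, h1⟩ := h.exists_variation_bound hε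
  refine ⟨V, hV, fun σ h2 h3 u hu => ?_⟩
  have h4 := (h1 σ h2 h3).2 u hu
  rw [Real.rpow_neg hu.le, ← div_eq_mul_inv, le_div_iff₀ (Real.rpow_pos_of_pos hu _)]
  exact h4

theorem locallyIntegrableOn (h : IsClassEWith ε g) : LocallyIntegrableOn g (Ioi 0) :=
  h.continuousOn.locallyIntegrableOn measurableSet_Ioi

theorem isBigO_atTop (hε : 0 < ε) (h : IsClassEWith ε g) : g =O[atTop] (· ^ (-(1 + ε))) := by
  obtain ⟨C, -, hC⟩ := h.exists_norm_le hε
  refine Asymptotics.IsBigO.of_bound C ?_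
  filter_upwards [eventually_gt_atTop 0] with u hu
  rw [Real.norm_of_nonneg (Real.rpow_nonneg hu.le _)]
  exact hC (1 + ε) (by linarith) le_rfl u hu

theorem isBigO_nhdsGT (hε : 0 < ε) (h : IsClassEWith ε g) : g =O[𝓝[>] 0] (· ^ (-(-ε))) := by
  obtain ⟨C, -, hC⟩ := h.exists_norm_le hε
  refine Asymptotics.IsBigO.of_bound C ?_
  filter_upwards [self_mem_nhdsWithin] with u hu
  rw [Real.norm_of_nonneg (Real.rpow_nonneg (mem_Ioi.1 hu).le _)]
  exact hC (-ε) le_rfl (by linarith) u hu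

theorem mellinConvergent (hε : 0 < ε) (h : IsClassEWith ε g) {s : ℂ} (h1 : -ε < s.re)
    (h2 : s.re < 1 + ε) : MellinConvergent g s :=
  mellinConvergent_of_isBigO_rpow h.locallyIntegrableOn (h.isBigO_atTop hε) h2
    (h.isBigO_nhdsGT hε) h1

theorem differentiableAt_mellin (hε : 0 < ε) (h : IsClassEWith ε g) {s : ℂ} (h1 : -ε < s.re)
    (h2 : s.re < 1 + ε) : DifferentiableAt ℂ (mellin g) s :=
  mellin_differentiableAt_of_isBigO_rpow h.locallyIntegrableOn (h.isBigO_atTop hε) h2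
    (h.isBigO_nhdsGT hε) h1

theorem differentiableOn_mellin (hε : 0 < ε) (h : IsClassEWith ε g) :
    DifferentiableOn ℂ (mellin g) {s : ℂ | -ε < s.re ∧ s.re < 1 + ε} := fun _ hs =>
  (h.differentiableAt_mellin hε hs.1 hs.2).differentiableWithinAt

theorem continuous_mellin_line (hε : 0 < ε) (h : IsClassEWith ε g) {c : ℝ} (h1 : -ε < c)
    (h2 : c < 1 + ε) : Continuous fun t : ℝ => mellin g (c + t * I) := by
  rw [continuous_iff_continuousAt]
  intro t
  have h3 : ContinuousAt (mellin g) (c + t * I) :=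
    (h.differentiableAt_mellin hε (by simpa) (by simpa)).continuousAt
  have h4 : Continuous fun t : ℝ => (c : ℂ) + t * I := by fun_prop
  exact ContinuousAt.comp (f := fun t : ℝ => (c : ℂ) + t * I) h3 h4.continuousAt

end IsClassEWith

/-! ### Decay of the Mellin transform -/

/-- After splitting the interval into steps of length `h`, the integrand summed over the steps is at
most the total variation. -/
theorem intervalIntegral_norm_translate_sub_le {F : ℝ → ℂ} (hF : Continuous F) {V : ℝ} (hV0 : 0 ≤ V)
    (hV : eVariationOn F univ ≤ ENNReal.ofReal V) {h : ℝ} (hh : 0 < h) (a : ℝ) (m : ℕ) :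
    ∫ x in a..(a + m * h), ‖F (x + h) - F x‖ ≤ h * V := by
  have hc : Continuous fun x => ‖F (x + h) - F x‖ := by fun_prop
  have h1 := intervalIntegral.sum_integral_adjacent_intervals (f := fun x => ‖F (x + h) - F x‖)
    (μ := volume) (a := fun k : ℕ => a + k * h) (n := m) fun k _ => hc.intervalIntegrable _ _
  simp only [Nat.cast_zero, zero_mul, add_zero] at h1
  rw [← h1]
  have h2 : ∀ k : ℕ, ∫ x in (a + k * h)..(a + (k + 1 : ℕ) * h), ‖F (x + h) - F x‖ =
      ∫ x in (0 : ℝ)..h, ‖F (x + (a + k * h) + h) - F (x + (a + k * h))‖ := fun k => by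
    rw [intervalIntegral.integral_comp_add_right (f := fun x => ‖F (x + h) - F x‖)]
    congr 1 <;> push_cast <;> ring
  rw [Finset.sum_congr rfl fun k _ => h2 k, ← intervalIntegral.integral_finsetSum fun k _ =>
    Continuous.intervalIntegrable (by fun_prop) _ _]
  calc _ ≤ ∫ x in (0 : ℝ)..h, V := by
        refine intervalIntegral.integral_mono_on hh.le
          (Continuous.intervalIntegrable (by fun_prop) _ _) (by simp) fun x _ => ?_
        have h3 := eVariationOn.sum_le (f := F) (s := univ) (n := m)
          (u := fun k : ℕ => x + (a + k * h)) (fun i j hij => by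
            have : (i : ℝ) ≤ j := by exact_mod_cast hij
            simp only
            gcongr) (fun _ => mem_univ _)
        have h4 := h3.trans hV
        simp only [edist_dist, dist_eq_norm] at h4
        rw [← ENNReal.ofReal_sum_of_nonneg (fun _ _ => norm_nonneg _),
          ENNReal.ofReal_le_ofReal_iff hV0] at h4
        refine (Finset.sum_le_sum fun k _ => le_of_eq ?_).trans h4
        congr 3
        push_cast
        ring
    _ = h * V := by simp

/-- The `L¹` modulus of continuity of a function of bounded variation is linear. -/
theorem integral_norm_translate_sub_le {F : ℝ → ℂ} (hF : Continuous F) (hFi : Integrable F) {V : ℝ}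
    (hV0 : 0 ≤ V) (hV : eVariationOn F univ ≤ ENNReal.ofReal V) {h : ℝ} (hh : 0 < h) :
    ∫ x, ‖F (x + h) - F x‖ ≤ h * V := by
  have h1 : Integrable fun x => ‖F (x + h) - F x‖ := ((hFi.comp_add_right h).sub hFi).norm
  have h2 : Tendsto (fun n : ℕ => (n : ℝ) * h) atTop atTop :=
    tendsto_natCast_atTop_atTop.atTop_mul_const hh
  have h3 : Tendsto (fun n : ℕ => -((n : ℝ) * h) + (2 * n : ℕ) * h) atTop atTop := by
    refine h2.congr fun n => ?_
    push_cast
    ring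
  exact le_of_tendsto (intervalIntegral_tendsto_integral h1 (tendsto_neg_atTop_atBot.comp h2) h3)
    (Eventually.of_forall fun n => intervalIntegral_norm_translate_sub_le hF hV0 hV hh _ _)

open FourierTransform in
/-- The Fourier transform of a function of bounded variation is `O(1 / |w|)`: translation by half a
period changes the sign of the integral. -/
theorem norm_fourier_mul_abs_le {F : ℝ → ℂ} (hF : Continuous F) (hFi : Integrable F) {V : ℝ}
    (hV0 : 0 ≤ V) (hV : eVariationOn F univ ≤ ENNReal.ofReal V) (w : ℝ) :
    ‖𝓕 F w‖ * |w| ≤ V := by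
  rcases eq_or_ne w 0 with rfl | hw
  · simpa using hV0
  have h1 := fourierIntegral_eq_half_sub_half_period_translate hw hFi
  have h2 : ‖𝓕 F w‖ ≤ 1 / 2 * ∫ v, ‖F v - F (v + 1 / (2 * w))‖ := by
    have h3 : 𝓕 F w = ∫ v, Real.fourierChar (-inner ℝ v w) • F v := by
      rw [Real.fourier_real_eq]
      congr with v
      simp [mul_comm]
    rw [h3, h1, norm_smul]
    have h4 : (1 / (2 * ‖w‖ ^ 2)) • w = 1 / (2 * w) := by
      rw [Real.norm_eq_abs, sq_abs, smul_eq_mul]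
      field_simp
    simp only [h4]
    gcongr
    · norm_num
    · refine (norm_integral_le_integral_norm _).trans (le_of_eq ?_)
      congr with v
      rw [Circle.norm_smul]
  have h5 : ∫ v, ‖F v - F (v + 1 / (2 * w))‖ ≤ 1 / (2 * |w|) * V := by
    rcases lt_or_gt_of_ne hw with h | h
    · rw [abs_of_neg h, ← integral_add_right_eq_self _ (1 / (2 * (-w)))]
      refine le_trans (le_of_eq ?_) (integral_norm_translate_sub_le hF hFi hV0 hV (h := 1 / (2 * -w))
        (by have : 0 < -w := neg_pos.2 h
            positivity))
      congr with v
      congr 3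
      field_simp
      ring
    · rw [abs_of_pos h]
      refine le_trans (le_of_eq ?_) (integral_norm_translate_sub_le hF hFi hV0 hV (h := 1 / (2 * w))
        (by positivity))
      congr with v
      rw [norm_sub_rev]
  calc ‖𝓕 F w‖ * |w| ≤ 1 / 2 * (1 / (2 * |w|) * V) * |w| := by
        gcongr
        linarith
    _ = V / 4 := by
        have := abs_pos.2 hw
        field_simp
        ring
    _ ≤ V := by linarith

/-- The substitution `x = e^{-u}` for integrability; it accompanies `mellin_eq_fourier`. -/
theorem integrable_exp_smul_comp_exp_neg {g : ℝ → ℂ} {s : ℂ} (h : MellinConvergent g s) :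
    Integrable fun u : ℝ => Real.exp (-s.re * u) • g (Real.exp (-u)) := by
  have h1 : (fun u : ℝ => Real.exp (-u)) '' univ = Ioi 0 := by
    ext x
    simp only [image_univ, mem_range, mem_Ioi]
    exact ⟨fun ⟨u, hu⟩ => hu ▸ Real.exp_pos _, fun hx => ⟨-Real.log x, by
      rw [neg_neg, Real.exp_log hx]⟩⟩
  have h2 : ∀ x ∈ (univ : Set ℝ), HasDerivWithinAt (fun u : ℝ => Real.exp (-u)) (-Real.exp (-x))
      univ x := fun x _ => by
    have h3 : HasDerivAt (fun u : ℝ => Real.exp (-u)) (Real.exp (-x) * -1) x :=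
      (hasDerivAt_neg x).exp
    simpa using h3.hasDerivWithinAt (s := univ)
  rw [MellinConvergent, ← h1, integrableOn_image_iff_integrableOn_abs_deriv_smul
    MeasurableSet.univ h2 (fun x _ y _ hxy => by simpa using hxy), integrableOn_univ] at h
  have h3 := h.norm
  have hm : AEStronglyMeasurable (fun u : ℝ => Real.exp (-s.re * u) • g (Real.exp (-u))) := by
    have h4 : ∀ u : ℝ, Real.exp (-s.re * u) • g (Real.exp (-u)) = cexp (s.im * u * I) •
        (|-Real.exp (-u)| • ((Real.exp (-u) : ℝ) : ℂ) ^ (s - 1) • g (Real.exp (-u))) := fun u => by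
      rw [abs_neg, abs_of_pos (Real.exp_pos _), cpow_def_of_ne_zero (by simp),
        ← ofReal_log (Real.exp_pos _).le, Real.log_exp, real_smul, real_smul, smul_eq_mul,
        smul_eq_mul, ← mul_assoc, ← mul_assoc]
      congr 1
      push_cast
      rw [← Complex.exp_add, ← Complex.exp_add]
      congr 1
      linear_combination (-(u : ℂ)) * re_add_im s
    simp_rw [h4]
    exact (by fun_prop : Continuous fun u : ℝ => cexp (s.im * u * I)).aestronglyMeasurable.smul
      h.aestronglyMeasurable
  refine h3.mono' hm (Eventually.of_forall fun u => le_of_eq ?_)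
  rw [norm_smul, norm_smul, norm_smul, norm_cpow_eq_rpow_re_of_pos (Real.exp_pos _), ← mul_assoc,
    ← Real.exp_mul]
  simp only [Real.norm_eq_abs, Real.abs_exp, abs_neg, sub_re, one_re]
  rw [← Real.exp_add]
  ring_nf

namespace IsClassEWith

variable {ε : ℝ} {g : ℝ → ℂ}

/-- The Mellin transform is `O(1 / |Im s|)`, uniformly in the open strip. -/
theorem exists_norm_mellin_mul_abs_im_le (hε : 0 < ε) (h : IsClassEWith ε g) :
    ∃ B : ℝ, 0 ≤ B ∧ ∀ s : ℂ, -ε < s.re → s.re < 1 + ε → ‖mellin g s‖ * |s.im| ≤ B := by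
  obtain ⟨V, hV0, hV⟩ := h.exists_variation_bound hε
  refine ⟨V * (2 * Real.pi), by positivity, fun s h1 h2 => ?_⟩
  have hi := integrable_exp_smul_comp_exp_neg (h.mellinConvergent hε h1 h2)
  have hc : Continuous fun u : ℝ => Real.exp (-s.re * u) • g (Real.exp (-u)) := by
    have : Continuous fun u : ℝ => g (Real.exp (-u)) :=
      h.continuousOn.comp_continuous (by fun_prop) fun u => Real.exp_pos _
    exact (by fun_prop : Continuous fun u : ℝ => Real.exp (-s.re * u)).smul this
  have hv : eVariationOn (fun u : ℝ => Real.exp (-s.re * u) • g (Real.exp (-u))) univ ≤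
      ENNReal.ofReal V := by
    refine le_trans (le_of_eq ?_) ((eVariationOn.comp_le_of_antitoneOn
      (fun u : ℝ => ((u ^ s.re : ℝ) : ℂ) * g u) (s := Ioi 0) (t := univ) (fun u => Real.exp (-u))
      (fun x _ y _ hxy => Real.exp_le_exp.2 (neg_le_neg hxy))
      fun x _ => Real.exp_pos _).trans (hV s.re h1.le h2.le).1)
    congr with u
    simp only [Function.comp, real_smul]
    rw [← Real.exp_mul]
    ring_nf
  have h3 := norm_fourier_mul_abs_le hc hi hV0 hv (s.im / (2 * Real.pi))
  rw [← mellin_eq_fourier, abs_div, abs_of_pos Real.two_pi_pos, ← mul_div_assoc,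
    div_le_iff₀ Real.two_pi_pos] at h3
  exact h3

end IsClassEWith

/-! ### The transpose and Mellin inversion -/

theorem mellin_transpose (g : ℝ → ℂ) (s : ℂ) : mellin (transpose g) s = mellin g (1 - s) := by
  have h1 : mellin (transpose g) s = mellin (fun t : ℝ => (t : ℂ) ^ (-1 : ℂ) • g t⁻¹) s := by
    refine setIntegral_congr_fun measurableSet_Ioi fun t _ => ?_
    simp only [transpose, cpow_neg_one, one_div, smul_eq_mul]
  rw [h1, mellin_cpow_smul, mellin_comp_inv]
  congr 1
  ring

theorem transpose_one (g : ℝ → ℂ) : transpose g 1 = g 1 := by simp [transpose]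

namespace IsClassEWith

variable {ε : ℝ} {g : ℝ → ℂ}

/-- The transpose satisfies the conditions with the same `ε`, because
`g^τ(x) K_ε(x) = g(1/x) K_ε(1/x)` and the strip `-ε < Re s < 1 + ε` is symmetric. -/
protected theorem transpose (h : IsClassEWith ε g) : IsClassEWith ε (transpose g) where
  continuousOn := by
    refine ContinuousOn.mul ?_ (h.continuousOn.comp ?_ fun x hx => mem_Ioi.2 (one_div_pos.2 hx))
    · refine continuousOn_const.div (by fun_prop) fun x hx => ?_
      exact_mod_cast (mem_Ioi.1 hx).ne'
    · exact continuousOn_const.div continuousOn_id fun x hx => (mem_Ioi.1 hx).ne'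
  boundedVariation := by
    have h1 := eVariationOn.comp_le_of_antitoneOn (fun u : ℝ => g u * (weight ε u : ℂ)) (s := Ioi 0)
      (t := Ioi 0) (fun x : ℝ => 1 / x) (fun x hx y _ hxy => one_div_le_one_div_of_le hx hxy)
      fun x hx => one_div_pos.2 (mem_Ioi.1 hx)
    have h2 : eVariationOn (fun u : ℝ => transpose g u * (weight ε u : ℂ)) (Ioi 0) =
        eVariationOn ((fun u : ℝ => g u * (weight ε u : ℂ)) ∘ fun x : ℝ => 1 / x) (Ioi 0) := by
      refine eVariationOn.eq_of_eqOn fun x hx => ?_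
      have hx' : 0 < x := hx
      have hx0 : (x : ℂ) ≠ 0 := by exact_mod_cast hx'.ne'
      have hw : weight ε (1 / x) = 1 / x * weight ε x := by
        simp only [weight, one_div, Real.inv_rpow hx'.le, ← Real.rpow_neg hx'.le]
        rw [mul_add, ← Real.rpow_neg_one, ← Real.rpow_add hx', ← Real.rpow_add hx']
        ring_nf
      simp only [Function.comp, transpose, hw]
      push_cast
      ring
    rw [BoundedVariationOn, h2]
    exact (h1.trans_lt (lt_top_iff_ne_top.2 h.boundedVariation)).ne
  integrable_log := fun c h1 h2 => by
    refine ((h.integrable_log (1 - c) (by linarith) (by linarith)).comp_neg).congr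
      (Eventually.of_forall fun t => ?_)
    simp only [mellin_transpose, abs_neg]
    congr 3
    push_cast
    ring

/-- The weight `log |t|` of the definition, which is not positive near `t = 0`, may be replaced by
`log (A + |t|)`, since the Mellin transform is continuous on the line. -/
theorem integrable_norm_mellin_mul_log (hε : 0 < ε) (h : IsClassEWith ε g) {c : ℝ} (h1 : -ε < c)
    (h2 : c < 1 + ε) {A : ℝ} (hA : 1 ≤ A) :
    Integrable fun t : ℝ => ‖mellin g (c + t * I)‖ * Real.log (A + |t|) := by
  have hpos : ∀ t : ℝ, 0 < A + |t| := fun t => by positivity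
  have hcont : Continuous fun t : ℝ => ‖mellin g (c + t * I)‖ * Real.log (A + |t|) :=
    (h.continuous_mellin_line hε h1 h2).norm.mul
      (Continuous.log (by fun_prop) fun t => (hpos t).ne')
  refine hcont.locallyIntegrable.integrable_of_isBigO_cocompact ?_
    ((h.integrable_log c h1 h2).integrableAtFilter _)
  refine Asymptotics.IsBigO.of_bound (Real.log (A + 1) + 1) ?_
  filter_upwards [tendsto_norm_cocompact_atTop.eventually_ge_atTop (3 : ℝ)] with t ht
  rw [Real.norm_eq_abs] at ht
  have h3 : 1 ≤ Real.log |t| := by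
    rw [Real.le_log_iff_exp_le (by linarith)]
    exact Real.exp_one_lt_three.le.trans ht
  have h4 : Real.log (A + |t|) ≤ Real.log (A + 1) + Real.log |t| := by
    rw [← Real.log_mul (by linarith) (by linarith)]
    exact Real.log_le_log (hpos t) (by nlinarith)
  have h5 : 0 ≤ Real.log (A + |t|) := Real.log_nonneg (by linarith [abs_nonneg t])
  have h6 : 0 ≤ Real.log (A + 1) := Real.log_nonneg (by linarith)
  rw [norm_mul, norm_mul, norm_norm, Real.norm_of_nonneg h5, Real.norm_of_nonneg (by linarith)]
  calc _ ≤ ‖mellin g (c + t * I)‖ * ((Real.log (A + 1) + 1) * Real.log |t|) := by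
        gcongr
        nlinarith
    _ = _ := by ring

theorem integrable_mellin (hε : 0 < ε) (h : IsClassEWith ε g) {c : ℝ} (h1 : -ε < c)
    (h2 : c < 1 + ε) : Integrable fun t : ℝ => mellin g (c + t * I) := by
  refine (h.integrable_norm_mellin_mul_log hε h1 h2 (Real.one_le_exp zero_le_one)).mono'
    (h.continuous_mellin_line hε h1 h2).aestronglyMeasurable (Eventually.of_forall fun t => ?_)
  have : 1 ≤ Real.log (Real.exp 1 + |t|) := by
    rw [Real.le_log_iff_exp_le (by positivity)]
    linarith [abs_nonneg t]
  exact le_mul_of_one_le_right (norm_nonneg _) this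

/-- Mellin inversion for the class `(E)`. -/
theorem integral_cpow_mul_mellin (hε : 0 < ε) (h : IsClassEWith ε g) {c : ℝ} (h1 : -ε < c)
    (h2 : c < 1 + ε) {u : ℝ} (hu : 0 < u) :
    ∫ t : ℝ, (u : ℂ) ^ (-(c + t * I) : ℂ) * mellin g (c + t * I) = 2 * Real.pi * g u := by
  have h3 := mellinInv_mellin_eq c g hu (h.mellinConvergent hε (by simpa) (by simpa))
    (h.integrable_mellin hε h1 h2) (h.continuousOn.continuousAt (Ioi_mem_nhds hu))
  rw [← h3, mellinInv, real_smul]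
  have : (Real.pi : ℂ) ≠ 0 := by exact_mod_cast Real.pi_ne_zero
  simp only [smul_eq_mul]
  push_cast
  rw [← mul_assoc, mul_one_div_cancel (by simp [this]), one_mul]

end IsClassEWith

theorem IsClassE.transpose {g : ℝ → ℂ} (h : IsClassE g) : IsClassE (transpose g) := by
  obtain ⟨ε, hε, h⟩ := h
  exact ⟨ε, hε, h.transpose⟩

/-! ### Multiplicative convolution -/

theorem eVariationOn_add_le (f g : ℝ → ℂ) (s : Set ℝ) :
    eVariationOn (f + g) s ≤ eVariationOn f s + eVariationOn g s := by
  refine iSup_le ?_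
  rintro ⟨n, u, hu, hus⟩
  calc _ ≤ ∑ i ∈ Finset.range n, (edist (f (u (i + 1))) (f (u i)) +
        edist (g (u (i + 1))) (g (u i))) := Finset.sum_le_sum fun i _ => edist_add_add_le _ _ _ _
    _ ≤ _ := by
      rw [Finset.sum_add_distrib]
      exact add_le_add (eVariationOn.sum_le hu hus) (eVariationOn.sum_le hu hus)

/-- For bounded variation of `g K_ε` it suffices to treat the two powers in `K_ε` separately. -/
theorem boundedVariationOn_mul_weight {ε : ℝ} {g : ℝ → ℂ}
    (h1 : BoundedVariationOn (fun u : ℝ => ((u ^ (-ε) : ℝ) : ℂ) * g u) (Ioi 0))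
    (h2 : BoundedVariationOn (fun u : ℝ => ((u ^ (1 + ε) : ℝ) : ℂ) * g u) (Ioi 0)) :
    BoundedVariationOn (fun u : ℝ => g u * (weight ε u : ℂ)) (Ioi 0) := by
  have h3 := eVariationOn_add_le (fun u : ℝ => ((u ^ (-ε) : ℝ) : ℂ) * g u)
    (fun u : ℝ => ((u ^ (1 + ε) : ℝ) : ℂ) * g u) (Ioi 0)
  have h4 : (fun u : ℝ => g u * (weight ε u : ℂ)) = (fun u : ℝ => ((u ^ (-ε) : ℝ) : ℂ) * g u) +
    (fun u : ℝ => ((u ^ (1 + ε) : ℝ) : ℂ) * g u) := by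
    ext u
    simp only [weight, Pi.add_apply]
    push_cast
    ring
  rw [BoundedVariationOn, h4]
  exact (h3.trans_lt (ENNReal.add_lt_top.2 ⟨lt_top_iff_ne_top.2 h1, lt_top_iff_ne_top.2 h2⟩)).ne

/-- Multiplication by `u^σ` distributes over multiplicative convolution. -/
theorem rpow_mul_mulConv (g k : ℝ → ℂ) (σ : ℝ) {u : ℝ} (hu : 0 < u) :
    ((u ^ σ : ℝ) : ℂ) * mulConv g k u = ∫ t in Ioi (0 : ℝ),
      ((t ^ (σ - 1) : ℝ) : ℂ) * g t * ((((u / t) ^ σ : ℝ) : ℂ) * k (u / t)) := by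
  rw [mulConv, ← integral_const_mul]
  refine setIntegral_congr_fun measurableSet_Ioi fun t ht => ?_
  have ht' : 0 < t := ht
  have h0 : (t : ℂ) ≠ 0 := by exact_mod_cast ht'.ne'
  have h1 : ((t ^ σ : ℝ) : ℂ) ≠ 0 := by exact_mod_cast (Real.rpow_pos_of_pos ht' σ).ne'
  rw [Real.div_rpow hu.le ht'.le, Real.rpow_sub ht', Real.rpow_one]
  push_cast
  field_simp

theorem norm_mellin_le (g : ℝ → ℂ) (s : ℂ) :
    ‖mellin g s‖ ≤ ∫ u in Ioi (0 : ℝ), ‖g u‖ * u ^ (s.re - 1) := by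
  refine (norm_integral_le_integral_norm _).trans (le_of_eq ?_)
  refine setIntegral_congr_fun measurableSet_Ioi fun u hu => ?_
  rw [norm_smul, norm_cpow_eq_rpow_re_of_pos hu, mul_comm, sub_re, one_re]

theorem norm_mul_comp_div_le {g k : ℝ → ℂ} {C : ℝ} (hC : ∀ u, 0 < u → ‖k u‖ ≤ C)
    {u t : ℝ} (hu : 0 < u) (ht : 0 < t) : ‖g t * k (u / t) / (t : ℂ)‖ ≤ C * (‖g t‖ * t ^ ((0 : ℝ) - 1)) := by
  rw [norm_div, norm_mul, norm_real, Real.norm_of_nonneg ht.le, zero_sub, Real.rpow_neg_one,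
    ← div_eq_mul_inv, ← mul_div_assoc, mul_comm C]
  gcongr
  exact hC _ (div_pos hu ht)

namespace IsClassEWith

variable {ε : ℝ} {g k : ℝ → ℂ}

theorem mono (hε : 0 < ε) (h : IsClassEWith ε g) {ε' : ℝ} (h0 : 0 < ε') (h1 : ε' ≤ ε) :
    IsClassEWith ε' g where
  continuousOn := h.continuousOn
  boundedVariation := by
    obtain ⟨V, -, hV⟩ := h.exists_variation_bound hε
    exact boundedVariationOn_mul_weight
      ((hV (-ε') (by linarith) (by linarith)).1.trans_lt ENNReal.ofReal_lt_top).ne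
      ((hV (1 + ε') (by linarith) (by linarith)).1.trans_lt ENNReal.ofReal_lt_top).ne
  integrable_log := fun c h2 h3 => h.integrable_log c (by linarith) (by linarith)

theorem integrableOn_norm_mul_rpow (hε : 0 < ε) (h : IsClassEWith ε g) {σ : ℝ} (h1 : -ε < σ)
    (h2 : σ < 1 + ε) : IntegrableOn (fun t : ℝ => ‖g t‖ * t ^ (σ - 1)) (Ioi 0) := by
  refine (h.mellinConvergent hε (s := σ) (by simpa) (by simpa)).norm.congr ?_
  filter_upwards [ae_restrict_mem measurableSet_Ioi] with t ht
  rw [norm_smul, norm_cpow_eq_rpow_re_of_pos ht, mul_comm]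
  simp

theorem continuousOn_mul_comp_div (hg : IsClassEWith ε g) (hk : IsClassEWith ε k) {u : ℝ}
    (hu : 0 < u) : ContinuousOn (fun t : ℝ => g t * k (u / t) / (t : ℂ)) (Ioi 0) := by
  refine (hg.continuousOn.mul (hk.continuousOn.comp ?_ fun t ht => div_pos hu ht)).div
    (by fun_prop) fun t ht => by exact_mod_cast (mem_Ioi.1 ht).ne'
  exact continuousOn_const.div continuousOn_id fun t ht => (mem_Ioi.1 ht).ne'

theorem exists_norm_le_const (hε : 0 < ε) (h : IsClassEWith ε g) :
    ∃ C, 0 ≤ C ∧ ∀ u, 0 < u → ‖g u‖ ≤ C := by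
  obtain ⟨C, h0, hC⟩ := h.exists_norm_le hε
  exact ⟨C, h0, fun u hu => by simpa using hC 0 (by linarith) (by linarith) u hu⟩

theorem integrableOn_mul_comp_div (hε : 0 < ε) (hg : IsClassEWith ε g) (hk : IsClassEWith ε k)
    {u : ℝ} (hu : 0 < u) : IntegrableOn (fun t : ℝ => g t * k (u / t) / (t : ℂ)) (Ioi 0) := by
  obtain ⟨C, -, hC⟩ := hk.exists_norm_le_const hε
  refine ((hg.integrableOn_norm_mul_rpow hε (σ := 0) (by linarith) (by linarith)).const_mul C).mono'
    ((hg.continuousOn_mul_comp_div hk hu).aestronglyMeasurable measurableSet_Ioi) ?_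
  filter_upwards [ae_restrict_mem measurableSet_Ioi] with t ht using norm_mul_comp_div_le hC hu ht

theorem continuousOn_mulConv (hε : 0 < ε) (hg : IsClassEWith ε g) (hk : IsClassEWith ε k) :
    ContinuousOn (mulConv g k) (Ioi 0) := by
  obtain ⟨C, -, hC⟩ := hk.exists_norm_le_const hε
  refine MeasureTheory.continuousOn_of_dominated
    (bound := fun t => C * (‖g t‖ * t ^ ((0 : ℝ) - 1)))
    (fun u hu => (hg.continuousOn_mul_comp_div hk hu).aestronglyMeasurable measurableSet_Ioi)
    (fun u hu => ?_)
    ((hg.integrableOn_norm_mul_rpow hε (σ := 0) (by linarith) (by linarith)).const_mul C) ?_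
  · filter_upwards [ae_restrict_mem measurableSet_Ioi] with t ht using norm_mul_comp_div_le hC hu ht
  · filter_upwards [ae_restrict_mem measurableSet_Ioi] with t ht
    exact (continuousOn_const.mul (hk.continuousOn.comp (continuousOn_id.div_const t)
      fun u hu => mem_Ioi.2 (div_pos hu ht))).div_const _

/-- A convolution is an average of dilates of `k`, and dilation does not change the variation. -/
theorem eVariationOn_rpow_mul_mulConv_le (hε : 0 < ε) (hg : IsClassEWith ε g)
    (hk : IsClassEWith ε k) {σ : ℝ} (h1 : -ε < σ) (h2 : σ < 1 + ε) :
    eVariationOn (fun u : ℝ => ((u ^ σ : ℝ) : ℂ) * mulConv g k u) (Ioi 0) ≤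
      (∫⁻ t in Ioi (0 : ℝ), ‖((t ^ (σ - 1) : ℝ) : ℂ) * g t‖ₑ) *
        eVariationOn (fun u : ℝ => ((u ^ σ : ℝ) : ℂ) * k u) (Ioi 0) := by
  set K : ℝ → ℂ := fun u : ℝ => ((u ^ σ : ℝ) : ℂ) * k u with hK
  have hKc : ContinuousOn K (Ioi 0) := by
    refine ContinuousOn.mul ?_ hk.continuousOn
    exact continuous_ofReal.comp_continuousOn
      (continuousOn_id.rpow_const fun x hx => Or.inl (mem_Ioi.1 hx).ne')
  have hint : ∀ u : ℝ, 0 < u → IntegrableOn (fun t : ℝ => ((t ^ (σ - 1) : ℝ) : ℂ) * g t *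
      K (u / t)) (Ioi 0) := fun u hu => by
    refine ((hg.integrableOn_mul_comp_div hε hk hu).const_mul ((u ^ σ : ℝ) : ℂ)).congr ?_
    filter_upwards [ae_restrict_mem measurableSet_Ioi] with t ht
    have ht' : 0 < t := ht
    have h0 : (t : ℂ) ≠ 0 := by exact_mod_cast ht'.ne'
    have h1 : ((t ^ σ : ℝ) : ℂ) ≠ 0 := by exact_mod_cast (Real.rpow_pos_of_pos ht' σ).ne'
    simp only [hK]
    rw [Real.div_rpow hu.le ht'.le, Real.rpow_sub ht', Real.rpow_one]
    push_cast
    field_simp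
  rw [eVariationOn]
  refine iSup_le ?_
  rintro ⟨n, u, hu, hu0⟩
  simp only
  have hu0' : ∀ i, 0 < u i := hu0
  have hd : ∀ i, edist (((u (i + 1) ^ σ : ℝ) : ℂ) * mulConv g k (u (i + 1)))
      (((u i ^ σ : ℝ) : ℂ) * mulConv g k (u i)) ≤ ∫⁻ t in Ioi (0 : ℝ),
        ‖((t ^ (σ - 1) : ℝ) : ℂ) * g t‖ₑ * edist (K (u (i + 1) / t)) (K (u i / t)) := fun i => by
    rw [rpow_mul_mulConv g k σ (hu0' _), rpow_mul_mulConv g k σ (hu0' _), edist_eq_enorm_sub,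
      ← integral_sub (hint _ (hu0' _)) (hint _ (hu0' _))]
    refine (enorm_integral_le_lintegral_enorm _).trans (le_of_eq ?_)
    congr with t
    rw [← mul_sub, enorm_mul, edist_eq_enorm_sub]
  have hmeas : ∀ i, AEMeasurable (fun t : ℝ => ‖((t ^ (σ - 1) : ℝ) : ℂ) * g t‖ₑ *
      edist (K (u (i + 1) / t)) (K (u i / t))) (volume.restrict (Ioi 0)) := fun i => by
    refine (((hint _ (hu0' (i + 1))).sub (hint _ (hu0' i))).aestronglyMeasurable.enorm).congr ?_
    refine Eventually.of_forall fun t => ?_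
    simp only [Pi.sub_apply]
    rw [← mul_sub, enorm_mul, edist_eq_enorm_sub]
  calc _ ≤ ∑ i ∈ Finset.range n, ∫⁻ t in Ioi (0 : ℝ), ‖((t ^ (σ - 1) : ℝ) : ℂ) * g t‖ₑ *
        edist (K (u (i + 1) / t)) (K (u i / t)) := Finset.sum_le_sum fun i _ => hd i
    _ = ∫⁻ t in Ioi (0 : ℝ), ∑ i ∈ Finset.range n, ‖((t ^ (σ - 1) : ℝ) : ℂ) * g t‖ₑ *
        edist (K (u (i + 1) / t)) (K (u i / t)) :=
      (lintegral_finsetSum' _ fun i _ => hmeas i).symm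
    _ ≤ ∫⁻ t in Ioi (0 : ℝ), ‖((t ^ (σ - 1) : ℝ) : ℂ) * g t‖ₑ * eVariationOn K (Ioi 0) := by
      refine setLIntegral_mono_ae' measurableSet_Ioi (Eventually.of_forall fun t ht => ?_)
      rw [← Finset.mul_sum]
      gcongr
      exact eVariationOn.sum_le (f := K) (s := Ioi 0) (u := fun i => u i / t)
        (fun i j hij => div_le_div_of_nonneg_right (hu hij) (mem_Ioi.1 ht).le)
        fun i => div_pos (hu0' i) ht
    _ = _ := by
      rw [lintegral_mul_const'' _ ?_]
      refine (((hg.mellinConvergent hε (s := σ) (by simpa) (by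
        simpa)).aestronglyMeasurable).enorm).congr ?_
      filter_upwards [ae_restrict_mem measurableSet_Ioi] with t ht
      rw [ofReal_cpow (mem_Ioi.1 ht).le]
      simp

/-- The Mellin transform turns multiplicative convolution into a product. -/
theorem mellin_mulConv (hε : 0 < ε) (hg : IsClassEWith ε g) (hk : IsClassEWith ε k) {s : ℂ}
    (h1 : -ε < s.re) (h2 : s.re < 1 + ε) :
    mellin (mulConv g k) s = mellin g s * mellin k s := by
  set F : ℝ → ℝ → ℂ := fun u t => (u : ℂ) ^ (s - 1) * (g t * k (u / t) / (t : ℂ)) with hF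
  have hscale : ∀ t : ℝ, 0 < t →
      ∫ u in Ioi (0 : ℝ), F u t = (t : ℂ) ^ (s - 1) * g t * mellin k s := fun t ht => by
    have h0 : (t : ℂ) ≠ 0 := by exact_mod_cast ht.ne'
    have h3 := mellin_comp_mul_right k s (inv_pos.2 ht)
    have h4 : ((t⁻¹ : ℝ) : ℂ) ^ (-s) = (t : ℂ) ^ s := by
      push_cast
      rw [inv_cpow _ _ (by rw [arg_ofReal_of_nonneg ht.le]; exact Real.pi_pos.ne), cpow_neg,
        inv_inv]
    rw [h4, mellin] at h3
    have h5 : ∀ u : ℝ, F u t = (g t / t) * ((u : ℂ) ^ (s - 1) • k (u * t⁻¹)) := fun u => by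
      simp only [hF, smul_eq_mul, div_eq_mul_inv]
      ring
    simp_rw [h5]
    rw [integral_const_mul, h3, cpow_sub _ _ h0, cpow_one, smul_eq_mul]
    ring
  have hscale' : ∀ t : ℝ, 0 < t → IntegrableOn (fun u => F u t) (Ioi 0) := fun t ht => by
    have h3 := (MellinConvergent.comp_mul_left (f := k) (s := s) (inv_pos.2 ht)).2
      (hk.mellinConvergent hε h1 h2)
    refine (Integrable.const_mul h3 (g t / t)).congr (Eventually.of_forall fun u => ?_)
    simp only [hF, smul_eq_mul, div_eq_mul_inv, mul_comm u]
    ring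
  have hnorm : ∀ t : ℝ, 0 < t → ∫ u in Ioi (0 : ℝ), ‖F u t‖ =
      ‖(t : ℂ) ^ (s - 1) • g t‖ * ∫ u in Ioi (0 : ℝ), ‖(u : ℂ) ^ (s - 1) • k u‖ := fun t ht => by
    have h3 := integral_comp_mul_right_Ioi (fun u : ℝ => ‖(u : ℂ) ^ (s - 1) • k u‖) 0
      (inv_pos.2 ht)
    rw [zero_mul, inv_inv, smul_eq_mul] at h3
    have h4 : ∀ u ∈ Ioi (0 : ℝ), ‖F u t‖ = (‖(t : ℂ) ^ (s - 1) • g t‖ * t⁻¹) *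
        ‖((u * t⁻¹ : ℝ) : ℂ) ^ (s - 1) • k (u * t⁻¹)‖ := fun u hu => by
      have hu' : 0 < u := hu
      have h5 := (Real.rpow_pos_of_pos ht (s.re - 1)).ne'
      simp only [hF, norm_smul, norm_mul, norm_div]
      rw [norm_cpow_eq_rpow_re_of_pos hu', norm_cpow_eq_rpow_re_of_pos ht,
        norm_cpow_eq_rpow_re_of_pos (mul_pos hu' (inv_pos.2 ht)), norm_real,
        Real.norm_of_nonneg ht.le, Real.mul_rpow hu'.le (inv_pos.2 ht).le, Real.inv_rpow ht.le,
        div_eq_mul_inv, div_eq_mul_inv, sub_re, one_re]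
      field_simp
    rw [setIntegral_congr_fun measurableSet_Ioi h4, integral_const_mul, h3]
    field_simp
  have hmeas : AEStronglyMeasurable (Function.uncurry F)
      ((volume.restrict (Ioi 0)).prod (volume.restrict (Ioi 0))) := by
    rw [Measure.prod_restrict]
    refine ContinuousOn.aestronglyMeasurable ?_ (measurableSet_Ioi.prod measurableSet_Ioi)
    have hfst : ContinuousOn (fun p : ℝ × ℝ => p.1) (Ioi 0 ×ˢ Ioi 0) := continuousOn_fst
    have hsnd : ContinuousOn (fun p : ℝ × ℝ => p.2) (Ioi 0 ×ˢ Ioi 0) := continuousOn_snd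
    refine ContinuousOn.mul ?_ (ContinuousOn.div (ContinuousOn.mul ?_ ?_) ?_ ?_)
    · refine ContinuousOn.cpow_const (continuous_ofReal.comp_continuousOn hfst) fun p hp => ?_
      exact Or.inl (by simpa using hp.1)
    · exact hg.continuousOn.comp hsnd fun p hp => hp.2
    · exact hk.continuousOn.comp (hfst.div hsnd fun p hp => (mem_Ioi.1 hp.2).ne')
        fun p hp => mem_Ioi.2 (div_pos hp.1 hp.2)
    · exact continuous_ofReal.comp_continuousOn hsnd
    · exact fun p hp => by exact_mod_cast (mem_Ioi.1 hp.2).ne'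
  have hint : Integrable (Function.uncurry F)
      ((volume.restrict (Ioi 0)).prod (volume.restrict (Ioi 0))) := by
    rw [integrable_prod_iff' hmeas]
    constructor
    · filter_upwards [ae_restrict_mem measurableSet_Ioi] with t ht using hscale' t ht
    · refine ((hg.mellinConvergent hε h1 h2).norm.mul_const
        (∫ u in Ioi (0 : ℝ), ‖(u : ℂ) ^ (s - 1) • k u‖)).congr ?_
      filter_upwards [ae_restrict_mem measurableSet_Ioi] with t ht
      exact (hnorm t ht).symm
  calc mellin (mulConv g k) s = ∫ u in Ioi (0 : ℝ), ∫ t in Ioi (0 : ℝ), F u t := by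
        refine setIntegral_congr_fun measurableSet_Ioi fun u _ => ?_
        simp only [hF, mulConv, smul_eq_mul]
        rw [integral_const_mul]
    _ = ∫ t in Ioi (0 : ℝ), ∫ u in Ioi (0 : ℝ), F u t := integral_integral_swap hint
    _ = ∫ t in Ioi (0 : ℝ), (t : ℂ) ^ (s - 1) * g t * mellin k s :=
        setIntegral_congr_fun measurableSet_Ioi hscale
    _ = mellin g s * mellin k s := by
        rw [integral_mul_const]
        rfl

/-- The passage to `ε / 2` makes the exponents `-ε / 2` and `1 + ε / 2` interior to the strip, where
`g(t) t^{σ-1}` is integrable. -/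
protected theorem mulConv (hε : 0 < ε) (hg : IsClassEWith ε g) (hk : IsClassEWith ε k) :
    IsClassEWith (ε / 2) (mulConv g k) where
  continuousOn := hg.continuousOn_mulConv hε hk
  boundedVariation := by
    obtain ⟨V, -, hV⟩ := hk.exists_variation_bound hε
    have key : ∀ σ, -ε < σ → σ < 1 + ε →
        BoundedVariationOn (fun u : ℝ => ((u ^ σ : ℝ) : ℂ) * mulConv g k u) (Ioi 0) :=
      fun σ h1 h2 => by
        refine ((hg.eVariationOn_rpow_mul_mulConv_le hε hk h1 h2).trans_lt
          (ENNReal.mul_lt_top ?_ ((hV σ h1.le h2.le).1.trans_lt ENNReal.ofReal_lt_top))).ne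
        have h3 := (hg.integrableOn_norm_mul_rpow hε h1 h2).hasFiniteIntegral
        refine (hasFiniteIntegral_iff_enorm.1 h3).trans_eq' ?_
        refine setLIntegral_congr_fun measurableSet_Ioi fun t ht => ?_
        simp only [enorm_mul, enorm_norm]
        rw [mul_comm]
        congr 1
        rw [enorm_eq_iff_norm_eq, norm_real]
    exact boundedVariationOn_mul_weight (key _ (by linarith) (by linarith))
      (key _ (by linarith) (by linarith))
  integrable_log := fun c h1 h2 => by
    have h3 : ∀ t : ℝ, mellin (mulConv g k) (c + t * I) =
        mellin g (c + t * I) * mellin k (c + t * I) := fun t =>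
      hg.mellin_mulConv hε hk (by simp; linarith) (by simp; linarith)
    simp_rw [h3, norm_mul]
    refine ((hg.integrable_log c (by linarith) (by linarith)).bdd_mul
      (f := fun t : ℝ => ‖mellin k (c + t * I)‖)
      (c := ∫ u in Ioi (0 : ℝ), ‖k u‖ * u ^ (c - 1)) ?_ ?_).congr ?_
    · exact (hk.continuous_mellin_line hε (by linarith)
        (by linarith)).norm.aestronglyMeasurable
    · refine Eventually.of_forall fun t => ?_
      rw [norm_norm]
      refine (norm_mellin_le k _).trans (le_of_eq ?_)
      simp
    · refine Eventually.of_forall fun t => ?_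
      ring

end IsClassEWith

theorem IsClassE.integrableOn_mulConv_and_mulConv {g k : ℝ → ℂ} (hg : IsClassE g)
    (hk : IsClassE k) :
    (∀ u : ℝ, 0 < u → IntegrableOn (fun t : ℝ => g t * k (u / t) / (t : ℂ)) (Ioi 0)) ∧
      IsClassE (mulConv g k) := by
  obtain ⟨ε, hε, hg⟩ := hg
  obtain ⟨δ, hδ, hk⟩ := hk
  have hm : 0 < min ε δ := lt_min hε hδ
  have hg' := hg.mono hε hm (min_le_left _ _)
  have hk' := hk.mono hδ hm (min_le_right _ _)
  exact ⟨fun u hu => hg'.integrableOn_mul_comp_div hm hk' hu, min ε δ / 2, half_pos hm,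
    hg'.mulConv hm hk'⟩

/-! ### The archimedean term -/

theorem measurable_logDeriv_Gammaℝ : Measurable (logDeriv Gammaℝ) := by
  have h1 : Measurable Gammaℝ := by
    have h2 := differentiable_Gammaℝ_inv.continuous.measurable.inv
    simpa only [Pi.inv_def, inv_inv] using h2
  exact (measurable_deriv Gammaℝ).div h1

theorem weilRealTerm_integrand_eq (z w : ℂ) (n : ℕ) (u : ℝ) :
    (z - w) * ((u : ℂ) ^ n)⁻¹ / (u : ℂ) =
      z * ((u : ℂ) ^ n)⁻¹ / (u : ℂ) - w * (((u : ℂ) ^ n)⁻¹ / (u : ℂ)) := by ring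

theorem inv_pow_div_eq_cpow {u : ℝ} (hu : 0 < u) (n : ℕ) :
    ((u : ℂ) ^ n)⁻¹ / (u : ℂ) = (u : ℂ) ^ (-(n + 1) : ℂ) := by
  have h0 : (u : ℂ) ≠ 0 := by exact_mod_cast hu.ne'
  rw [cpow_neg, cpow_add _ _ h0, cpow_one, cpow_natCast]
  field_simp

theorem integrableOn_inv_pow_div {n : ℕ} (hn : n ≠ 0) :
    IntegrableOn (fun u : ℝ => ((u : ℂ) ^ n)⁻¹ / (u : ℂ)) (Ioi 1) := by
  refine (integrableOn_Ioi_cpow_of_lt (a := (-(n + 1) : ℂ)) (c := 1) 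
    (by simpa using Nat.pos_of_ne_zero hn) zero_lt_one).congr ?_
  filter_upwards [ae_restrict_mem measurableSet_Ioi] with u hu
  exact (inv_pow_div_eq_cpow (zero_lt_one.trans hu) n).symm

theorem integral_inv_pow_div {n : ℕ} (hn : n ≠ 0) :
    ∫ u in Ioi (1 : ℝ), ((u : ℂ) ^ n)⁻¹ / (u : ℂ) = (n : ℂ)⁻¹ := by
  rw [setIntegral_congr_fun measurableSet_Ioi fun u hu =>
    inv_pow_div_eq_cpow (zero_lt_one.trans hu) n,
    integral_Ioi_cpow_of_lt (by simpa using Nat.pos_of_ne_zero hn) zero_lt_one, ofReal_one,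
    one_cpow]
  rw [show -((n : ℂ) + 1) + 1 = -n by ring, neg_div_neg_eq, one_div]

theorem norm_inv_add_natCast_le {c : ℝ} (hc : 0 < c) (n : ℕ) (t : ℝ) :
    ‖((c : ℂ) + t * I + n)⁻¹‖ ≤ c⁻¹ := by
  rw [norm_inv]
  refine inv_anti₀ hc ((?_ : c ≤ ((c : ℂ) + t * I + n).re).trans (re_le_norm _))
  simp

theorem mellin_mul_gammaTerm_eq (z : ℂ) (j : ℕ) (c t : ℝ) :
    z * gammaTerm j (c + t * I) = z * ((c : ℂ) + t * I + (2 * (j + 1) : ℕ))⁻¹ -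
      z * ((2 * (j + 1) : ℕ) : ℂ)⁻¹ := by
  rw [gammaTerm]
  push_cast
  ring

theorem norm_ofReal_add_mul_I_le {c : ℝ} (hc : 0 ≤ c) (t : ℝ) : ‖(c : ℂ) + t * I‖ ≤ c + |t| := by
  refine (norm_add_le _ _).trans (le_of_eq ?_)
  simp [abs_of_nonneg hc]

namespace IsClassEWith

variable {ε : ℝ} {h : ℝ → ℂ}

theorem integrableOn_mul_inv_pow_div (hε : 0 < ε) (hh : IsClassEWith ε h) (n : ℕ) :
    IntegrableOn (fun u : ℝ => h u * ((u : ℂ) ^ n)⁻¹ / (u : ℂ)) (Ioi 1) := by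
  have h1 := (hh.integrableOn_norm_mul_rpow hε (σ := 0) (by linarith) (by linarith)).mono_set
    (Ioi_subset_Ioi zero_le_one)
  refine h1.mono' (ContinuousOn.aestronglyMeasurable ?_ measurableSet_Ioi) ?_
  · have h0 : ∀ u ∈ Ioi (1 : ℝ), (u : ℂ) ≠ 0 := fun u hu => by
      exact_mod_cast (zero_lt_one.trans hu).ne'
    refine ((hh.continuousOn.mono (Ioi_subset_Ioi zero_le_one)).mul
      (ContinuousOn.inv₀ (by fun_prop) fun u hu => pow_ne_zero _ (h0 u hu))).div (by fun_prop) h0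
  · filter_upwards [ae_restrict_mem measurableSet_Ioi] with u hu
    have hu' : 0 < u := zero_lt_one.trans hu
    rw [norm_div, norm_mul, norm_inv, norm_pow, norm_real, Real.norm_of_nonneg hu'.le, zero_sub,
      Real.rpow_neg_one, div_eq_mul_inv]
    gcongr
    exact mul_le_of_le_one_right (norm_nonneg _)
      (inv_le_one_of_one_le₀ (one_le_pow₀ (mem_Ioi.1 hu).le))

theorem integrableOn_weilRealTerm (hε : 0 < ε) (hh : IsClassEWith ε h) (j : ℕ) :
    IntegrableOn (fun u : ℝ => (h u - h 1) * ((u : ℂ) ^ (2 * (j + 1)))⁻¹ / (u : ℂ)) (Ioi 1) := by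
  simp_rw [weilRealTerm_integrand_eq]
  exact (hh.integrableOn_mul_inv_pow_div hε _).sub
    ((integrableOn_inv_pow_div (by omega)).const_mul _)

theorem integrable_mellin_mul (hε : 0 < ε) (hh : IsClassEWith ε h) {c : ℝ} (h1 : -ε < c)
    (h2 : c < 1 + ε) {w : ℝ → ℂ} (hw : AEStronglyMeasurable w) {C : ℝ} (hC : ∀ t, ‖w t‖ ≤ C) :
    Integrable fun t : ℝ => mellin h (c + t * I) * w t :=
  (hh.integrable_mellin hε h1 h2).mul_bdd hw (Eventually.of_forall hC)

/-- The inverse transform of `1 / (s + n)`: expand `1 / (s + n) = ∫₁^∞ u^{-s-n} du/u`, exchange the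
integrals, and apply Mellin inversion for each `u`. -/
theorem integral_mellin_mul_inv (hε : 0 < ε) (hh : IsClassEWith ε h) {c : ℝ} (h1 : 0 < c)
    (h2 : c < 1 + ε) (n : ℕ) :
    ∫ t : ℝ, mellin h (c + t * I) * ((c : ℂ) + t * I + n)⁻¹ =
      2 * Real.pi * ∫ u in Ioi (1 : ℝ), h u * ((u : ℂ) ^ n)⁻¹ / (u : ℂ) := by
  set F : ℝ → ℝ → ℂ := fun t u => mellin h (c + t * I) * (u : ℂ) ^ (-(c + t * I + n + 1) : ℂ)
    with hF
  have hn : (0 : ℝ) ≤ n := Nat.cast_nonneg n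
  have hint : Integrable (Function.uncurry F) (volume.prod (volume.restrict (Ioi 1))) := by
    have h3 := ((hh.integrable_mellin hε (by linarith) h2).norm).mul_prod
      (integrableOn_Ioi_rpow_of_lt (a := -(c + n + 1)) (c := 1) (by linarith) zero_lt_one)
    refine h3.mono' ?_ ?_
    · refine AEStronglyMeasurable.mul
        ((hh.integrable_mellin hε (by linarith) h2).aestronglyMeasurable.comp_fst) ?_
      exact (by fun_prop : Measurable fun p : ℝ × ℝ =>
        (p.2 : ℂ) ^ (-(c + p.1 * I + n + 1) : ℂ)).aestronglyMeasurable
    · have : ∀ᵐ p : ℝ × ℝ ∂(volume.prod (volume.restrict (Ioi 1))), 1 < p.2 := by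
        rw [← Measure.restrict_univ (μ := (volume : Measure ℝ)), Measure.restrict_univ,
          ← Measure.restrict_univ (μ := (volume : Measure ℝ)), Measure.prod_restrict]
        filter_upwards [ae_restrict_mem (MeasurableSet.univ.prod measurableSet_Ioi)] with p hp
        exact hp.2
      filter_upwards [this] with p hp
      simp only [Function.uncurry, hF]
      rw [norm_mul, norm_cpow_eq_rpow_re_of_pos (zero_lt_one.trans hp)]
      simp
  calc _ = ∫ t : ℝ, ∫ u in Ioi (1 : ℝ), F t u := by
        congr with t
        simp only [hF]
        rw [integral_const_mul, integral_Ioi_cpow_of_lt (by simp; linarith) zero_lt_one, ofReal_one,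
          one_cpow, show -((c : ℂ) + t * I + n + 1) + 1 = -(c + t * I + n) by ring, neg_div_neg_eq,
          one_div]
    _ = ∫ u in Ioi (1 : ℝ), ∫ t : ℝ, F t u := integral_integral_swap hint
    _ = ∫ u in Ioi (1 : ℝ), 2 * Real.pi * (h u * ((u : ℂ) ^ n)⁻¹ / (u : ℂ)) := by
        refine setIntegral_congr_fun measurableSet_Ioi fun u hu => ?_
        have hu' : 0 < u := zero_lt_one.trans hu
        have hu0 : (u : ℂ) ≠ 0 := by exact_mod_cast hu'.ne'
        have h4 : ∀ t : ℝ, F t u = (((u : ℂ) ^ n)⁻¹ / (u : ℂ)) *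
            ((u : ℂ) ^ (-(c + t * I) : ℂ) * mellin h (c + t * I)) := fun t => by
          simp only [hF]
          rw [inv_pow_div_eq_cpow hu', ← mul_assoc, ← cpow_add _ _ hu0, mul_comm]
          ring_nf
        simp_rw [h4]
        rw [integral_const_mul, hh.integral_cpow_mul_mellin hε (by linarith) h2 hu']
        ring
    _ = _ := integral_const_mul _ _

theorem integral_mellin (hε : 0 < ε) (hh : IsClassEWith ε h) {c : ℝ} (h1 : -ε < c)
    (h2 : c < 1 + ε) : ∫ t : ℝ, mellin h (c + t * I) = 2 * Real.pi * h 1 := by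
  simpa using hh.integral_cpow_mul_mellin hε h1 h2 zero_lt_one

theorem integrable_mellin_mul_inv (hε : 0 < ε) (hh : IsClassEWith ε h) {c : ℝ} (h1 : 0 < c)
    (h2 : c < 1 + ε) (n : ℕ) :
    Integrable fun t : ℝ => mellin h (c + t * I) * ((c : ℂ) + t * I + n)⁻¹ :=
  hh.integrable_mellin_mul hε (by linarith) h2
    (by fun_prop : Measurable fun t : ℝ => ((c : ℂ) + t * I + n)⁻¹).aestronglyMeasurable
    (norm_inv_add_natCast_le h1 n)

theorem integrable_mellin_mul_gammaTerm (hε : 0 < ε) (hh : IsClassEWith ε h) {c : ℝ} (h1 : 0 < c)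
    (h2 : c < 1 + ε) (j : ℕ) :
    Integrable fun t : ℝ => mellin h (c + t * I) * gammaTerm j (c + t * I) := by
  simp_rw [mellin_mul_gammaTerm_eq]
  exact (hh.integrable_mellin_mul_inv hε h1 h2 _).sub
    ((hh.integrable_mellin hε (by linarith) h2).mul_const _)

/-- The two parts of `gammaTerm` give the two parts of `(h(u) - h(1)) u^{-2j}`: the constant one by
Mellin inversion at `u = 1`. -/
theorem integral_mellin_mul_gammaTerm (hε : 0 < ε) (hh : IsClassEWith ε h) {c : ℝ} (h1 : 0 < c)
    (h2 : c < 1 + ε) (j : ℕ) :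
    ∫ t : ℝ, mellin h (c + t * I) * gammaTerm j (c + t * I) =
      2 * Real.pi * weilRealTerm h (j + 1) := by
  simp_rw [mellin_mul_gammaTerm_eq]
  rw [integral_sub (hh.integrable_mellin_mul_inv hε h1 h2 _)
    ((hh.integrable_mellin hε (by linarith) h2).mul_const _), integral_mul_const,
    hh.integral_mellin_mul_inv hε h1 h2, hh.integral_mellin hε (by linarith) h2, weilRealTerm]
  simp_rw [weilRealTerm_integrand_eq]
  rw [integral_sub (hh.integrableOn_mul_inv_pow_div hε _)
    ((integrableOn_inv_pow_div (by omega)).const_mul _), integral_const_mul,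
    integral_inv_pow_div (by omega)]
  ring

theorem summable_integral_norm_mellin_mul_gammaTerm (hε : 0 < ε) (hh : IsClassEWith ε h) {c : ℝ}
    (h1 : 0 < c) (h2 : c < 1 + ε) :
    Summable fun j => ∫ t : ℝ, ‖mellin h (c + t * I) * gammaTerm j (c + t * I)‖ := by
  have hI : Integrable fun t : ℝ =>
      ‖mellin h (c + t * I)‖ + ‖mellin h (c + t * I)‖ * Real.log (2 + c + |t|) :=
    (hh.integrable_mellin hε (by linarith) h2).norm.add
      (hh.integrable_norm_mellin_mul_log hε (by linarith) h2 (by linarith))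
  refine summable_of_sum_range_le (c := ∫ t : ℝ, (‖mellin h (c + t * I)‖ +
    ‖mellin h (c + t * I)‖ * Real.log (2 + c + |t|)))
    (fun j => integral_nonneg fun t => norm_nonneg _) fun n => ?_
  rw [← integral_finsetSum _ fun j _ => (hh.integrable_mellin_mul_gammaTerm hε h1 h2 j).norm]
  refine integral_mono (integrable_finsetSum _ fun j _ =>
    (hh.integrable_mellin_mul_gammaTerm hε h1 h2 j).norm) hI fun t => ?_
  simp only [norm_mul]
  rw [← Finset.mul_sum, ← mul_one_add]
  gcongr
  refine (sum_norm_gammaTerm_le (by simpa using h1) n).trans ?_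
  have h3 := norm_ofReal_add_mul_I_le h1.le t
  have h4 := Real.log_le_log (by positivity) (by linarith : 2 + ‖(c : ℂ) + t * I‖ ≤ 2 + c + |t|)
  linarith

theorem summable_norm_weilRealTerm (hε : 0 < ε) (hh : IsClassEWith ε h) :
    Summable fun j : ℕ => ‖weilRealTerm h (j + 1)‖ := by
  refine .of_nonneg_of_le (fun _ => norm_nonneg _) (fun j => ?_)
    (hh.summable_integral_norm_mellin_mul_gammaTerm hε (c := 1) one_pos (by linarith))
  have h3 := norm_integral_le_integral_norm (μ := volume)
    fun t : ℝ => mellin h ((1 : ℝ) + t * I) * gammaTerm j ((1 : ℝ) + t * I)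
  rw [hh.integral_mellin_mul_gammaTerm hε one_pos (by linarith), norm_mul] at h3
  refine le_trans (le_mul_of_one_le_left (norm_nonneg _) ?_) h3
  rw [← ofReal_ofNat, ← ofReal_mul, norm_real, Real.norm_of_nonneg Real.two_pi_pos.le]
  linarith [Real.pi_gt_three]

theorem integrable_mellin_mul_logDeriv_Gammaℝ (hε : 0 < ε) (hh : IsClassEWith ε h) {c : ℝ}
    (h1 : 0 < c) (h2 : c < 1 + ε) :
    Integrable fun t : ℝ => mellin h (c + t * I) * -logDeriv Gammaℝ (c + t * I) := by
  set A : ℝ := |Real.log Real.pi + Real.eulerMascheroniConstant| + c⁻¹ + 1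
  have hI := ((hh.integrable_mellin hε (by linarith) h2).norm.mul_const A).add
      (hh.integrable_norm_mellin_mul_log hε (by linarith) h2 (A := 2 + c) (by linarith))
  refine hI.mono' ((hh.integrable_mellin hε (by linarith) h2).aestronglyMeasurable.mul
    ((measurable_logDeriv_Gammaℝ.comp (by fun_prop)).neg).aestronglyMeasurable)
    (Eventually.of_forall fun t => ?_)
  simp only [Pi.add_apply]
  rw [norm_mul, norm_neg, ← mul_add]
  gcongr
  refine (norm_logDeriv_Gammaℝ_le h1 (by simp)).trans ?_
  have h3 := norm_ofReal_add_mul_I_le h1.le t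
  have h4 := Real.log_le_log (by positivity) (by linarith : 2 + ‖(c : ℂ) + t * I‖ ≤ 2 + c + |t|)
  simp only [A]
  linarith

/-- The contribution of a single `h` to the archimedean term: the partial fraction expansion of
`-Γℝ'/Γℝ` integrated term by term. -/
theorem integral_mellin_mul_logDeriv_Gammaℝ (hε : 0 < ε) (hh : IsClassEWith ε h) {c : ℝ}
    (h1 : 0 < c) (h2 : c < 1 + ε) :
    ∫ t : ℝ, mellin h (c + t * I) * -logDeriv Gammaℝ (c + t * I) = 2 * Real.pi *
      (((Real.log Real.pi + Real.eulerMascheroniConstant : ℝ) : ℂ) / 2 * h 1 +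
        (∫ u in Ioi (1 : ℝ), h u / (u : ℂ)) + ∑' j : ℕ, weilRealTerm h (j + 1)) := by
  have hre : ∀ t : ℝ, 0 < ((c : ℂ) + t * I).re := fun t => by simpa using h1
  have hsum := hasSum_integral_of_summable_integral_norm
    (hh.integrable_mellin_mul_gammaTerm hε h1 h2)
    (hh.summable_integral_norm_mellin_mul_gammaTerm hε h1 h2)
  simp_rw [hh.integral_mellin_mul_gammaTerm hε h1 h2] at hsum
  have hinv := hh.integral_mellin_mul_inv hε h1 h2 0
  have hinvI := hh.integrable_mellin_mul_inv hε h1 h2 0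
  simp only [Nat.cast_zero, add_zero, pow_zero, inv_one, mul_one] at hinv hinvI
  have h3 : ∀ t : ℝ, mellin h (c + t * I) * -logDeriv Gammaℝ (c + t * I) =
      mellin h (c + t * I) * (((Real.log Real.pi + Real.eulerMascheroniConstant : ℝ) : ℂ) / 2) +
      mellin h (c + t * I) * ((c : ℂ) + t * I)⁻¹ +
      ∑' j, mellin h (c + t * I) * gammaTerm j (c + t * I) := fun t => by
    rw [neg_logDeriv_Gammaℝ_eq (hre t), tsum_mul_left]
    ring
  have hAB : Integrable fun t : ℝ =>
      mellin h (c + t * I) * (((Real.log Real.pi + Real.eulerMascheroniConstant : ℝ) : ℂ) / 2) +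
      mellin h (c + t * I) * ((c : ℂ) + t * I)⁻¹ :=
    ((hh.integrable_mellin hε (by linarith) h2).mul_const _).add hinvI
  have hT : Integrable fun t : ℝ => ∑' j, mellin h (c + t * I) * gammaTerm j (c + t * I) := by
    refine ((hh.integrable_mellin_mul_logDeriv_Gammaℝ hε h1 h2).sub hAB).congr
      (Eventually.of_forall fun t => ?_)
    simp only [Pi.sub_apply]
    rw [h3]
    ring
  simp_rw [h3]
  rw [integral_add hAB hT,
    integral_add ((hh.integrable_mellin hε (by linarith) h2).mul_const _) hinvI,
    integral_mul_const, hh.integral_mellin hε (by linarith) h2, hinv, ← hsum.tsum_eq, tsum_mul_left]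
  ring

theorem integrable_archimedean (hε : 0 < ε) (hh : IsClassEWith ε h) {c : ℝ} (h1 : 0 < c)
    (h2 : c < 1 + ε) :
    Integrable fun t : ℝ => -logDeriv Gammaℝ (c + t * I) *
      (mellin h (c + t * I) + mellin h (1 - (c + t * I))) := by
  refine ((hh.integrable_mellin_mul_logDeriv_Gammaℝ hε h1 h2).add
    (hh.transpose.integrable_mellin_mul_logDeriv_Gammaℝ hε h1 h2)).congr
    (Eventually.of_forall fun t => ?_)
  simp only [Pi.add_apply, mellin_transpose]
  ring

theorem integrableOn_div (hε : 0 < ε) (hh : IsClassEWith ε h) :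
    IntegrableOn (fun u : ℝ => h u / (u : ℂ)) (Ioi 1) := by
  simpa using hh.integrableOn_mul_inv_pow_div hε 0

theorem integral_archimedean (hε : 0 < ε) (hh : IsClassEWith ε h) {c : ℝ} (h1 : 0 < c)
    (h2 : c < 1 + ε) :
    ∫ t : ℝ, -logDeriv Gammaℝ (c + t * I) *
      (mellin h (c + t * I) + mellin h (1 - (c + t * I))) = 2 * Real.pi * weilReal h := by
  have h3 : ∀ t : ℝ, -logDeriv Gammaℝ (c + t * I) *
      (mellin h (c + t * I) + mellin h (1 - (c + t * I))) =
      mellin h (c + t * I) * -logDeriv Gammaℝ (c + t * I) +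
      mellin (transpose h) (c + t * I) * -logDeriv Gammaℝ (c + t * I) := fun t => by
    rw [mellin_transpose]
    ring
  simp_rw [h3]
  rw [integral_add (hh.integrable_mellin_mul_logDeriv_Gammaℝ hε h1 h2)
    (hh.transpose.integrable_mellin_mul_logDeriv_Gammaℝ hε h1 h2),
    hh.integral_mellin_mul_logDeriv_Gammaℝ hε h1 h2,
    hh.transpose.integral_mellin_mul_logDeriv_Gammaℝ hε h1 h2, weilReal, transpose_one]
  simp_rw [add_div]
  rw [integral_add (hh.integrableOn_div hε) (hh.transpose.integrableOn_div hε)]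
  ring

theorem tendsto_archimedeanIntegral (hε : 0 < ε) (hh : IsClassEWith ε h) {c : ℝ} (h1 : 0 < c)
    (h2 : c < 1 + ε) :
    Tendsto (fun T : ℝ => archimedeanIntegral h c T) atTop (𝓝 (weilReal h)) := by
  have h3 := (intervalIntegral_tendsto_integral (hh.integrable_archimedean hε h1 h2)
    tendsto_neg_atTop_atBot tendsto_id).const_mul (1 / (2 * (Real.pi : ℂ)))
  have hpi : (Real.pi : ℂ) ≠ 0 := by exact_mod_cast Real.pi_ne_zero
  rw [hh.integral_archimedean hε h1 h2, ← mul_assoc, one_div_mul_cancel (by simp [hpi]),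
    one_mul] at h3
  refine h3.congr fun T => ?_
  rw [archimedeanIntegral, intervalIntegral.integral_mul_const]
  have h4 : ∀ X : ℂ, 1 / (2 * (Real.pi : ℂ)) * X = 1 / (2 * (Real.pi : ℂ) * I) * (X * I) :=
    fun X => by field_simp
  exact h4 _

end IsClassEWith

/-! ### The prime terms -/

open ArithmeticFunction (vonMangoldt)

/-- The second series in `W_p(g)` is the first one for the transpose. -/
theorem transpose_pow (h : ℝ → ℂ) (p k : ℕ) :
    transpose h ((p : ℝ) ^ k) = (1 / (p : ℂ) ^ k) * h (1 / (p : ℝ) ^ k) := by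
  simp [transpose]

theorem weilPrime_eq (h : ℝ → ℂ) (p : ℕ) :
    weilPrime h p = (Real.log p : ℂ) * ∑' k : ℕ, h ((p : ℝ) ^ (k + 1)) +
      (Real.log p : ℂ) * ∑' k : ℕ, transpose h ((p : ℝ) ^ (k + 1)) := by
  simp_rw [weilPrime, transpose_pow]

theorem norm_logDeriv_riemannZeta_le {c : ℝ} (hc : 1 < c) (t : ℝ) :
    ‖logDeriv riemannZeta (c + t * I)‖ ≤
      ∑' n, ‖LSeries.term (fun n => (vonMangoldt n : ℂ)) c n‖ := by
  have hre : 1 < ((c : ℂ) + t * I).re := by simpa using hc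
  have h1 := ArithmeticFunction.LSeries_vonMangoldt_eq_deriv_riemannZeta_div hre
  have h2 : ‖logDeriv riemannZeta (c + t * I)‖ =
      ‖LSeries (fun n => (vonMangoldt n : ℂ)) (c + t * I)‖ := by
    rw [h1, logDeriv_apply, neg_div, norm_neg]
  have h3 : ∀ n, ‖LSeries.term (fun n => (vonMangoldt n : ℂ)) (c + t * I) n‖ =
      ‖LSeries.term (fun n => (vonMangoldt n : ℂ)) c n‖ := fun n => by
    rw [LSeries.norm_term_eq, LSeries.norm_term_eq]
    simp
  rw [h2, LSeries]
  refine (norm_tsum_le_tsum_norm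
    (ArithmeticFunction.LSeriesSummable_vonMangoldt hre).norm).trans (le_of_eq ?_)
  exact tsum_congr h3

namespace IsClassEWith

variable {ε : ℝ} {h : ℝ → ℂ}

theorem summable_vonMangoldt_mul (hε : 0 < ε) (hh : IsClassEWith ε h) :
    Summable fun n : ℕ => (vonMangoldt n : ℂ) * h n := by
  obtain ⟨C, -, hC⟩ := hh.exists_norm_le hε
  have h1 := (ArithmeticFunction.LSeriesSummable_vonMangoldt (s := (1 + ε : ℝ))
    (by rw [ofReal_re]; linarith)).norm.mul_left C
  refine .of_norm_bounded h1 fun n => ?_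
  rcases Nat.eq_zero_or_pos n with rfl | hn
  · simp
  have hn' : (0 : ℝ) < n := by exact_mod_cast hn
  have h2 := hC (1 + ε) (by linarith) le_rfl n hn'
  rw [LSeries.term_def, if_neg hn.ne', norm_div, norm_mul, norm_natCast_cpow_of_pos hn, ofReal_re]
  rw [Real.rpow_neg hn'.le] at h2
  calc _ ≤ ‖(vonMangoldt n : ℂ)‖ * (C * ((n : ℝ) ^ (1 + ε))⁻¹) := by gcongr
    _ = _ := by ring

theorem summable_log_mul_prime_pow (hε : 0 < ε) (hh : IsClassEWith ε h) :
    Summable fun q : Nat.Primes × ℕ => (Real.log q.1 : ℂ) * h (((q.1 : ℕ) : ℝ) ^ (q.2 + 1)) := by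
  have h1 := (hh.summable_vonMangoldt_mul hε).comp_injective
    (Subtype.val_injective.comp Nat.Primes.prodNatEquiv.injective)
  refine h1.congr fun q => ?_
  simp only [Function.comp_apply]
  change ((vonMangoldt ((q.1 : ℕ) ^ (q.2 + 1)) : ℝ) : ℂ) * h (((q.1 : ℕ) ^ (q.2 + 1) : ℕ) : ℝ) = _
  rw [ArithmeticFunction.vonMangoldt_apply_pow (Nat.succ_ne_zero _),
    ArithmeticFunction.vonMangoldt_apply_prime q.1.2]
  push_cast
  rfl

theorem tsum_vonMangoldt_mul (hε : 0 < ε) (hh : IsClassEWith ε h) :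
    ∑' n : ℕ, (vonMangoldt n : ℂ) * h n =
      ∑' p : Nat.Primes, (Real.log p : ℂ) * ∑' k : ℕ, h (((p : ℕ) : ℝ) ^ (k + 1)) := by
  rw [tsum_eq_tsum_primes_of_support_subset_prime_powers (hh.summable_vonMangoldt_mul hε)]
  · refine tsum_congr fun p => ?_
    rw [← tsum_mul_left]
    refine tsum_congr fun k => ?_
    rw [ArithmeticFunction.vonMangoldt_apply_pow (Nat.succ_ne_zero _),
      ArithmeticFunction.vonMangoldt_apply_prime p.2]
    push_cast
    rfl
  · intro n hn
    by_contra hp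
    exact hn (by simp [ArithmeticFunction.vonMangoldt_eq_zero_iff.2 hp])

theorem summable_prime_pow (hε : 0 < ε) (hh : IsClassEWith ε h) {p : ℕ} (hp : p.Prime) :
    Summable fun k : ℕ => ‖h ((p : ℝ) ^ (k + 1))‖ := by
  have h1 := ((hh.summable_log_mul_prime_pow hε).prod_factor ⟨p, hp⟩)
  have h2 : (Real.log p : ℂ) ≠ 0 := by
    exact_mod_cast (Real.log_pos (by exact_mod_cast hp.one_lt)).ne'
  exact ((summable_mul_left_iff h2).1 h1).norm

theorem summable_log_mul_tsum (hε : 0 < ε) (hh : IsClassEWith ε h) :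
    Summable fun p : Nat.Primes =>
      (Real.log p : ℂ) * ∑' k : ℕ, h (((p : ℕ) : ℝ) ^ (k + 1)) := by
  refine (hh.summable_log_mul_prime_pow hε).prod.congr fun p => ?_
  exact tsum_mul_left (a := (Real.log p : ℂ)) (f := fun k : ℕ => h (((p : ℕ) : ℝ) ^ (k + 1)))

theorem summable_weilPrime (hε : 0 < ε) (hh : IsClassEWith ε h) :
    Summable fun p : Nat.Primes => weilPrime h p := by
  simp_rw [weilPrime_eq]
  exact (hh.summable_log_mul_tsum hε).add (hh.transpose.summable_log_mul_tsum hε)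

theorem tsum_weilPrime (hε : 0 < ε) (hh : IsClassEWith ε h) :
    ∑' p : Nat.Primes, weilPrime h p = ∑' n : ℕ, (vonMangoldt n : ℂ) * h n +
      ∑' n : ℕ, (vonMangoldt n : ℂ) * transpose h n := by
  simp_rw [weilPrime_eq]
  rw [(hh.summable_log_mul_tsum hε).tsum_add (hh.transpose.summable_log_mul_tsum hε),
    hh.tsum_vonMangoldt_mul hε, hh.transpose.tsum_vonMangoldt_mul hε]

theorem weilTermsConverge (hε : 0 < ε) (hh : IsClassEWith ε h) : WeilTermsConverge h where
  prime _ hp := hh.summable_prime_pow hε hp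
  prime_inv p hp := by
    simpa only [transpose_pow] using hh.transpose.summable_prime_pow hε hp
  primes := (hh.summable_weilPrime hε).norm
  real_integral := by
    simp_rw [add_div]
    exact (hh.integrableOn_div hε).add (hh.transpose.integrableOn_div hε)
  real_term_integral := by
    rintro f (rfl | rfl) j
    exacts [hh.integrableOn_weilRealTerm hε j, hh.transpose.integrableOn_weilRealTerm hε j]
  real_sum := by
    rintro f (rfl | rfl)
    exacts [hh.summable_norm_weilRealTerm hε, hh.transpose.summable_norm_weilRealTerm hε]

theorem integrable_mellin_mul_logDeriv_riemannZeta (hε : 0 < ε) (hh : IsClassEWith ε h) {c : ℝ}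
    (h1 : 1 < c) (h2 : c < 1 + ε) :
    Integrable fun t : ℝ => mellin h (c + t * I) * -logDeriv riemannZeta (c + t * I) := by
  refine hh.integrable_mellin_mul hε (by linarith) h2 ?_
    (fun t => (norm_neg _).trans_le (norm_logDeriv_riemannZeta_le h1 t))
  have hre : ∀ t : ℝ, 1 < ((c : ℂ) + t * I).re := fun t => by simpa using h1
  have hne : ∀ t : ℝ, ((c : ℂ) + t * I) ∈ ({1}ᶜ : Set ℂ) := fun t h3 => by
    have := hre t
    rw [mem_singleton_iff.1 h3, one_re] at this
    exact lt_irrefl _ this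
  have hl : Continuous fun t : ℝ => (c : ℂ) + t * I := by fun_prop
  have h4 : Continuous fun t : ℝ => deriv riemannZeta (c + t * I) / riemannZeta (c + t * I) :=
    (analyticOnNhd_riemannZeta.deriv.continuousOn.comp_continuous hl hne).div
      (analyticOnNhd_riemannZeta.continuousOn.comp_continuous hl hne)
      fun t => riemannZeta_ne_zero_of_one_lt_re (hre t)
  exact h4.neg.aestronglyMeasurable

/-- The Dirichlet series of `-ζ'/ζ` integrated term by term, with Mellin inversion at each integer.
-/
theorem integral_mellin_mul_logDeriv_riemannZeta (hε : 0 < ε) (hh : IsClassEWith ε h) {c : ℝ}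
    (h1 : 1 < c) (h2 : c < 1 + ε) :
    ∫ t : ℝ, mellin h (c + t * I) * -logDeriv riemannZeta (c + t * I) =
      2 * Real.pi * ∑' n : ℕ, (vonMangoldt n : ℂ) * h n := by
  set f : ℕ → ℂ := fun n => (vonMangoldt n : ℂ)
  have hre : ∀ t : ℝ, 1 < ((c : ℂ) + t * I).re := fun t => by simpa using h1
  have hterm : ∀ (n : ℕ) (t : ℝ), LSeries.term f (c + t * I) n =
      f n * (n : ℂ) ^ (-(c + t * I) : ℂ) := fun n t => by
    rcases Nat.eq_zero_or_pos n with rfl | hn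
    · simp [f]
    · rw [LSeries.term_def, if_neg hn.ne', cpow_neg, div_eq_mul_inv]
  have hnorm : ∀ (n : ℕ) (t : ℝ), ‖LSeries.term f (c + t * I) n‖ = ‖LSeries.term f c n‖ :=
    fun n t => by
      rw [LSeries.norm_term_eq, LSeries.norm_term_eq]
      simp
  have hI : ∀ n, Integrable fun t : ℝ => mellin h (c + t * I) * LSeries.term f (c + t * I) n :=
    fun n => by
      refine hh.integrable_mellin_mul hε (by linarith) h2 ?_ (fun t => (hnorm n t).le)
      simp_rw [hterm]
      exact (by fun_prop : Measurable fun t : ℝ =>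
        f n * (n : ℂ) ^ (-(c + t * I) : ℂ)).aestronglyMeasurable
  have hS : Summable fun n => ∫ t : ℝ, ‖mellin h (c + t * I) * LSeries.term f (c + t * I) n‖ := by
    simp_rw [norm_mul, hnorm, integral_mul_const]
    exact (ArithmeticFunction.LSeriesSummable_vonMangoldt (s := (c : ℂ))
      (by simpa using h1)).norm.mul_left _
  have hsum := hasSum_integral_of_summable_integral_norm hI hS
  calc _ = ∫ t : ℝ, ∑' n, mellin h (c + t * I) * LSeries.term f (c + t * I) n := by
        congr with t
        rw [tsum_mul_left, ← LSeries,
          ArithmeticFunction.LSeries_vonMangoldt_eq_deriv_riemannZeta_div (hre t), logDeriv_apply,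
          neg_div]
    _ = ∑' n, ∫ t : ℝ, mellin h (c + t * I) * LSeries.term f (c + t * I) n := hsum.tsum_eq.symm
    _ = ∑' n : ℕ, 2 * Real.pi * (f n * h n) := by
        refine tsum_congr fun n => ?_
        rcases Nat.eq_zero_or_pos n with rfl | hn
        · simp [f]
        have hn' : (0 : ℝ) < n := by exact_mod_cast hn
        have h3 := hh.integral_cpow_mul_mellin hε (by linarith) h2 hn'
        rw [ofReal_natCast] at h3
        have h4 : ∀ t : ℝ, mellin h (c + t * I) * LSeries.term f (c + t * I) n =
            f n * ((n : ℂ) ^ (-(c + t * I) : ℂ) * mellin h (c + t * I)) := fun t => by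
          rw [hterm]
          ring
        simp_rw [h4]
        rw [integral_const_mul, h3]
        ring
    _ = _ := tsum_mul_left

end IsClassEWith

/-! ### The completed zeta function -/

/-- The function `s (s - 1) π^{-s/2} Γ(s/2) ζ(s)`, extended to an entire function. -/
noncomputable def xi (s : ℂ) : ℂ := s * (s - 1) * completedRiemannZeta₀ s + 1

theorem differentiable_xi : Differentiable ℂ xi :=
  ((differentiable_id.mul (differentiable_id.sub_const 1)).mul
    differentiable_completedZeta₀).add_const 1

theorem xi_one_sub (s : ℂ) : xi (1 - s) = xi s := by
  rw [xi, xi, completedRiemannZeta₀_one_sub]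
  ring

theorem xi_eq_mul_riemannZeta {s : ℂ} (h : 0 < s.re) (h1 : s ≠ 1) :
    xi s = s * (s - 1) * Gammaℝ s * riemannZeta s := by
  have h0 : s ≠ 0 := fun h0 => by simp [h0] at h
  have h1' : 1 - s ≠ 0 := sub_ne_zero.2 h1.symm
  rw [riemannZeta_def_of_ne_zero h0, mul_assoc, mul_div_cancel₀ _ (Gammaℝ_ne_zero_of_re_pos h),
    completedRiemannZeta_eq, xi]
  field_simp
  ring

theorem xi_eventuallyEq {s : ℂ} (h : 0 < s.re) (h1 : s ≠ 1) :
    xi =ᶠ[𝓝 s] (fun z => z * (z - 1) * Gammaℝ z) * riemannZeta := by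
  filter_upwards [(isOpen_lt continuous_const continuous_re).mem_nhds h,
    isOpen_compl_singleton.mem_nhds (show s ∈ ({1}ᶜ : Set ℂ) from h1)] with z hz hz1
  exact xi_eq_mul_riemannZeta hz hz1

theorem analyticAt_Gammaℝ {s : ℂ} (h : 0 < s.re) : AnalyticAt ℂ Gammaℝ s := by
  have h2 : AnalyticAt ℂ (fun z => (Gammaℝ z)⁻¹) s :=
    differentiable_Gammaℝ_inv.analyticAt s
  simpa only [Pi.inv_def, inv_inv] using h2.inv (inv_ne_zero (Gammaℝ_ne_zero_of_re_pos h))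

theorem xi_one : xi 1 = 1 := by simp [xi]

/-- On `Re s ≥ 1` there are no zeros, by the non-vanishing of `ζ`, and the functional equation
excludes `Re s ≤ 0`. -/
theorem xi_eq_zero_iff {s : ℂ} : xi s = 0 ↔ s ∈ criticalZeros := by
  have key : ∀ z : ℂ, xi z = 0 → 0 < z.re → riemannZeta z = 0 ∧ z.re < 1 := fun z hz h0 => by
    have h1 : z ≠ 1 := fun h => by simp [h, xi_one] at hz
    rw [xi_eq_mul_riemannZeta h0 h1] at hz
    have h2 : z ≠ 0 := fun h => by simp [h] at h0
    have h3 : riemannZeta z = 0 :=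
      (mul_eq_zero.1 hz).resolve_left (mul_ne_zero (mul_ne_zero h2 (sub_ne_zero.2 h1))
        (Gammaℝ_ne_zero_of_re_pos h0))
    exact ⟨h3, not_le.1 fun h => riemannZeta_ne_zero_of_one_le_re h h3⟩
  constructor
  · intro h
    have h0 : 0 < s.re := by
      by_contra! h0
      have := (key (1 - s) (by rwa [xi_one_sub]) (by simp; linarith)).2
      simp at this
      linarith
    exact ⟨(key s h h0).1, h0, (key s h h0).2⟩
  · rintro ⟨h, h0, h1⟩
    rw [xi_eq_mul_riemannZeta h0 (fun h2 => by simp [h2] at h1), h, mul_zero]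

theorem one_sub_mem_criticalZeros {ρ : ℂ} (h : ρ ∈ criticalZeros) : 1 - ρ ∈ criticalZeros := by
  rw [← xi_eq_zero_iff, xi_one_sub, xi_eq_zero_iff]
  exact h

theorem analyticOrderAt_xi {ρ : ℂ} (h : 0 < ρ.re) (h1 : ρ ≠ 1) :
    analyticOrderAt xi ρ = analyticOrderAt riemannZeta ρ := by
  have h0 : ρ ≠ 0 := fun h0 => by simp [h0] at h
  have hA : AnalyticAt ℂ (fun z => z * (z - 1) * Gammaℝ z) ρ :=
    (analyticAt_id.mul (analyticAt_id.sub analyticAt_const)).mul (analyticAt_Gammaℝ h)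
  rw [analyticOrderAt_congr (xi_eventuallyEq h h1),
    analyticOrderAt_mul hA (analyticOnNhd_riemannZeta ρ h1), hA.analyticOrderAt_eq_zero.2
    (mul_ne_zero (mul_ne_zero h0 (sub_ne_zero.2 h1)) (Gammaℝ_ne_zero_of_re_pos h)), zero_add]

theorem analyticOrderNatAt_xi {ρ : ℂ} (h : ρ ∈ criticalZeros) :
    analyticOrderNatAt xi ρ = analyticOrderNatAt riemannZeta ρ := by
  rw [analyticOrderNatAt, analyticOrderNatAt, analyticOrderAt_xi h.2.1 fun h1 => by
    simpa [h1] using h.2.2]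

theorem analyticOrderAt_xi_ne_top {ρ : ℂ} (h : ρ ∈ criticalZeros) :
    analyticOrderAt xi ρ ≠ ⊤ := by
  have h1 : ρ ≠ 1 := fun h1 => by simpa [h1] using h.2.2
  rw [analyticOrderAt_xi h.2.1 h1]
  exact analyticOrderAt_riemannZeta_ne_top h1

theorem analyticOrderNatAt_riemannZeta_one_sub {ρ : ℂ} (h : ρ ∈ criticalZeros) :
    analyticOrderNatAt riemannZeta (1 - ρ) = analyticOrderNatAt riemannZeta ρ := by
  rw [← analyticOrderNatAt_xi h, ← analyticOrderNatAt_xi (one_sub_mem_criticalZeros h)]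
  have hd : HasDerivAt (fun z : ℂ => 1 - z) (-1) ρ := by
    simpa using (hasDerivAt_id ρ).const_sub 1
  have h1 := analyticOrderAt_comp_of_deriv_ne_zero (f := xi) (g := fun z : ℂ => 1 - z) (z₀ := ρ)
    (by fun_prop) (by rw [hd.deriv]; norm_num)
  have h2 : xi ∘ (fun z : ℂ => 1 - z) = xi := funext xi_one_sub
  rw [h2] at h1
  rw [analyticOrderNatAt, analyticOrderNatAt, h1]

/-- The logarithmic derivative of `xi` with the contributions of the factors `s` and `s - 1`
removed; in the half-plane `Re s > 0` it is that of `π^{-s/2} Γ(s/2) ζ(s)`. -/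
noncomputable def logDerivXiSub (s : ℂ) : ℂ := logDeriv xi s - s⁻¹ - (s - 1)⁻¹

theorem logDeriv_xi_one_sub (s : ℂ) : logDeriv xi (1 - s) = -logDeriv xi s := by
  have h1 : deriv xi (1 - s) = -deriv xi s := by
    have h2 := deriv_comp_const_sub xi 1 s
    simp_rw [xi_one_sub] at h2
    rw [h2, neg_neg]
  rw [logDeriv_apply, logDeriv_apply, h1, xi_one_sub, neg_div]

theorem logDerivXiSub_one_sub (s : ℂ) : logDerivXiSub (1 - s) = -logDerivXiSub s := by
  rw [logDerivXiSub, logDerivXiSub, logDeriv_xi_one_sub, ← neg_sub s 1, inv_neg,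
    show -(s - 1) - 1 = -s by ring, inv_neg]
  ring

theorem logDerivXiSub_eq {s : ℂ} (h : 0 < s.re) (h1 : s ≠ 1) (hz : riemannZeta s ≠ 0) :
    logDerivXiSub s = logDeriv Gammaℝ s + logDeriv riemannZeta s := by
  have h0 : s ≠ 0 := fun h0 => by simp [h0] at h
  have h1' : s - 1 ≠ 0 := sub_ne_zero.2 h1
  have hG := Gammaℝ_ne_zero_of_re_pos h
  have hGd := (analyticAt_Gammaℝ h).differentiableAt
  have e1 : logDeriv (fun z : ℂ => z) s = s⁻¹ := by simp [logDeriv_apply]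
  have e2 : logDeriv (fun z : ℂ => z - 1) s = (s - 1)⁻¹ := by simp [logDeriv_apply]
  rw [logDerivXiSub, (logDeriv_congr_nhds (xi_eventuallyEq h h1)).self_of_nhds]
  rw [show ((fun z => z * (z - 1) * Gammaℝ z) * riemannZeta) =
    fun z => (z * (z - 1) * Gammaℝ z) * riemannZeta z from rfl,
    logDeriv_mul (f := fun z => z * (z - 1) * Gammaℝ z) s (mul_ne_zero (mul_ne_zero h0 h1') hG) hz
      (by fun_prop) (differentiableAt_riemannZeta h1),
    logDeriv_mul (f := fun z => z * (z - 1)) s (mul_ne_zero h0 h1') hG (by fun_prop) hGd,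
    logDeriv_mul (f := fun z => z) (g := fun z => z - 1) s h0 h1' (by fun_prop) (by fun_prop),
    e1, e2]
  ring

/-- There are heights in every interval `[τ, τ + 1/4]` at which `logDerivXiSub` is `O(log² τ)`. The
left half of the strip is reached through the functional equation. -/
theorem exists_height_logDerivXiSub : ∃ D : ℝ, 0 < D ∧ ∀ τ : ℝ, 3 ≤ τ →
    ∃ T ∈ Icc τ (τ + 1 / 4), ∀ s : ℂ, -1 ≤ s.re → s.re ≤ 2 → |s.im| = T →
      xi s ≠ 0 ∧ ‖logDerivXiSub s‖ ≤ D * Real.log τ ^ 2 := by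
  obtain ⟨A, hA, h⟩ := exists_height_logDeriv_riemannZeta
  set K : ℝ := |Real.log Real.pi + Real.eulerMascheroniConstant| + (1 / 2)⁻¹ + 1 with hK
  refine ⟨A + K + 2, by positivity, fun τ hτ => ?_⟩
  obtain ⟨T, hT, hT'⟩ := h τ hτ
  have hlog : 1 ≤ Real.log τ := by
    rw [Real.le_log_iff_exp_le (by linarith)]
    exact Real.exp_one_lt_three.le.trans hτ
  have key : ∀ s : ℂ, 1 / 2 ≤ s.re → s.re ≤ 2 → |s.im| = T →
      xi s ≠ 0 ∧ ‖logDerivXiSub s‖ ≤ (A + K + 2) * Real.log τ ^ 2 := fun s h1 h2 h3 => by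
    have hne : s ≠ 1 := fun h4 => by
      rw [h4, one_im, abs_zero] at h3
      linarith [hT.1]
    obtain ⟨h4, h5⟩ := hT' s h1 h2 h3
    refine ⟨fun h6 => h4 (xi_eq_zero_iff.1 h6).1, ?_⟩
    rw [logDerivXiSub_eq (by linarith) hne h4]
    have h6 := norm_logDeriv_Gammaℝ_le (s := s) (by norm_num : (0 : ℝ) < 1 / 2) h1
    have h7 : ‖s‖ ≤ 2 + (τ + 1 / 4) := by
      refine (norm_le_abs_re_add_abs_im s).trans ?_
      rw [abs_of_nonneg (by linarith), h3]
      linarith [hT.2]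
    have h8 : Real.log (2 + ‖s‖) ≤ 2 * Real.log τ := by
      rw [← Real.log_rpow (by linarith)]
      refine Real.log_le_log (by positivity) ?_
      norm_num
      nlinarith
    refine (norm_add_le _ _).trans ?_
    have hK0 : 0 ≤ K := by positivity
    have h9 : 1 ≤ Real.log τ ^ 2 := one_le_pow₀ hlog
    nlinarith
  refine ⟨T, hT, fun s h1 h2 h3 => ?_⟩
  rcases le_total (1 / 2) s.re with h4 | h4
  · exact key s h4 h2 h3
  · have h5 := key (1 - s) (by simp; linarith) (by simp; linarith) (by simpa using h3)
    rwa [xi_one_sub, logDerivXiSub_one_sub, norm_neg] at h5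

/-! ### The contour integral -/

theorem rectIntegral_finset_sum {ι : Type*} (Z : Finset ι) {f : ι → ℂ → ℂ} {a b T : ℝ}
    (hab : a ≤ b) (hT : 0 ≤ T) (hf : ∀ i ∈ Z, ContinuousOn (f i) (rectBoundary a b T)) :
    rectIntegral (fun s => ∑ i ∈ Z, f i s) a b T = ∑ i ∈ Z, rectIntegral (f i) a b T := by
  classical
  induction Z using Finset.induction_on with
  | empty => simp [rectIntegral]
  | insert i Z hi ih =>
    simp_rw [Finset.sum_insert hi]
    rw [rectIntegral_add (.of_continuousOn hab hT (hf i (Finset.mem_insert_self _ _)))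
      (.of_continuousOn hab hT (continuousOn_finsetSum _ fun j hj =>
        hf j (Finset.mem_insert_of_mem hj))), ih fun j hj => hf j (Finset.mem_insert_of_mem hj)]

theorem mem_zeros_iff {ρ : ℂ} {T : ℝ} :
    ρ ∈ (finite_criticalZeros_lt T).toFinset ↔ ρ ∈ criticalZeros ∧ |ρ.im| < T := by
  rw [Set.Finite.mem_toFinset]
  rfl

theorem mellin_mul_logDerivXiSub_eq {c : ℝ} (h1 : 1 < c) (z : ℂ) (t : ℝ) :
    z * logDerivXiSub (c + t * I) =
      -(z * -logDeriv Gammaℝ (c + t * I) + z * -logDeriv riemannZeta (c + t * I)) := by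
  have hre : 1 < ((c : ℂ) + t * I).re := by simpa using h1
  rw [logDerivXiSub_eq (by linarith) (fun h3 => by rw [h3, one_re] at hre; exact lt_irrefl _ hre)
    (riemannZeta_ne_zero_of_one_lt_re hre)]
  ring

/-- The vertical sides of the contour, folded onto the line `Re s = c` by the functional equation.
-/
theorem rectIntegral_eq_horizontal_add_vertical (g : ℝ → ℂ) (c T : ℝ) :
    rectIntegral (fun s => mellin g s * logDerivXiSub s) (1 - c) c T =
      (∫ x in (1 - c)..c, mellin g (x + (-T : ℝ) * I) * logDerivXiSub (x + (-T : ℝ) * I)) -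
      (∫ x in (1 - c)..c, mellin g (x + T * I) * logDerivXiSub (x + T * I)) +
      I * ((∫ t in (-T)..T, mellin g (c + t * I) * logDerivXiSub (c + t * I)) +
        ∫ t in (-T)..T, mellin (transpose g) (c + t * I) * logDerivXiSub (c + t * I)) := by
  have h1 := intervalIntegral.integral_comp_neg (a := -T) (b := T)
    fun y : ℝ => mellin g ((1 - c : ℝ) + y * I) * logDerivXiSub ((1 - c : ℝ) + y * I)
  rw [neg_neg] at h1
  have h2 : ∀ y : ℝ, mellin g ((1 - c : ℝ) + (-y : ℝ) * I) * logDerivXiSub ((1 - c : ℝ) +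
      (-y : ℝ) * I) = -(mellin (transpose g) (c + y * I) * logDerivXiSub (c + y * I)) := fun y => by
    rw [mellin_transpose, show (((1 - c : ℝ) : ℂ) + (-y : ℝ) * I) = 1 - (c + y * I) by
      push_cast; ring, logDerivXiSub_one_sub]
    ring
  simp_rw [h2] at h1
  rw [intervalIntegral.integral_neg] at h1
  rw [rectIntegral, ← h1]
  ring

namespace IsClassEWith

variable {ε : ℝ} {g : ℝ → ℂ}

/-- The residue theorem for `ĝ · (ξ'/ξ - 1/s - 1/(s - 1))` on a rectangle about the critical strip.
The factorization of `ξ` over its zeros in the rectangle reduces it to Cauchy's formula for the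
functions `ĝ(s) / (s - ρ)`. -/
theorem rectIntegral_mellin_mul_logDerivXiSub (hε : 0 < ε) (hg : IsClassEWith ε g) {c : ℝ}
    (h1 : 1 < c) (h2 : c < 1 + ε) {T : ℝ} (hT : 0 < T)
    (hgood : ∀ ρ ∈ criticalZeros, |ρ.im| ≠ T) :
    rectIntegral (fun s => mellin g s * logDerivXiSub s) (1 - c) c T =
      2 * Real.pi * I * (zeroSum g T - mellin g 0 - mellin g 1) := by
  have hab : 1 - c ≤ c := by linarith
  set Z := (finite_criticalZeros_lt T).toFinset with hZ
  set S : Set ℂ := {s : ℂ | -ε < s.re ∧ s.re < 1 + ε} with hS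
  have hSo : IsOpen S :=
    (isOpen_lt continuous_const continuous_re).inter (isOpen_lt continuous_re continuous_const)
  have hG : DifferentiableOn ℂ (mellin g) S := hg.differentiableOn_mellin hε
  have hsub : Icc (1 - c) c ×ℂ Icc (-T) T ⊆ S := fun s hs =>
    ⟨by have := hs.1.1; linarith, by have := hs.1.2; linarith⟩
  have hbS : rectBoundary (1 - c) c T ⊆ S := (rectBoundary_subset hab hT.le).trans hsub
  have hGc : ContinuousOn (mellin g) (rectBoundary (1 - c) c T) := hG.continuousOn.mono hbS
  have hZin : ∀ ρ ∈ Z, 1 - c < ρ.re ∧ ρ.re < c ∧ |ρ.im| < T := fun ρ hρ => by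
    obtain ⟨⟨-, h3, h4⟩, h5⟩ := mem_zeros_iff.1 hρ
    exact ⟨by linarith, by linarith, h5⟩
  have hZero : ∀ s ∈ Icc (1 - c) c ×ℂ Icc (-T) T, xi s = 0 → s ∈ Z := fun s hs h3 => by
    rw [xi_eq_zero_iff] at h3
    refine mem_zeros_iff.2 ⟨h3, lt_of_le_of_ne (abs_le.2 ⟨hs.2.1, hs.2.2⟩) (hgood s h3)⟩
  have hcont : ∀ ρ : ℂ, 1 - c < ρ.re → ρ.re < c → |ρ.im| < T →
      ContinuousOn (fun s => mellin g s * (s - ρ)⁻¹) (rectBoundary (1 - c) c T) :=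
    fun ρ h3 h4 h5 => hGc.mul (ContinuousOn.inv₀ (by fun_prop)
      fun s hs => sub_ne_zero_of_mem_rectBoundary h3 h4 h5 hs)
  have hres : ∀ ρ : ℂ, 1 - c < ρ.re → ρ.re < c → |ρ.im| < T →
      rectIntegral (fun s => mellin g s * (s - ρ)⁻¹) (1 - c) c T =
        2 * Real.pi * I * mellin g ρ := fun ρ h3 h4 h5 =>
    rectIntegral_mul_inv_sub hSo hG hsub h3 h4 h5
  obtain ⟨e, he, hfe, he0⟩ := exists_eq_prod_mul isOpen_univ differentiable_xi.differentiableOn Z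
    (fun ρ _ => mem_univ _) fun ρ hρ => analyticOrderAt_xi_ne_top (mem_zeros_iff.1 hρ).1
  have he0' : ∀ s ∈ Icc (1 - c) c ×ℂ Icc (-T) T, e s ≠ 0 := fun s hs h3 => by
    have h4 : s ∈ Z := hZero s hs (by rw [hfe s (mem_univ _), h3, mul_zero])
    exact he0 s h4 h3
  have hed : DifferentiableOn ℂ (fun s => mellin g s * logDeriv e s)
      (Icc (1 - c) c ×ℂ Icc (-T) T) := by
    refine (hG.mono hsub).mul (DifferentiableOn.div ?_ (he.mono (subset_univ _)) he0')
    exact (he.deriv isOpen_univ).mono (subset_univ _)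
  have h0 : 1 - c < (0 : ℂ).re ∧ (0 : ℂ).re < c ∧ |(0 : ℂ).im| < T := by
    simp [hT]
    constructor <;> linarith
  have h1' : 1 - c < (1 : ℂ).re ∧ (1 : ℂ).re < c ∧ |(1 : ℂ).im| < T := by
    simp [hT]
    constructor <;> linarith
  have hEq : EqOn (fun s => mellin g s * logDerivXiSub s)
      (fun s => ((∑ ρ ∈ Z, (analyticOrderNatAt riemannZeta ρ : ℂ) * (mellin g s * (s - ρ)⁻¹)) +
        mellin g s * logDeriv e s) + ((-1) * (mellin g s * (s - 0)⁻¹) +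
        (-1) * (mellin g s * (s - 1)⁻¹))) (rectBoundary (1 - c) c T) := fun s hs => by
    have h3 : s ∉ Z := fun h3 => by
      obtain ⟨h4, h5, h6⟩ := hZin s h3
      exact sub_ne_zero_of_mem_rectBoundary h4 h5 h6 hs (sub_self s)
    have h4 : xi s ≠ 0 := fun h4 => h3 (hZero s (rectBoundary_subset hab hT.le hs) h4)
    simp only [logDerivXiSub]
    rw [logDeriv_eq_sum_add_logDeriv isOpen_univ he hfe (mem_univ s) h4 h3]
    have h5 : ∑ ρ ∈ Z, (analyticOrderNatAt xi ρ : ℂ) * (s - ρ)⁻¹ =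
        ∑ ρ ∈ Z, (analyticOrderNatAt riemannZeta ρ : ℂ) * (s - ρ)⁻¹ :=
      Finset.sum_congr rfl fun ρ hρ => by rw [analyticOrderNatAt_xi (mem_zeros_iff.1 hρ).1]
    have h6 : ∑ ρ ∈ Z, (analyticOrderNatAt riemannZeta ρ : ℂ) * (mellin g s * (s - ρ)⁻¹) =
        mellin g s * ∑ ρ ∈ Z, (analyticOrderNatAt riemannZeta ρ : ℂ) * (s - ρ)⁻¹ := by
      rw [Finset.mul_sum]
      exact Finset.sum_congr rfl fun ρ _ => by ring
    rw [h5, h6, sub_zero]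
    ring
  have hint : ∀ {f : ℂ → ℂ}, ContinuousOn f (rectBoundary (1 - c) c T) →
      RectIntegrable f (1 - c) c T := fun hf => .of_continuousOn hab hT.le hf
  have c1 : ∀ ρ ∈ Z, ContinuousOn (fun s => (analyticOrderNatAt riemannZeta ρ : ℂ) *
      (mellin g s * (s - ρ)⁻¹)) (rectBoundary (1 - c) c T) := fun ρ hρ =>
    continuousOn_const.mul (hcont ρ (hZin ρ hρ).1 (hZin ρ hρ).2.1 (hZin ρ hρ).2.2)
  have c2 := hed.continuousOn.mono (rectBoundary_subset hab hT.le)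
  have c3 : ContinuousOn (fun s => (-1) * (mellin g s * (s - 0)⁻¹)) (rectBoundary (1 - c) c T) :=
    continuousOn_const.mul (hcont 0 h0.1 h0.2.1 h0.2.2)
  have c4 : ContinuousOn (fun s => (-1) * (mellin g s * (s - 1)⁻¹)) (rectBoundary (1 - c) c T) :=
    continuousOn_const.mul (hcont 1 h1'.1 h1'.2.1 h1'.2.2)
  have c1' := continuousOn_finsetSum Z c1
  have c12 : ContinuousOn (fun s => (∑ ρ ∈ Z, (analyticOrderNatAt riemannZeta ρ : ℂ) *
      (mellin g s * (s - ρ)⁻¹)) + mellin g s * logDeriv e s) (rectBoundary (1 - c) c T) :=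
    c1'.add c2
  have c34 : ContinuousOn (fun s => (-1) * (mellin g s * (s - 0)⁻¹) +
      (-1) * (mellin g s * (s - 1)⁻¹)) (rectBoundary (1 - c) c T) := c3.add c4
  rw [rectIntegral_congr hab hT.le hEq, rectIntegral_add (hint c12) (hint c34),
    rectIntegral_add (hint c1') (hint c2), rectIntegral_add (hint c3) (hint c4),
    rectIntegral_finset_sum Z hab hT.le c1, rectIntegral_eq_zero hab hT.le hed,
    rectIntegral_const_mul, rectIntegral_const_mul, hres 0 h0.1 h0.2.1 h0.2.2,
    hres 1 h1'.1 h1'.2.1 h1'.2.2]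
  have h3 : ∑ ρ ∈ Z, rectIntegral (fun s => (analyticOrderNatAt riemannZeta ρ : ℂ) *
      (mellin g s * (s - ρ)⁻¹)) (1 - c) c T = 2 * Real.pi * I * zeroSum g T := by
    rw [zeroSum, Finset.mul_sum]
    refine Finset.sum_congr rfl fun ρ hρ => ?_
    rw [rectIntegral_const_mul, hres ρ (hZin ρ hρ).1 (hZin ρ hρ).2.1 (hZin ρ hρ).2.2]
    ring
  rw [h3]
  ring

theorem integrable_mellin_mul_logDerivXiSub (hε : 0 < ε) (hg : IsClassEWith ε g) {c : ℝ}
    (h1 : 1 < c) (h2 : c < 1 + ε) :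
    Integrable fun t : ℝ => mellin g (c + t * I) * logDerivXiSub (c + t * I) := by
  simp_rw [mellin_mul_logDerivXiSub_eq h1]
  exact ((hg.integrable_mellin_mul_logDeriv_Gammaℝ hε (by linarith) h2).add
    (hg.integrable_mellin_mul_logDeriv_riemannZeta hε h1 h2)).neg

/-- The vertical line contributes the prime terms and the archimedean term. -/
theorem integral_mellin_mul_logDerivXiSub (hε : 0 < ε) (hg : IsClassEWith ε g) {c : ℝ}
    (h1 : 1 < c) (h2 : c < 1 + ε) :
    (∫ t : ℝ, mellin g (c + t * I) * logDerivXiSub (c + t * I)) +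
      ∫ t : ℝ, mellin (transpose g) (c + t * I) * logDerivXiSub (c + t * I) =
      -(2 * Real.pi * (∑' p : Nat.Primes, weilPrime g p + weilReal g)) := by
  have h0 : 0 < c := by linarith
  simp_rw [mellin_mul_logDerivXiSub_eq h1]
  have e := hg.integral_archimedean hε h0 h2
  have h3 : ∀ t : ℝ, -logDeriv Gammaℝ (c + t * I) *
      (mellin g (c + t * I) + mellin g (1 - (c + t * I))) =
      mellin g (c + t * I) * -logDeriv Gammaℝ (c + t * I) +
      mellin (transpose g) (c + t * I) * -logDeriv Gammaℝ (c + t * I) := fun t => by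
    rw [mellin_transpose]
    ring
  simp_rw [h3] at e
  rw [integral_add (hg.integrable_mellin_mul_logDeriv_Gammaℝ hε h0 h2)
    (hg.transpose.integrable_mellin_mul_logDeriv_Gammaℝ hε h0 h2)] at e
  rw [integral_neg, integral_neg, integral_add (hg.integrable_mellin_mul_logDeriv_Gammaℝ hε h0 h2)
    (hg.integrable_mellin_mul_logDeriv_riemannZeta hε h1 h2),
    integral_add (hg.transpose.integrable_mellin_mul_logDeriv_Gammaℝ hε h0 h2)
    (hg.transpose.integrable_mellin_mul_logDeriv_riemannZeta hε h1 h2),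
    hg.integral_mellin_mul_logDeriv_riemannZeta hε h1 h2,
    hg.transpose.integral_mellin_mul_logDeriv_riemannZeta hε h1 h2, hg.tsum_weilPrime hε]
  linear_combination -e

end IsClassEWith

/-! ### The sum over the zeros -/

/-- The number of critical zeros at heights in `[τ, τ + 1/4]` is `O(log τ)`; those to the left of
the critical line are counted through the functional equation. -/
theorem exists_sum_order_criticalZeros_le : ∃ A : ℝ, 0 < A ∧ ∀ τ : ℝ, 3 ≤ τ → ∀ F : Finset ℂ,
    (∀ ρ ∈ F, ρ ∈ criticalZeros ∧ |ρ.im| ∈ Icc τ (τ + 1 / 4)) →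
    ∑ ρ ∈ F, (analyticOrderNatAt riemannZeta ρ : ℝ) ≤ A * Real.log τ := by
  classical
  obtain ⟨A, hA, h⟩ := exists_card_zeros_le
  refine ⟨2 * A, by positivity, fun τ hτ F hF => ?_⟩
  rw [← Finset.sum_filter_add_sum_filter_not F fun ρ => 1 / 2 ≤ ρ.re]
  have h1 := h τ hτ (F.filter fun ρ => 1 / 2 ≤ ρ.re) fun ρ hρ => by
    obtain ⟨h1, h2⟩ := Finset.mem_filter.1 hρ
    obtain ⟨⟨h3, h4, h5⟩, h6⟩ := hF ρ h1
    exact ⟨h3, h2, by linarith, h6⟩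
  have h2 := h τ hτ ((F.filter fun ρ => ¬1 / 2 ≤ ρ.re).image fun ρ => 1 - ρ) fun ρ hρ => by
    obtain ⟨z, hz, rfl⟩ := Finset.mem_image.1 hρ
    obtain ⟨h1, h2⟩ := Finset.mem_filter.1 hz
    obtain ⟨h3, h6⟩ := hF z h1
    obtain ⟨h4, h5, h7⟩ := one_sub_mem_criticalZeros h3
    refine ⟨h4, ?_, by linarith, by simpa using h6⟩
    simp only [sub_re, one_re]
    linarith
  rw [Finset.sum_image (fun x _ y _ hxy => sub_right_injective hxy)] at h2
  rw [Finset.sum_congr rfl fun ρ hρ => by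
    rw [analyticOrderNatAt_riemannZeta_one_sub (hF ρ (Finset.mem_filter.1 hρ).1).1]] at h2
  linarith

theorem tendsto_log_pow_div (n : ℕ) (M : ℝ) :
    Tendsto (fun τ : ℝ => M * (Real.log τ ^ n / τ)) atTop (𝓝 0) := by
  have h1 : Tendsto (fun τ : ℝ => Real.log τ ^ n / τ) atTop (𝓝 0) :=
    (Real.isLittleO_pow_log_id_atTop (n := n)).tendsto_div_nhds_zero
  simpa using h1.const_mul M

namespace IsClassEWith

variable {ε : ℝ} {g : ℝ → ℂ}

/-- Moving the height of the truncation by at most `1/4` changes the sum over the zeros by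
`O(log τ / τ)`: there are `O(log τ)` zeros in between and the transform is `O(1 / τ)` there. -/
theorem exists_norm_zeroSum_sub_le (hε : 0 < ε) (hg : IsClassEWith ε g) :
    ∃ M : ℝ, ∀ τ T : ℝ, 3 ≤ τ → T ∈ Icc τ (τ + 1 / 4) →
      ‖zeroSum g T - zeroSum g τ‖ ≤ M * (Real.log τ / τ) := by
  classical
  obtain ⟨A, hA, h⟩ := exists_sum_order_criticalZeros_le
  obtain ⟨B, hB0, hB⟩ := hg.exists_norm_mellin_mul_abs_im_le hε
  refine ⟨B * A, fun τ T hτ hT => ?_⟩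
  have hτ0 : 0 < τ := by linarith
  have hsub : (finite_criticalZeros_lt τ).toFinset ⊆ (finite_criticalZeros_lt T).toFinset :=
    fun ρ hρ => by
      obtain ⟨h1, h2⟩ := mem_zeros_iff.1 hρ
      exact mem_zeros_iff.2 ⟨h1, h2.trans_le hT.1⟩
  set F := (finite_criticalZeros_lt T).toFinset \ (finite_criticalZeros_lt τ).toFinset
  have hF : ∀ ρ ∈ F, ρ ∈ criticalZeros ∧ |ρ.im| ∈ Icc τ (τ + 1 / 4) := fun ρ hρ => by
    obtain ⟨h1, h2⟩ := Finset.mem_sdiff.1 hρ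
    obtain ⟨h3, h4⟩ := mem_zeros_iff.1 h1
    exact ⟨h3, not_lt.1 fun h5 => h2 (mem_zeros_iff.2 ⟨h3, h5⟩), h4.le.trans hT.2⟩
  rw [zeroSum, zeroSum, ← Finset.sum_sdiff hsub, add_sub_cancel_right]
  calc _ ≤ ∑ ρ ∈ F, (analyticOrderNatAt riemannZeta ρ : ℝ) * (B / τ) := by
        refine (norm_sum_le _ _).trans (Finset.sum_le_sum fun ρ hρ => ?_)
        obtain ⟨h1, h2⟩ := hF ρ hρ
        rw [norm_mul, norm_natCast]
        gcongr
        rw [le_div_iff₀ hτ0]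
        exact (mul_le_mul_of_nonneg_left h2.1 (norm_nonneg _)).trans
          (hB ρ (by linarith [h1.2.1]) (by linarith [h1.2.2]))
    _ ≤ A * Real.log τ * (B / τ) := by
        rw [← Finset.sum_mul]
        gcongr
        exact h τ hτ F hF
    _ = _ := by ring

/-- The explicit formula. The contour argument applies at the heights `T τ ∈ [τ, τ + 1/4]` at which
the logarithmic derivative is small, and the sum changes by `o(1)` between `τ` and `T τ`. -/
theorem tendsto_zeroSum (hε : 0 < ε) (hg : IsClassEWith ε g) :
    Tendsto (fun T : ℝ => zeroSum g T) atTop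
      (𝓝 (mellin g 0 + mellin g 1 - (∑' p : Nat.Primes, weilPrime g p + weilReal g))) := by
  set W := ∑' p : Nat.Primes, weilPrime g p + weilReal g with hW
  obtain ⟨c, h1, h2, h3⟩ : ∃ c : ℝ, 1 < c ∧ c < 1 + ε ∧ c ≤ 2 :=
    ⟨1 + min (ε / 2) 1, by have := lt_min (half_pos hε) one_pos; linarith,
      by have := min_le_left (ε / 2) 1; linarith, by have := min_le_right (ε / 2) 1; linarith⟩
  obtain ⟨D, hD, hheight⟩ := exists_height_logDerivXiSub
  obtain ⟨B, hB0, hB⟩ := hg.exists_norm_mellin_mul_abs_im_le hε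
  obtain ⟨M, hM⟩ := hg.exists_norm_zeroSum_sub_le hε
  have hex : ∀ τ : ℝ, ∃ T : ℝ, 3 ≤ τ → T ∈ Icc τ (τ + 1 / 4) ∧
      ∀ s : ℂ, -1 ≤ s.re → s.re ≤ 2 → |s.im| = T →
        xi s ≠ 0 ∧ ‖logDerivXiSub s‖ ≤ D * Real.log τ ^ 2 := fun τ => by
    by_cases hτ : 3 ≤ τ
    · obtain ⟨T, hT⟩ := hheight τ hτ
      exact ⟨T, fun _ => hT⟩
    · exact ⟨0, fun h => absurd h hτ⟩
  choose T hT using hex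
  have hTtop : Tendsto T atTop atTop := by
    refine tendsto_atTop_mono' _ ?_ tendsto_id
    filter_upwards [eventually_ge_atTop 3] with τ hτ using (hT τ hτ).1.1
  -- On the vertical sides the integrand is integrable over the whole line.
  have hvert := ((intervalIntegral_tendsto_integral
    (hg.integrable_mellin_mul_logDerivXiSub hε h1 h2)
    (tendsto_neg_atTop_atBot.comp hTtop) hTtop).add (intervalIntegral_tendsto_integral
    (hg.transpose.integrable_mellin_mul_logDerivXiSub hε h1 h2)
    (tendsto_neg_atTop_atBot.comp hTtop) hTtop)).const_mul I
  rw [hg.integral_mellin_mul_logDerivXiSub hε h1 h2] at hvert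
  -- On the horizontal sides the integrand is `O(log² τ / τ)`.
  have hside : ∀ τ : ℝ, 3 ≤ τ → ∀ y : ℝ, |y| = T τ →
      ‖∫ x in (1 - c)..c, mellin g (x + y * I) * logDerivXiSub (x + y * I)‖ ≤
        (B * D * (c - (1 - c))) * (Real.log τ ^ 2 / τ) := fun τ hτ y hy => by
    have hτ0 : 0 < τ := by linarith
    obtain ⟨hT1, hT2⟩ := hT τ hτ
    have h4 : ∀ x ∈ uIoc (1 - c) c, ‖mellin g (x + y * I) * logDerivXiSub (x + y * I)‖ ≤
        (B / τ) * (D * Real.log τ ^ 2) := fun x hx => by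
      rw [uIoc_of_le (by linarith)] at hx
      have h5 := (hT2 (x + y * I) (by simp; linarith [hx.1]) (by simp; linarith [hx.2])
        (by simpa using hy)).2
      have h6 := hB (x + y * I) (by simp; linarith [hx.1]) (by simp; linarith [hx.2])
      rw [norm_mul]
      gcongr
      rw [le_div_iff₀ hτ0]
      refine (mul_le_mul_of_nonneg_left ?_ (norm_nonneg _)).trans h6
      simp [hy, hT1.1]
    refine (intervalIntegral.norm_integral_le_of_norm_le_const h4).trans (le_of_eq ?_)
    rw [abs_of_pos (by linarith)]
    ring
  -- The sign `σ` selects the lower or the upper side.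
  have hhor : ∀ σ : ℝ, |σ| = 1 → Tendsto (fun τ => ∫ x in (1 - c)..c,
      mellin g (x + (σ * T τ : ℝ) * I) * logDerivXiSub (x + (σ * T τ : ℝ) * I)) atTop (𝓝 0) :=
    fun σ hσ => by
      refine squeeze_zero_norm' ?_ (tendsto_log_pow_div 2 (B * D * (c - (1 - c))))
      filter_upwards [eventually_ge_atTop 3] with τ hτ
      refine hside τ hτ _ ?_
      rw [abs_mul, hσ, one_mul, abs_of_nonneg]
      linarith [(hT τ hτ).1.1]
  have hrect := ((hhor (-1) (by simp)).sub (hhor 1 (by simp))).add hvert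
  have hgoodlim : Tendsto (fun τ => zeroSum g (T τ)) atTop
      (𝓝 (mellin g 0 + mellin g 1 - W)) := by
    have h4 := (hrect.const_mul (2 * Real.pi * I : ℂ)⁻¹).const_add (mellin g 0 + mellin g 1)
    have hpi : (Real.pi : ℂ) ≠ 0 := by exact_mod_cast Real.pi_ne_zero
    have h5 : mellin g 0 + mellin g 1 + (2 * Real.pi * I : ℂ)⁻¹ *
        (0 - 0 + I * -(2 * Real.pi * W)) = mellin g 0 + mellin g 1 - W := by
      field_simp
      ring
    rw [h5] at h4
    refine h4.congr' ?_
    filter_upwards [eventually_ge_atTop 3] with τ hτ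
    obtain ⟨hT1, hT2⟩ := hT τ hτ
    have h6 := hg.rectIntegral_mellin_mul_logDerivXiSub hε h1 h2 (T := T τ) (by linarith [hT1.1])
      fun ρ hρ hρT => (hT2 ρ (by linarith [hρ.2.1]) (by linarith [hρ.2.2]) hρT).1
        (xi_eq_zero_iff.2 hρ)
    rw [rectIntegral_eq_horizontal_add_vertical] at h6
    simp only [neg_one_mul, one_mul, Function.comp_apply]
    rw [h6]
    field_simp
    ring
  have hdiff : Tendsto (fun τ => zeroSum g (T τ) - zeroSum g τ) atTop (𝓝 0) := by
    refine squeeze_zero_norm' ?_ (tendsto_log_pow_div 1 M)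
    filter_upwards [eventually_ge_atTop 3] with τ hτ
    rw [pow_one]
    exact hM τ (T τ) hτ (hT τ hτ).1
  simpa using hgoodlim.sub hdiff

end IsClassEWith

end ExplicitFormula

theorem mainTheorem3 :
    -- stability under multiplicative convolution (whose defining integral converges absolutely)
    (∀ g k : ℝ → ℂ, ExplicitFormula.IsClassE g → ExplicitFormula.IsClassE k →
      (∀ u : ℝ, 0 < u → IntegrableOn (fun t : ℝ => g t * k (u / t) / (t : ℂ)) (Ioi 0)) ∧
      ExplicitFormula.IsClassE (ExplicitFormula.mulConv g k)) ∧
    -- stability under the transpose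
    (∀ g : ℝ → ℂ, ExplicitFormula.IsClassE g →
      ExplicitFormula.IsClassE (ExplicitFormula.transpose g)) ∧
    -- the explicit formula
    (∀ g : ℝ → ℂ, ExplicitFormula.IsClassE g →
      ExplicitFormula.WeilTermsConverge g ∧
      ∃ S : ℂ, Tendsto (fun T : ℝ => ExplicitFormula.zeroSum g T) atTop (𝓝 S) ∧
        mellin g 0 + mellin g 1 - S =
          (∑' p : Nat.Primes, ExplicitFormula.weilPrime g p) + ExplicitFormula.weilReal g) ∧
    -- the closed form of the archimedean term
    (∀ (ε : ℝ) (g : ℝ → ℂ), 0 < ε → ExplicitFormula.IsClassEWith ε g →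
      ∀ c : ℝ, 0 < c → c < 1 + ε →
        Tendsto (fun T : ℝ => ExplicitFormula.archimedeanIntegral g c T) atTop
          (𝓝 (ExplicitFormula.weilReal g))) := by
  refine ⟨fun g k hg hk => hg.integrableOn_mulConv_and_mulConv hk, fun g hg => hg.transpose,
    ?_, fun ε g hε hg c h1 h2 => hg.tendsto_archimedeanIntegral hε h1 h2⟩
  rintro g ⟨ε, hε, hg⟩
  exact ⟨hg.weilTermsConverge hε, _, hg.tendsto_zeroSum hε, sub_sub_cancel _ _⟩
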